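/- Let $d\ge 2$ and $0<T<\infty$, and let $\mathbb{T}^d$ be the torus of period $1$. Let $V:[0,T]\times\mathbb{T}^d\to\mathbb{R}^d$ belong to $L^{p^*}([0,T];L^p(\mathbb{T}^d))$, where $\frac dp+\frac2{p^*}\le 1$, $2\le p^*<\infty$ and $d<p\le\infty$. Let $\rho_0\in L^\infty(\mathbb{T}^d)$ be nonnegative and let $g\in L^2(\mathbb{T}^d\times[0,T];\mathbb{R}^d)$. Let $\{\sigma^{1/2,\eta}\}_{\eta\in(0,1)}$ be nondecreasing functions in $C^\infty([0,\infty))$ with values in $[0,\infty)$ and $\sigma^{1/2,\eta}(0)=0$, such that: (i) there is a constant $c_1\in(0,\infty)$, independent of $\eta$, with $0\le\sigma^{1/2,\eta}(\zeta)\le c_1\sqrt\zeta$ for all $\zeta\ge0$ and $0\le(\sigma^{1/2,\eta})'(\zeta)\le c_1/\sqrt\zeta$ for all $\zeta>0$; (ii) $\sigma^{1/2,\eta}$ and $(\sigma^{1/2,\eta})'$ are bounded for each $\eta$; (iii) $\sigma^{1/2,\eta}(\zeta)\to\sqrt\zeta$ as $\eta\to0$, uniformly on compact subsets of $[0,\infty)$.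 Put $\sigma^\eta=(\sigma^{1/2,\eta})^2$. Let $V^\gamma=\tilde V\star\kappa_\gamma$ be the space-time mollification of the extension $\tilde V$ of $V$ by zero outside $[0,T]$, where $\kappa_\gamma(t,x)=\gamma^{-(d+1)}\kappa(t/\gamma,x/\gamma)$ and $\kappa\ge0$ is smooth, compactly supported and of integral one. For $\eta,\gamma\in(0,1)$, let $\rho$ be a weak solution of $$\partial_t\rho=\Delta\rho-\nabla\cdot(\sigma^{1/2,\eta}(\rho)g)-\nabla\cdot(\sigma^\eta(\rho)\,V^\gamma*\rho),\qquad \rho(0)=\rho_0,$$ that is, a nonnegative $\rho\in L^\infty([0,T];L^1(\mathbb{T}^d))\cap L^2([0,T];H^1(\mathbb{T}^d))$ such that for every $\psi\in C^\infty(\mathbb{T}^d)$ and almost every $t\in[0,T]$, $$\int\rho(t)\psi\,dx=\int\rho_0\psi\,dx-\int_0^t\!\!\int\nabla\rho\cdot\nabla\psi\,dx\,ds+\int_0^t\!\!\int\sigma^\eta(\rho)\,(V^\gamma*\rho)\cdot\nabla\psi\,dx\,ds+\int_0^t\!\!\int\sigma^{1/2,\eta}(\rho)\,g\cdot\nabla\psi\,dx\,ds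 .$$ Let $\Psi(\zeta)=\zeta\log\zeta-\zeta$, with $\Psi(0)=0$. Then $\sqrt\rho\in L^2([0,T];H^1(\mathbb{T}^d))$, and for almost every $t\in[0,T]$ the function $\Psi(\rho(\cdot,t))$ is integrable and $$\int_{\mathbb{T}^d}\Psi(\rho(x,t))\,dx+\int_0^t\|\nabla\sqrt{\rho}\|_{L^2(\mathbb{T}^d)}^2ds\le\int_{\mathbb{T}^d}\Psi(\rho_0)\,dx+c(c_1)\,\|g\|_{L^2(\mathbb{T}^d\times[0,T];\mathbb{R}^d)}^2+C .$$ Here $c(c_1)>0$ depends only on $c_1$, and $C>0$ depends only on $c_1$, $d$, the exponents $p,p^*$, $\|\rho_0\|_{L^1(\mathbb{T}^d)}$ and $\|V\|_{L^{p^*}([0,T];L^p(\mathbb{T}^d))}$. In particular, both are independent of $\eta$, $\gamma$ and $t$. -/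

import Mathlib

open MeasureTheory Set Filter Topology
open scoped ENNReal NNReal ContDiff

noncomputable section

namespace Skeleton

/-- The flat torus `𝕋ᵈ` with period `1`, with its Lebesgue (probability) measure `volume`. -/
abbrev Torus (d : ℕ) := UnitAddTorus (Fin d)

/-- `ℝᵈ` with the Euclidean norm; the values of vector fields lie here. -/
abbrev Vec (d : ℕ) := EuclideanSpace ℝ (Fin d)

/-- The covering map `ℝᵈ → 𝕋ᵈ`. -/
def proj {d : ℕ} (x : Fin d → ℝ) : Torus d := fun i => (x i : UnitAddCircle)

/-- `ψ ∈ C^∞(𝕋ᵈ)`: the periodic lift of `ψ` to `ℝᵈ` is smooth. -/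
def SmoothOnTorus {d : ℕ} (ψ : Torus d → ℝ) : Prop :=
  ContDiff ℝ ∞ (fun x : Fin d → ℝ => ψ (proj x))

/-- The `i`-th partial derivative of a function on the torus. -/
def partialDeriv {d : ℕ} (i : Fin d) (ψ : Torus d → ℝ) (x : Torus d) : ℝ :=
  deriv (fun s : ℝ => ψ (x + Pi.single i (s : UnitAddCircle))) 0

/-- The classical gradient of a function on the torus. -/
def grad {d : ℕ} (ψ : Torus d → ℝ) (x : Torus d) : Vec d :=
  WithLp.toLp 2 (fun i => partialDeriv i ψ x)

/-- `G` is the weak gradient of `f` on the torus. -/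
def IsWeakGrad {d : ℕ} (f : Torus d → ℝ) (G : Torus d → Vec d) : Prop :=
  Integrable f ∧ Integrable G ∧
    ∀ φ : Torus d → ℝ, SmoothOnTorus φ → ∀ i : Fin d,
      ∫ x, f x * partialDeriv i φ x = - ∫ x, G x i * φ x

/-- Lebesgue measure on `[0,T] × 𝕋ᵈ`. -/
def spaceTime (d : ℕ) (T : ℝ) : Measure (ℝ × Torus d) :=
  (volume.restrict (Icc (0 : ℝ) T)).prod volume

/-- The norm of `L^r([0,T]; L^p(𝕋ᵈ))`. -/
def mixedNorm {d : ℕ} {E : Type*} [NormedAddCommGroup E] (T : ℝ) (r p : ℝ≥0∞)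
    (u : ℝ → Torus d → E) : ℝ≥0∞ :=
  eLpNorm (fun t => eLpNorm (u t) p volume) r (volume.restrict (Icc (0 : ℝ) T))

/-- `u ∈ L²([0,T]; H¹(𝕋ᵈ))`, with weak spatial gradient `G`. -/
def IsL2H1WithGrad {d : ℕ} (T : ℝ) (u : ℝ → Torus d → ℝ) (G : ℝ → Torus d → Vec d) : Prop :=
  MemLp (Function.uncurry u) 2 (spaceTime d T) ∧
  MemLp (Function.uncurry G) 2 (spaceTime d T) ∧
  ∀ᵐ t ∂(volume.restrict (Icc (0 : ℝ) T)), IsWeakGrad (u t) (G t)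

/-- The interaction kernel `V : [0,T] × 𝕋ᵈ → ℝᵈ` belongs to `L^{p*}([0,T]; L^p(𝕋ᵈ))`, where
`d/p + 2/p* ≤ 1`, `2 ≤ p* < ∞` and `d < p ≤ ∞` (the Ladyzhenskaya-Prodi-Serrin condition). -/
structure LPSKernel {d : ℕ} (T : ℝ) (p pstar : ℝ≥0∞) (V : ℝ → Torus d → Vec d) : Prop where
  measurable : AEStronglyMeasurable (Function.uncurry V) (spaceTime d T)
  scaling : (d : ℝ≥0∞) / p + 2 / pstar ≤ 1
  two_le : 2 ≤ pstar
  lt_top : pstar < ⊤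
  dim_lt : (d : ℝ≥0∞) < p
  finite : mixedNorm T pstar p V < ⊤

/-- `σ η = σ^{1/2,η}`, `0 < η < 1`, is a family of smooth nondecreasing approximations of the
square root on `[0,∞)`; `c₁` is the constant in the bounds that are uniform in `η`. -/
structure SqrtApprox (c₁ : ℝ) (σ : ℝ → ℝ → ℝ) : Prop where
  pos : 0 < c₁
  smooth : ∀ η ∈ Ioo (0 : ℝ) 1, ContDiffOn ℝ ∞ (σ η) (Ici 0)
  mono : ∀ η ∈ Ioo (0 : ℝ) 1, MonotoneOn (σ η) (Ici 0)
  zero : ∀ η ∈ Ioo (0 : ℝ) 1, σ η 0 = 0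
  bound : ∀ η ∈ Ioo (0 : ℝ) 1, ∀ ζ, 0 ≤ ζ → 0 ≤ σ η ζ ∧ σ η ζ ≤ c₁ * √ζ
  deriv_nonneg : ∀ η ∈ Ioo (0 : ℝ) 1, ∀ ζ, 0 ≤ ζ → 0 ≤ derivWithin (σ η) (Ici 0) ζ
  /-- At `ζ = 0` the right-hand side is `+∞`, so there is no condition there. -/
  deriv_le : ∀ η ∈ Ioo (0 : ℝ) 1, ∀ ζ, 0 < ζ → derivWithin (σ η) (Ici 0) ζ ≤ c₁ / √ζ
  bounded : ∀ η ∈ Ioo (0 : ℝ) 1, ∃ K : ℝ, ∀ ζ, 0 ≤ ζ →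
    |σ η ζ| ≤ K ∧ |derivWithin (σ η) (Ici 0) ζ| ≤ K
  tendsto : ∀ A : Set ℝ, A ⊆ Ici 0 → IsCompact A →
    TendstoUniformlyOn σ (fun ζ => √ζ) (𝓝[>] 0) A

/-- A convolution kernel on `ℝ × ℝᵈ`: smooth, nonnegative, compactly supported, of mass one. -/
structure IsConvKernel {d : ℕ} (κ : ℝ × (Fin d → ℝ) → ℝ) : Prop where
  smooth : ContDiff ℝ ∞ κ
  nonneg : ∀ z, 0 ≤ κ z
  compact : HasCompactSupport κ
  mass : ∫ z, κ z = 1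

/-- `κ_γ(t,x) = γ^{-(d+1)} κ(t/γ, x/γ)`. -/
def scaledKernel {d : ℕ} (κ : ℝ × (Fin d → ℝ) → ℝ) (γ : ℝ) (z : ℝ × (Fin d → ℝ)) : ℝ :=
  (γ ^ (d + 1))⁻¹ * κ (γ⁻¹ • z)

/-- The space-time mollification `V^γ = Ṽ ⋆ κ_γ`, where `Ṽ` is the extension of `V` by zero outside
`[0,T]` and `κ_γ` acts on the torus through its periodization. -/
def mollify {d : ℕ} (T : ℝ) (κ : ℝ × (Fin d → ℝ) → ℝ) (γ : ℝ) (V : ℝ → Torus d → Vec d)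
    (t : ℝ) (x : Torus d) : Vec d :=
  ∫ z : ℝ × (Fin d → ℝ),
    scaledKernel κ γ z • (Icc (0 : ℝ) T).indicator (fun r => V r (x - proj z.2)) (t - z.1)

/-- Spatial convolution `(W ∗ f)(x) = ∫ W(x - y) f(y) dy` on the torus. -/
def conv {d : ℕ} (W : Torus d → Vec d) (f : Torus d → ℝ) (x : Torus d) : Vec d :=
  ∫ y, f y • W (x - y)

/-- Weak solutions on `[0,T]` of
`∂ₜρ = Δρ - ∇·(s(ρ) g) - ∇·(s(ρ)² W ∗ ρ)`, `ρ(0) = ρ₀`,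
to be used with `s = σ^{1/2,η}` and `W = V^γ`. -/
def IsWeakSolution {d : ℕ} (T : ℝ) (s : ℝ → ℝ) (W : ℝ → Torus d → Vec d)
    (g : ℝ → Torus d → Vec d) (ρ₀ : Torus d → ℝ) (ρ : ℝ → Torus d → ℝ) : Prop :=
  (∀ᵐ z ∂(spaceTime d T), 0 ≤ ρ z.1 z.2) ∧
  mixedNorm T ⊤ 1 ρ < ⊤ ∧
  ∃ G : ℝ → Torus d → Vec d, IsL2H1WithGrad T ρ G ∧
    ∀ ψ : Torus d → ℝ, SmoothOnTorus ψ → ∀ᵐ t ∂(volume.restrict (Icc (0 : ℝ) T)),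
      ∫ x, ρ t x * ψ x
        = (∫ x, ρ₀ x * ψ x)
          - (∫ r in (0 : ℝ)..t, ∫ x, inner ℝ (G r x) (grad ψ x))
          + (∫ r in (0 : ℝ)..t, ∫ x, (s (ρ r x)) ^ 2 * inner ℝ (conv (W r) (ρ r) x) (grad ψ x))
          + (∫ r in (0 : ℝ)..t, ∫ x, s (ρ r x) * inner ℝ (g r x) (grad ψ x))

/-- `Ψ(ζ) = ∫₀^ζ log ζ' dζ' = ζ log ζ - ζ` for `ζ ≥ 0`. -/
def entropyFn (ζ : ℝ) : ℝ := ζ * Real.log ζ - ζ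

end Skeleton

end

open Skeleton

/-! Formally one tests the equation with `log ρ`. To avoid the singularity of the logarithm, `Ψ(ζ)`
is replaced by `Ψ(ζ + δ)` with `0 < δ ≤ 1`, and all terms are compared with the dissipation `A = ∫
|∇ρ|² / (ρ + δ)`, uniformly in `δ`.

The `g` term costs `A/4 + c₁²‖g‖²` by Young, since `σ ≤ c₁√ρ`. The drift term is `∫ k(ρ) ∇ρ · (V^γ ∗
ρ)` with `k = σ²/(ρ + δ)` bounded by `c₁²`. As `k(ρ)∇ρ` is itself a gradient, it has mean zero, so
`V^γ ∗ ρ` may be replaced by `V^γ ∗ (ρ - M)`, where `M` is the conserved mass. Hölder bounds this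
field by `N ‖ρ - M‖_{p'}`, where `N(t)` averages the `L^p` norms of the slices of `V` against the
kernel. The Ladyzhenskaya-Prodi-Serrin condition says precisely that `p'` is admissible for
interpolation between `L¹` and `L^{d/(d-1)}` with weight `θ = 1 - 2/p*`. The Sobolev–Poincaré
inequality then gives `‖ρ - M‖_{p'} ≲ M^{1-θ} ‖∇ρ‖₁^θ`, and Cauchy–Schwarz gives `‖∇ρ‖₁² ≤ (M + δ)
A`. So the drift is at most a constant times `N A^{(1+θ)/2} = N A^{1-1/p*}`, and Young splits it
into `A/4` and a multiple of `N^{p*}` (`integral_drift_le`). The time integral of `N^{p*}` is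
bounded by the mixed norm of `V`, because averaging is a contraction (`lintegral_avgNorm_rpow_le`);
this removes `γ`. Subtracting the mean leaves no zeroth-order term in Sobolev's inequality, so that
`T` does not enter the constant.

To justify the computation, the equation is read as `∂ₜρ + ∇·F = 0` with `F ∈ L²`, and mollified in
space. The mollified density is absolutely continuous in time for every `x`, and satisfies an exact
entropy balance (`ContinuityEquation.integral_entropyFn_tconv`). When the mollification is removed,
the entropy production converges along a subsequence, while the entropies at the two end times are
compared through tangent lines of the convex `Ψ` (`ContinuityEquation.integral_entropyFn_add_le`).
Finally `δ → 0` by Fatou (`ContinuityEquation.entropy_le_of_regularized`). The limit also shows that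
`∇ρ = 0` almost everywhere on `{ρ = 0}`, so `√ρ` has weak gradient `∇ρ / (2√ρ)`. As `|∇ρ|²/ρ =
4|∇√ρ|²` away from zeros, the remaining `A/2` is more than enough. -/

instance UnitAddCircle.isProbabilityMeasure_volume :
    IsProbabilityMeasure (volume : Measure UnitAddCircle) :=
  ⟨UnitAddCircle.measure_univ⟩

/-! ### Differential calculus and integration by parts on the torus -/

section TorusCalculus

variable {d : ℕ}

/-- `u` is continuous with continuous `i`-th partial derivative `u'`. -/
structure HasPartial (i : Fin d) (u u' : Torus d → ℝ) : Prop where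
  cont : Continuous u
  cont' : Continuous u'
  deriv : ∀ x, HasDerivAt (fun s : ℝ => u (x + Pi.single i (s : UnitAddCircle))) (u' x) 0

theorem continuous_shift (i : Fin d) (x : Torus d) :
    Continuous (fun s : ℝ => x + Pi.single i (s : UnitAddCircle)) :=
  continuous_const.add ((continuous_single i).comp (AddCircle.continuous_mk' 1))

theorem shift_add (i : Fin d) (x : Torus d) (s t : ℝ) :
    x + Pi.single i ((s + t : ℝ) : UnitAddCircle)
      = (x + Pi.single i (s : UnitAddCircle)) + Pi.single i (t : UnitAddCircle) := by
  rw [AddCircle.coe_add, Pi.single_add, add_assoc]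

theorem HasPartial.hasDerivAt {i : Fin d} {u u' : Torus d → ℝ} (h : HasPartial i u u')
    (x : Torus d) (s : ℝ) :
    HasDerivAt (fun s : ℝ => u (x + Pi.single i (s : UnitAddCircle)))
      (u' (x + Pi.single i (s : UnitAddCircle))) s := by
  have h1 := h.deriv (x + Pi.single i (s : UnitAddCircle))
  have h2 : HasDerivAt (fun r : ℝ => r - s) 1 s := (hasDerivAt_id s).sub_const s
  have h3 : HasDerivAt (fun r : ℝ => u (x + Pi.single i (s : UnitAddCircle)
      + Pi.single i (r : UnitAddCircle))) (u' (x + Pi.single i (s : UnitAddCircle))) (s - s) := by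
    rw [sub_self]; exact h1
  have h4 := HasDerivAt.comp (h := fun r : ℝ => r - s) s h3 h2
  rw [mul_one] at h4
  refine h4.congr_of_eventuallyEq (Eventually.of_forall fun r => ?_)
  simp only [Function.comp]
  rw [← shift_add, add_sub_cancel]

theorem HasPartial.mul {i : Fin d} {u u' v v' : Torus d → ℝ} (hu : HasPartial i u u')
    (hv : HasPartial i v v') :
    HasPartial i (fun x => u x * v x) (fun x => u' x * v x + u x * v' x) where
  cont := hu.cont.mul hv.cont
  cont' := (hu.cont'.mul hv.cont).add (hu.cont.mul hv.cont')
  deriv x := by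
    have := (hu.deriv x).mul (hv.deriv x)
    simp only [AddCircle.coe_zero, Pi.single_zero, add_zero] at this
    exact this

theorem HasPartial.comp {i : Fin d} {u u' : Torus d → ℝ} (hu : HasPartial i u u')
    {H h : ℝ → ℝ} (hH : ∀ x, HasDerivAt H (h (u x)) (u x)) (hc : Continuous fun x => h (u x)) :
    HasPartial i (fun x => H (u x)) (fun x => h (u x) * u' x) where
  cont := continuous_iff_continuousAt.2 fun x =>
    ContinuousAt.comp (hH x).continuousAt hu.cont.continuousAt
  cont' := hc.mul hu.cont'
  deriv x := by
    have h1 : HasDerivAt H (h (u x)) (u (x + Pi.single i ((0 : ℝ) : UnitAddCircle))) := by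
      simpa using hH x
    exact h1.comp (0 : ℝ) (hu.deriv x)

theorem exists_bound_of_continuous {u : Torus d → ℝ} (hu : Continuous u) :
    ∃ C, 0 ≤ C ∧ ∀ x, |u x| ≤ C := by
  obtain ⟨C, hC⟩ := (isCompact_range hu).isBounded.exists_norm_le
  exact ⟨C, (abs_nonneg _).trans (hC _ ⟨0, rfl⟩), fun x => hC _ ⟨x, rfl⟩⟩

theorem Continuous.integrable_torus {E : Type*} [NormedAddCommGroup E] {u : Torus d → E}
    (hu : Continuous u) : Integrable u :=
  hu.integrable_of_hasCompactSupport (HasCompactSupport.of_compactSpace u)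

/-- The integral of a translate of `u` does not depend on the translation; differentiating this
constant under the integral sign gives the claim without fundamental domains or boundary terms. -/
theorem HasPartial.integral_eq_zero {i : Fin d} {u u' : Torus d → ℝ} (h : HasPartial i u u') :
    ∫ x, u' x = 0 := by
  obtain ⟨C, hC0, hC⟩ := exists_bound_of_continuous h.cont'
  have hshift : ∀ {v : Torus d → ℝ}, Continuous v → ∀ s : ℝ,
      Continuous fun x : Torus d => v (x + Pi.single i (s : UnitAddCircle)) :=
    fun hv s => hv.comp (continuous_add_const _)
  have key := (hasDerivAt_integral_of_dominated_loc_of_deriv_le (μ := (volume : Measure (Torus d)))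
    (F := fun (s : ℝ) x => u (x + Pi.single i (s : UnitAddCircle)))
    (F' := fun (s : ℝ) x => u' (x + Pi.single i (s : UnitAddCircle))) (x₀ := 0) (s := univ)
    (bound := fun _ => C) univ_mem
    (Eventually.of_forall fun s => (hshift h.cont s).aestronglyMeasurable)
    (hshift h.cont 0).integrable_torus (hshift h.cont' 0).aestronglyMeasurable
    (Eventually.of_forall fun x s _ => hC _) (integrable_const C)
    (Eventually.of_forall fun x s _ => h.hasDerivAt x s)).2
  have hconst : (fun s : ℝ => ∫ x : Torus d, u (x + Pi.single i (s : UnitAddCircle)))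
      = fun _ => ∫ x, u x := by
    funext s
    exact integral_add_right_eq_self u _
  rw [hconst] at key
  have := key.unique (hasDerivAt_const (0 : ℝ) (∫ x, u x))
  simpa using this

theorem HasPartial.integral_mul_eq_neg {i : Fin d} {u u' v v' : Torus d → ℝ}
    (hu : HasPartial i u u') (hv : HasPartial i v v') :
    ∫ x, u x * v' x = - ∫ x, u' x * v x := by
  have h := (hu.mul hv).integral_eq_zero
  have h2 := integral_add (hu.cont'.mul hv.cont).integrable_torus
    (hu.cont.mul hv.cont').integrable_torus
  simp only [Pi.mul_apply] at h2
  linarith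

theorem isOpenQuotientMap_proj : IsOpenQuotientMap (proj : (Fin d → ℝ) → Torus d) :=
  IsOpenQuotientMap.piMap (fun _ => QuotientAddGroup.isOpenQuotientMap_mk)

theorem proj_add (x y : Fin d → ℝ) : proj (x + y) = proj x + proj y := by
  funext i; exact AddCircle.coe_add _ _ _

theorem proj_sub (x y : Fin d → ℝ) : proj (x - y) = proj x - proj y := by
  funext i; exact AddCircle.coe_sub _ _ _

theorem proj_single (i : Fin d) (s : ℝ) :
    proj (Pi.single i s) = (Pi.single i (s : UnitAddCircle) : Torus d) := by
  funext j
  by_cases h : j = i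
  · subst h; simp [proj]
  · simp [proj, h]

theorem Skeleton.SmoothOnTorus.hasPartial {φ : Torus d → ℝ} (h : SmoothOnTorus φ) (i : Fin d) :
    HasPartial i φ (partialDeriv i φ) := by
  have hlift : ∀ x : Fin d → ℝ, HasDerivAt
      (fun s : ℝ => φ (proj x + Pi.single i (s : UnitAddCircle)))
      (fderiv ℝ (fun x => φ (proj x)) x (Pi.single i 1)) 0 := by
    intro x
    have h1 : HasFDerivAt (fun x => φ (proj x)) (fderiv ℝ (fun x => φ (proj x)) x)
        (x + (0 : ℝ) • Pi.single i (1 : ℝ)) := by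
      rw [zero_smul, add_zero]
      exact (h.differentiable (by simp) x).hasFDerivAt
    have h2 : HasDerivAt (fun s : ℝ => x + s • (Pi.single i (1 : ℝ) : Fin d → ℝ))
        (Pi.single i 1) 0 := by
      simpa using ((hasDerivAt_id (0 : ℝ)).smul_const (Pi.single i (1 : ℝ) : Fin d → ℝ)).const_add x
    refine (h1.comp_hasDerivAt (0 : ℝ) h2).congr_of_eventuallyEq (Eventually.of_forall fun s => ?_)
    simp only [Function.comp]
    rw [proj_add, ← Pi.single_smul, smul_eq_mul, mul_one, proj_single]
  -- Continuity on the torus is tested on the periodic lift, `proj` being a quotient map.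
  refine ⟨isOpenQuotientMap_proj.isQuotientMap.continuous_iff.2 h.continuous,
    isOpenQuotientMap_proj.isQuotientMap.continuous_iff.2 ?_, fun x => ?_⟩
  · have : (partialDeriv i φ ∘ proj) = fun x => fderiv ℝ (fun x => φ (proj x)) x (Pi.single i 1) := by
      funext x
      exact (hlift x).deriv
    rw [this]
    exact (h.continuous_fderiv (by simp)).clm_apply continuous_const
  · obtain ⟨y, rfl⟩ := isOpenQuotientMap_proj.surjective x
    exact (hlift y).differentiableAt.hasDerivAt

theorem Skeleton.SmoothOnTorus.comp_sub_left {φ : Torus d → ℝ} (h : SmoothOnTorus φ) (x : Torus d) :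
    SmoothOnTorus (fun y => φ (x - y)) := by
  obtain ⟨x, rfl⟩ := isOpenQuotientMap_proj.surjective x
  have : (fun y : Fin d → ℝ => φ (proj x - proj y)) = (fun y => φ (proj y)) ∘ fun y => x - y := by
    funext y; simp [proj_sub]
  unfold SmoothOnTorus
  rw [this]
  exact ContDiff.comp h (contDiff_const.sub contDiff_id)

theorem partialDeriv_comp_sub_left (φ : Torus d → ℝ) (i : Fin d) (x y : Torus d) :
    partialDeriv i (fun y => φ (x - y)) y = - partialDeriv i φ (x - y) := by
  unfold partialDeriv
  have : (fun s : ℝ => φ (x - (y + Pi.single i (s : UnitAddCircle))))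
      = fun s : ℝ => (fun s : ℝ => φ (x - y + Pi.single i (s : UnitAddCircle))) (-s) := by
    funext s
    simp only [AddCircle.coe_neg, Pi.single_neg]
    congr 1; abel
  rw [this]
  have h := deriv_comp_neg (fun s : ℝ => φ (x - y + Pi.single i (s : UnitAddCircle))) 0
  rw [neg_zero] at h
  exact h

theorem smoothOnTorus_const (c : ℝ) : SmoothOnTorus (fun _ : Torus d => c) := contDiff_const

theorem partialDeriv_const (i : Fin d) (c : ℝ) (x : Torus d) :
    partialDeriv i (fun _ : Torus d => c) x = 0 := by
  simp [partialDeriv]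

end TorusCalculus

/-! ### A smooth approximate identity on the torus -/

section PeakKernel

variable {d : ℕ}

/-- A smooth function on the torus with values in `[0,1]` and unique maximum at the origin. -/
noncomputable def torusPeak (d : ℕ) (x : Torus d) : ℝ := ∏ i, (1 + (fourier 1 (x i) : ℂ).re) / 2

/-- On the lift each factor is `(1 + cos 2πxᵢ)/2`. -/
theorem smoothOnTorus_torusPeak_pow (n : ℕ) : SmoothOnTorus (fun x : Torus d => torusPeak d x ^ n) := by
  unfold SmoothOnTorus torusPeak
  refine ContDiff.pow (contDiff_prod fun i _ => ?_) n
  have : (fun x : Fin d → ℝ => (1 + (fourier 1 (proj x i) : ℂ).re) / 2)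
      = fun x => (1 + Real.cos (2 * Real.pi * x i)) / 2 := by
    funext x
    have : (fourier 1 (proj x i) : ℂ) = Complex.exp ((2 * Real.pi * x i : ℝ) * Complex.I) := by
      simp only [proj]
      rw [fourier_coe_apply]
      congr 1; push_cast; ring
    rw [this, Complex.exp_ofReal_mul_I_re]
  rw [this]
  have h1 : ContDiff ℝ ∞ fun x : Fin d → ℝ => x i := contDiff_apply ℝ ℝ i
  exact (contDiff_const.add (Real.contDiff_cos.comp (contDiff_const.mul h1))).div_const 2

theorem peakFactor_mem (t : UnitAddCircle) : 0 ≤ (1 + (fourier 1 t : ℂ).re) / 2 ∧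
    (1 + (fourier 1 t : ℂ).re) / 2 ≤ 1 := by
  have h := Complex.abs_re_le_norm (fourier 1 t : ℂ)
  rw [fourier_apply, Circle.norm_coe] at h
  rw [fourier_apply]
  have := abs_le.1 h
  constructor <;> linarith

/-- A complex number of modulus one with real part `1` is `1`, and the circle embeds injectively
into the unit complex numbers. -/
theorem peakFactor_lt {t : UnitAddCircle} (ht : t ≠ 0) : (1 + (fourier 1 t : ℂ).re) / 2 < 1 := by
  refine lt_of_le_of_ne (peakFactor_mem t).2 fun h => ht ?_
  have hre : (fourier 1 t : ℂ).re = 1 := by linarith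
  have hn : ‖(fourier 1 t : ℂ)‖ = 1 := by rw [fourier_apply, Circle.norm_coe]
  have h1 : (fourier 1 t : ℂ) = 1 := by
    apply Complex.ext
    · simpa using hre
    · have := Complex.sq_norm_sub_sq_re (fourier 1 t : ℂ)
      rw [hn, hre] at this
      simpa using this.symm
  rw [fourier_apply, one_smul] at h1
  apply AddCircle.injective_toCircle (T := (1 : ℝ)) one_ne_zero
  rw [AddCircle.toCircle_zero]
  exact Subtype.ext h1

theorem torusPeak_nonneg (x : Torus d) : 0 ≤ torusPeak d x :=
  Finset.prod_nonneg fun i _ => (peakFactor_mem (x i)).1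

theorem torusPeak_zero : torusPeak d 0 = 1 := by simp [torusPeak]

theorem torusPeak_lt {x : Torus d} (hx : x ≠ 0) : torusPeak d x < torusPeak d 0 := by
  rw [torusPeak_zero]
  obtain ⟨i, hi⟩ := Function.ne_iff.1 hx
  rw [torusPeak, ← Finset.mul_prod_erase _ _ (Finset.mem_univ i)]
  calc _ ≤ (1 + (fourier 1 (x i) : ℂ).re) / 2 * 1 := by
        refine mul_le_mul_of_nonneg_left ?_ (peakFactor_mem _).1
        exact Finset.prod_le_one (fun j _ => (peakFactor_mem _).1) (fun j _ => (peakFactor_mem _).2)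
    _ < 1 := by rw [mul_one]; exact peakFactor_lt hi

theorem continuous_torusPeak : Continuous (torusPeak d) := by
  have := (smoothOnTorus_torusPeak_pow (d := d) 1)
  refine isOpenQuotientMap_proj.isQuotientMap.continuous_iff.2 ?_
  have h := this.continuous
  simp only [pow_one] at h
  exact h

theorem integral_torusPeak_pow_pos (n : ℕ) : 0 < ∫ x, torusPeak d x ^ n := by
  refine ((continuous_torusPeak.pow n).integral_pos_of_hasCompactSupport_nonneg_nonzero
    (HasCompactSupport.of_compactSpace _) (fun x => pow_nonneg (torusPeak_nonneg x) n)
    (x := 0) ?_)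
  simp [torusPeak_zero]

/-- Smooth nonnegative kernels on the torus of mass one, concentrating at the origin. -/
noncomputable def peakKernel (d n : ℕ) (x : Torus d) : ℝ := (∫ y, torusPeak d y ^ n)⁻¹ * torusPeak d x ^ n

theorem smoothOnTorus_peakKernel (n : ℕ) : SmoothOnTorus (peakKernel d n) :=
  contDiff_const.mul (smoothOnTorus_torusPeak_pow n)

theorem peakKernel_nonneg (n : ℕ) (x : Torus d) : 0 ≤ peakKernel d n x :=
  mul_nonneg (inv_nonneg.2 (integral_torusPeak_pow_pos n).le) (pow_nonneg (torusPeak_nonneg x) n)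

theorem integral_peakKernel (n : ℕ) : ∫ x, peakKernel d n x = 1 := by
  unfold peakKernel
  rw [integral_const_mul, inv_mul_cancel₀ (integral_torusPeak_pow_pos n).ne']

/-- Laplace's principle: normalized powers of a function with a strict unique maximum concentrate at
that maximum. -/
theorem tendsto_integral_peakKernel_mul {g : Torus d → ℝ} (hg : Continuous g) :
    Tendsto (fun n => ∫ x, peakKernel d n x * g x) atTop (𝓝 (g 0)) := by
  have := tendsto_setIntegral_pow_smul_of_unique_maximum_of_isCompact_of_continuousOn
    (μ := (volume : Measure (Torus d))) (x₀ := (0 : Torus d)) (s := univ) (g := g) isCompact_univ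
    continuous_torusPeak.continuousOn (fun y _ hy => torusPeak_lt hy)
    (fun x _ => torusPeak_nonneg x) (by rw [torusPeak_zero]; exact one_pos) (by simp) hg.continuousOn
  simp only [Measure.restrict_univ, smul_eq_mul] at this
  simpa only [peakKernel, mul_assoc, integral_const_mul] using this

end PeakKernel

/-! ### Square norms as integrals and Jensen's inequality -/

section Preliminaries

variable {α : Type*} [MeasurableSpace α]

theorem eLpNorm_two_sq {E : Type*} [NormedAddCommGroup E] (μ : Measure α) (f : α → E) :
    eLpNorm f 2 μ ^ 2 = ∫⁻ x, ‖f x‖ₑ ^ 2 ∂μ := by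
  have := eLpNorm_nnreal_pow_eq_lintegral (μ := μ) (f := f) (p := (2 : ℝ≥0)) two_ne_zero
  simpa using this

/-- Jensen's inequality, obtained from Hölder with the constant `1` as second factor. -/
theorem lintegral_rpow_le_of_isProbabilityMeasure (ν : Measure α) [IsProbabilityMeasure ν] {q : ℝ}
    (hq : 1 ≤ q) {h : α → ℝ≥0∞} (hh : AEMeasurable h ν) :
    (∫⁻ x, h x ∂ν) ^ q ≤ ∫⁻ x, h x ^ q ∂ν := by
  have hq0 : 0 < q := by linarith
  have key := ENNReal.lintegral_mul_norm_pow_le (μ := ν) (f := fun x => h x ^ q) (g := fun _ => 1)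
    (hh.pow_const q) aemeasurable_const (p := 1 / q) (q := 1 - 1 / q) (by positivity)
    (by rw [sub_nonneg]; exact (div_le_one hq0).2 hq) (by ring)
  simp only [ENNReal.one_rpow, mul_one, lintegral_one, measure_univ] at key
  have h1 : ∀ x, (h x ^ q) ^ (1 / q) = h x := fun x => by
    rw [← ENNReal.rpow_mul, mul_one_div_cancel hq0.ne', ENNReal.rpow_one]
  simp only [h1] at key
  calc _ ≤ ((∫⁻ x, h x ^ q ∂ν) ^ (1 / q)) ^ q := ENNReal.rpow_le_rpow key hq0.le
    _ = _ := by rw [← ENNReal.rpow_mul, one_div_mul_cancel hq0.ne', ENNReal.rpow_one]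

end Preliminaries

/-! ### Mollification on the torus -/

section TorusConvolution

variable {d : ℕ}

instance isNegInvariant_volume_torus : (volume : Measure (Torus d)).IsNegInvariant :=
  Measure.IsAddHaarMeasure.isNegInvariant_of_regular (volume : Measure (Torus d))

/-- Convolution of scalar functions on the torus. -/
noncomputable def tconv (φ f : Torus d → ℝ) (x : Torus d) : ℝ := ∫ y, f y * φ (x - y)

theorem integrable_mul_comp_sub {φ f : Torus d → ℝ} (hφ : Continuous φ) (hf : Integrable f)
    (x : Torus d) : Integrable (fun y => f y * φ (x - y)) := by
  obtain ⟨C, _, hC⟩ := exists_bound_of_continuous hφ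
  exact hf.mul_bdd (c := C) (hφ.comp (continuous_const.sub continuous_id)).aestronglyMeasurable
    (Eventually.of_forall fun _ => hC _)

theorem tconv_eq (φ f : Torus d → ℝ) (x : Torus d) : tconv φ f x = ∫ y, φ y * f (x - y) := by
  unfold tconv
  rw [← integral_sub_left_eq_self _ _ x]
  simp only [sub_sub_cancel, mul_comm]

theorem continuous_tconv {φ f : Torus d → ℝ} (hφ : Continuous φ) (hf : Integrable f) :
    Continuous (tconv φ f) := by
  obtain ⟨C, _, hC⟩ := exists_bound_of_continuous hφ
  refine continuous_of_dominated (bound := fun y => |f y| * C)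
    (fun x => (integrable_mul_comp_sub hφ hf x).aestronglyMeasurable)
    (fun x => Eventually.of_forall fun y => ?_) (hf.abs.mul_const C)
    (Eventually.of_forall fun _ => ?_)
  · rw [Real.norm_eq_abs, abs_mul]
    exact mul_le_mul_of_nonneg_left (hC _) (abs_nonneg _)
  · exact continuous_const.mul (hφ.comp (continuous_id.sub continuous_const))

theorem abs_tconv_le {φ f : Torus d → ℝ} {C : ℝ} (hC : ∀ x, |φ x| ≤ C) (hf : Integrable f)
    (x : Torus d) : |tconv φ f x| ≤ C * ∫ y, |f y| := by
  unfold tconv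
  rw [← Real.norm_eq_abs, mul_comm, ← integral_mul_const]
  refine norm_integral_le_of_norm_le (hf.abs.mul_const C) (Eventually.of_forall fun y => ?_)
  rw [Real.norm_eq_abs, abs_mul]
  exact mul_le_mul_of_nonneg_left (hC _) (abs_nonneg _)

theorem tconv_nonneg {φ f : Torus d → ℝ} (hφ : ∀ x, 0 ≤ φ x) (hf : ∀ᵐ x, 0 ≤ f x)
    (x : Torus d) : 0 ≤ tconv φ f x :=
  integral_nonneg_of_ae (hf.mono fun _ hy => mul_nonneg hy (hφ _))

theorem HasPartial.tconv {i : Fin d} {φ φ' f : Torus d → ℝ} (hφ : HasPartial i φ φ')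
    (hf : Integrable f) : HasPartial i (tconv φ f) (tconv φ' f) where
  cont := continuous_tconv hφ.cont hf
  cont' := continuous_tconv hφ.cont' hf
  deriv x := by
    obtain ⟨C, _, hC⟩ := exists_bound_of_continuous hφ.cont'
    have hsub : ∀ (s : ℝ) (y : Torus d), x + Pi.single i (s : UnitAddCircle) - y
        = (x - y) + Pi.single i (s : UnitAddCircle) := fun s y => by abel
    have key := (hasDerivAt_integral_of_dominated_loc_of_deriv_le
      (μ := (volume : Measure (Torus d)))
      (F := fun (s : ℝ) y => f y * φ (x + Pi.single i (s : UnitAddCircle) - y))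
      (F' := fun (s : ℝ) y => f y * φ' (x + Pi.single i (s : UnitAddCircle) - y))
      (x₀ := 0) (s := univ) (bound := fun y => |f y| * C) univ_mem
      (Eventually.of_forall fun s => (integrable_mul_comp_sub hφ.cont hf _).aestronglyMeasurable)
      (integrable_mul_comp_sub hφ.cont hf _)
      (integrable_mul_comp_sub hφ.cont' hf _).aestronglyMeasurable
      (Eventually.of_forall fun y s _ => ?_) (hf.abs.mul_const C)
      (Eventually.of_forall fun y s _ => ?_)).2
    · simpa [_root_.tconv] using key
    · rw [Real.norm_eq_abs, abs_mul]
      exact mul_le_mul_of_nonneg_left (hC _) (abs_nonneg _)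
    · simp only [hsub]
      exact (hφ.hasDerivAt (x - y) s).const_mul (f y)

/-- This is the definition of the weak gradient with test function `y ↦ φ (x - y)`; the reflection
and the integration by parts each contribute a minus sign. -/
theorem Skeleton.IsWeakGrad.tconv_partialDeriv {f : Torus d → ℝ} {G : Torus d → Vec d} (h : IsWeakGrad f G)
    {φ : Torus d → ℝ} (hφ : SmoothOnTorus φ) (i : Fin d) :
    tconv (partialDeriv i φ) f = tconv φ (fun y => G y i) := by
  funext x
  have := h.2.2 _ (hφ.comp_sub_left x) i
  simp only [partialDeriv_comp_sub_left, mul_neg, integral_neg, neg_inj] at this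
  exact this

theorem Skeleton.IsWeakGrad.hasPartial_tconv {f : Torus d → ℝ} {G : Torus d → Vec d} (h : IsWeakGrad f G)
    {φ : Torus d → ℝ} (hφ : SmoothOnTorus φ) (i : Fin d) :
    HasPartial i (tconv φ f) (tconv φ (fun y => G y i)) := by
  rw [← h.tconv_partialDeriv hφ i]
  exact (hφ.hasPartial i).tconv h.1

theorem tconv_sub {φ f g : Torus d → ℝ} (hφ : Continuous φ) (hf : Integrable f)
    (hg : Integrable g) : tconv φ (f - g) = tconv φ f - tconv φ g := by
  funext x
  simp only [tconv, Pi.sub_apply, sub_mul]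
  exact integral_sub (integrable_mul_comp_sub hφ hf x) (integrable_mul_comp_sub hφ hg x)

/-- Convolution with a probability density is a contraction in `L²`. -/
theorem eLpNorm_tconv_le {φ f : Torus d → ℝ} (hφ : Continuous φ) (hφ0 : ∀ x, 0 ≤ φ x)
    (hφ1 : ∫ x, φ x = 1) (hf : AEStronglyMeasurable f) :
    eLpNorm (tconv φ f) 2 volume ≤ eLpNorm f 2 volume := by
  set w : Torus d → ℝ≥0∞ := fun y => ENNReal.ofReal (φ y) with hw
  have hwm : Measurable w := hφ.measurable.ennreal_ofReal
  have hw1 : ∫⁻ y, w y = 1 := by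
    rw [hw, ← ofReal_integral_eq_lintegral_ofReal hφ.integrable_torus
      (Eventually.of_forall hφ0), hφ1, ENNReal.ofReal_one]
  -- For each `x`, Jensen is applied to the probability measure `φ(y) dy`; Tonelli and translation
  -- invariance then finish.
  have : IsProbabilityMeasure (volume.withDensity w) :=
    ⟨by rw [withDensity_apply _ MeasurableSet.univ, Measure.restrict_univ, hw1]⟩
  have hshift : ∀ x, AEStronglyMeasurable (fun y => f (x - y)) := fun x =>
    hf.comp_quasiMeasurePreserving
      (Measure.measurePreserving_sub_left volume x).quasiMeasurePreserving
  have hpt : ∀ x, ‖tconv φ f x‖ₑ ^ 2 ≤ ∫⁻ y, w y * ‖f (x - y)‖ₑ ^ 2 := by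
    intro x
    rw [tconv_eq]
    have h1 : ‖∫ y, φ y * f (x - y)‖ₑ ≤ ∫⁻ y, ‖f (x - y)‖ₑ ∂(volume.withDensity w) := by
      refine (enorm_integral_le_lintegral_enorm _).trans_eq ?_
      rw [lintegral_withDensity_eq_lintegral_mul₀ hwm.aemeasurable (hshift x).enorm]
      refine lintegral_congr fun y => ?_
      rw [enorm_mul, Real.enorm_eq_ofReal (hφ0 y)]; rfl
    have h2 := lintegral_rpow_le_of_isProbabilityMeasure (volume.withDensity w) (q := 2)
      (by norm_num) ((hshift x).enorm.mono_ac (withDensity_absolutelyContinuous _ _))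
    simp only [ENNReal.rpow_ofNat] at h2
    refine (pow_le_pow_left' h1 2).trans (h2.trans_eq ?_)
    rw [lintegral_withDensity_eq_lintegral_mul₀ hwm.aemeasurable ((hshift x).enorm.pow_const 2)]
    rfl
  have hmeas : AEMeasurable (Function.uncurry fun x y : Torus d => w y * ‖f (x - y)‖ₑ ^ 2)
      (volume.prod volume) := by
    refine (hwm.comp measurable_snd).aemeasurable.mul (AEMeasurable.pow_const ?_ 2)
    exact (hf.comp_quasiMeasurePreserving (quasiMeasurePreserving_sub volume volume)).enorm
  have hsq : eLpNorm (tconv φ f) 2 volume ^ 2 ≤ eLpNorm f 2 volume ^ 2 := by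
    rw [eLpNorm_two_sq, eLpNorm_two_sq]
    calc _ ≤ ∫⁻ x, ∫⁻ y, w y * ‖f (x - y)‖ₑ ^ 2 := lintegral_mono hpt
      _ = ∫⁻ y, ∫⁻ x, w y * ‖f (x - y)‖ₑ ^ 2 := lintegral_lintegral_swap hmeas
      _ = ∫⁻ y, w y * ∫⁻ x, ‖f x‖ₑ ^ 2 := by
          refine lintegral_congr fun y => ?_
          rw [lintegral_const_mul' _ _ ENNReal.ofReal_ne_top]
          congr 1
          exact lintegral_sub_right_eq_self (fun x => ‖f x‖ₑ ^ 2) y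
      _ = _ := by rw [lintegral_mul_const _ hwm, hw1, one_mul]
  exact le_of_not_gt fun h => absurd hsq (not_le.2 (ENNReal.pow_right_strictMono two_ne_zero h))

theorem tendsto_tconv_peakKernel_of_continuous {f : Torus d → ℝ} (hf : Continuous f)
    (x : Torus d) : Tendsto (fun n => tconv (peakKernel d n) f x) atTop (𝓝 (f x)) := by
  have := tendsto_integral_peakKernel_mul (d := d)
    (hf.comp (continuous_const.sub continuous_id) : Continuous fun y => f (x - y))
  simp only [Function.comp, sub_zero] at this
  simpa only [tconv_eq] using this

theorem continuous_peakKernel (n : ℕ) : Continuous (peakKernel d n) :=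
  continuous_const.mul (continuous_torusPeak.pow n)

theorem abs_tconv_peakKernel_le {f : Torus d → ℝ} {C : ℝ}
    (hC : ∀ᵐ x, |f x| ≤ C) (n : ℕ) (x : Torus d) : |tconv (peakKernel d n) f x| ≤ C := by
  rw [tconv_eq, ← Real.norm_eq_abs]
  have h1 : ∀ᵐ y, |f (x - y)| ≤ C :=
    (Measure.measurePreserving_sub_left volume x).quasiMeasurePreserving.ae hC
  refine (norm_integral_le_of_norm_le (g := fun y => peakKernel d n y * C)
    ((continuous_peakKernel n).integrable_torus.mul_const C) (h1.mono fun y hy => ?_)).trans_eq ?_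
  · rw [Real.norm_eq_abs, abs_mul, abs_of_nonneg (peakKernel_nonneg n y)]
    exact mul_le_mul_of_nonneg_left hy (peakKernel_nonneg n y)
  · rw [integral_mul_const, integral_peakKernel, one_mul]

/-- For continuous functions this is dominated convergence. The contraction property carries it over
to `L²` by density, with an error of three thirds. -/
theorem tendsto_eLpNorm_tconv_sub {f : Torus d → ℝ} (hf : MemLp f 2 volume) :
    Tendsto (fun n => eLpNorm (tconv (peakKernel d n) f - f) 2 volume) atTop (𝓝 0) := by
  rw [ENNReal.tendsto_atTop_zero]
  intro ε hε
  have hε3 : ε / 3 ≠ 0 := (ENNReal.div_pos hε.ne' (by norm_num)).ne'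
  obtain ⟨g, -, hfg, hgc, hg⟩ := hf.exists_hasCompactSupport_eLpNorm_sub_le (by norm_num) hε3
  have hcont : Tendsto (fun n => eLpNorm (tconv (peakKernel d n) g - g) 2 volume) atTop (𝓝 0) := by
    obtain ⟨C, hC0, hC⟩ := exists_bound_of_continuous hgc
    have h2 : Tendsto (fun n => eLpNorm (tconv (peakKernel d n) g - g) 2 volume ^ 2) atTop
        (𝓝 0) := by
      simp only [eLpNorm_two_sq]
      rw [show (0 : ℝ≥0∞) = ∫⁻ _ : Torus d, 0 by simp]
      refine tendsto_lintegral_of_dominated_convergence'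
        (fun _ => ENNReal.ofReal (2 * C) ^ 2) (fun n => ?_) (fun n => ?_)
        (by rw [lintegral_const]; simp [-ENNReal.ofReal_mul]) ?_
      · exact (((continuous_tconv (continuous_peakKernel n) hgc.integrable_torus).sub
          hgc).enorm.measurable.pow_const 2).aemeasurable
      · refine Eventually.of_forall fun x => pow_le_pow_left' ?_ 2
        rw [Real.enorm_eq_ofReal_abs]
        refine ENNReal.ofReal_le_ofReal ((abs_sub _ _).trans ?_)
        linarith [abs_tconv_peakKernel_le (Eventually.of_forall hC) n x, hC x]
      · refine Eventually.of_forall fun x => ?_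
        have h3 : Tendsto (fun n => (tconv (peakKernel d n) g - g) x) atTop (𝓝 0) := by
          have := (tendsto_tconv_peakKernel_of_continuous hgc x).sub_const (g x)
          simpa using this
        have h4 := ((continuous_enorm (E := ℝ)).tendsto 0).comp h3
        have h5 := ((ENNReal.continuous_pow 2).tendsto _).comp h4
        simp only [enorm_zero, ne_eq, OfNat.ofNat_ne_zero, not_false_eq_true, zero_pow] at h5
        exact h5
    have h6 := ((ENNReal.continuous_rpow_const (y := 1 / 2)).tendsto 0).comp h2
    rw [ENNReal.zero_rpow_of_pos (by norm_num)] at h6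
    refine h6.congr fun n => ?_
    simp only [Function.comp]
    rw [← ENNReal.rpow_natCast, ← ENNReal.rpow_mul]
    norm_num
  obtain ⟨N, hN⟩ := (ENNReal.tendsto_atTop_zero.1 hcont) (ε / 3) (pos_iff_ne_zero.2 hε3)
  refine ⟨N, fun n hn => ?_⟩
  have hfi := hf.integrable (by norm_num)
  have hgi := hg.integrable (by norm_num)
  have hk := continuous_peakKernel (d := d) n
  have hdec : tconv (peakKernel d n) f - f
      = tconv (peakKernel d n) (f - g) + ((tconv (peakKernel d n) g - g) + (g - f)) := by
    rw [tconv_sub hk hfi hgi]; abel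
  have m1 := (continuous_tconv hk (hfi.sub hgi)).aestronglyMeasurable (μ := volume)
  have m2 := ((continuous_tconv hk hgi).sub hgc).aestronglyMeasurable (μ := volume)
  have m3 := hg.1.sub hf.1
  rw [hdec]
  calc _ ≤ eLpNorm (tconv (peakKernel d n) (f - g)) 2 volume
        + (eLpNorm (tconv (peakKernel d n) g - g) 2 volume + eLpNorm (g - f) 2 volume) :=
        (eLpNorm_add_le m1 (m2.add m3) (by norm_num)).trans
          (add_le_add le_rfl (eLpNorm_add_le m2 m3 (by norm_num)))
    _ ≤ ε / 3 + (ε / 3 + ε / 3) := by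
        refine add_le_add ?_ (add_le_add (hN n hn) ?_)
        · exact (eLpNorm_tconv_le hk (peakKernel_nonneg n) (integral_peakKernel n)
            (hf.1.sub hg.1)).trans hfg
        · rw [eLpNorm_sub_comm]; exact hfg
    _ = ε := by rw [← add_assoc]; exact ENNReal.add_thirds ε

end TorusConvolution

/-! ### Functions of time: chain rule, slices, slicewise mollification -/

section TimeDependent

/-- The continuous functions `max f K` and `K` agree almost everywhere, hence everywhere on a
nondegenerate interval. -/
theorem ae_le_forall_le {T K : ℝ} (hT : 0 < T) {f : ℝ → ℝ} (hf : ContinuousOn f (Icc 0 T))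
    (h : ∀ᵐ t ∂(volume.restrict (Icc (0 : ℝ) T)), f t ≤ K) : ∀ t ∈ Icc (0 : ℝ) T, f t ≤ K := by
  have h1 : (fun t => max (f t) K) =ᵐ[volume.restrict (Icc (0 : ℝ) T)] fun _ => K :=
    h.mono fun t ht => max_eq_right ht
  have h2 := Measure.eqOn_Icc_of_ae_eq (μ := (volume : Measure ℝ)) hT.ne h1
    (hf.sup continuousOn_const) continuousOn_const
  intro t ht
  exact (le_max_left _ _).trans (h2 ht).le

theorem AbsolutelyContinuousOnInterval.lipschitzOnWith_comp {U Ψ : ℝ → ℝ} {a b : ℝ} {s : Set ℝ}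
    {K : ℝ≥0} (hU : AbsolutelyContinuousOnInterval U a b) (hΨ : LipschitzOnWith K Ψ s)
    (hs : MapsTo U (uIcc a b) s) : AbsolutelyContinuousOnInterval (fun t => Ψ (U t)) a b := by
  rw [absolutelyContinuousOnInterval_iff] at hU ⊢
  intro ε hε
  -- `K + 1` keeps the denominator positive when `K = 0`.
  obtain ⟨δ, hδ, h⟩ := hU (ε / (K + 1)) (by positivity)
  refine ⟨δ, hδ, fun E hE hlen => ?_⟩
  have h1 := h E hE hlen
  rw [lt_div_iff₀ (by positivity)] at h1
  refine lt_of_le_of_lt ?_ h1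
  rw [Finset.sum_mul]
  refine Finset.sum_le_sum fun i hi => ?_
  have hmem := hE.1 i hi
  have := hΨ.dist_le_mul _ (hs hmem.1) _ (hs hmem.2)
  nlinarith [dist_nonneg (x := U (E.2 i).1) (y := U (E.2 i).2), K.2]

/-- Chain rule for a `C¹` function of an absolutely continuous nonnegative function. -/
theorem comp_add_integral_eq {T : ℝ} {D : ℝ → ℝ} (hD : IntervalIntegrable D volume 0 T) {u₀ : ℝ}
    {Ψ ψ : ℝ → ℝ} (hpos : ∀ t ∈ Icc (0 : ℝ) T, 0 ≤ u₀ + ∫ r in (0 : ℝ)..t, D r)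
    (hΨ : ∀ z, 0 ≤ z → HasDerivAt Ψ (ψ z) z) (hψ : ContinuousOn ψ (Ici 0)) {t : ℝ}
    (ht : t ∈ Icc (0 : ℝ) T) :
    Ψ (u₀ + ∫ r in (0 : ℝ)..t, D r)
      = Ψ u₀ + ∫ s in (0 : ℝ)..t, ψ (u₀ + ∫ r in (0 : ℝ)..s, D r) * D s := by
  set U : ℝ → ℝ := fun t => u₀ + ∫ r in (0 : ℝ)..t, D r with hUdef
  have hDt : IntervalIntegrable D volume 0 t := hD.mono_set (by
    rw [uIcc_of_le ht.1, uIcc_of_le (ht.1.trans ht.2)]; exact Icc_subset_Icc le_rfl ht.2)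
  have hUac : AbsolutelyContinuousOnInterval U 0 t := by
    have h1 : AbsolutelyContinuousOnInterval (fun _ : ℝ => u₀) 0 t :=
      (LipschitzWith.const u₀).lipschitzOnWith.absolutelyContinuousOnInterval
    exact h1.fun_add (hDt.absolutelyContinuousOnInterval_intervalIntegral left_mem_uIcc)
  -- An absolutely continuous function is bounded, so only `Ψ` on `[0, R]` matters, and there it is
  -- Lipschitz. The composition is thus absolutely continuous and equals the integral of its a.e.
  -- derivative.
  obtain ⟨R, hR⟩ := hUac.exists_bound
  have hmaps : MapsTo U (uIcc 0 t) (Icc 0 R) := fun s hs => by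
    have hs' := hs
    rw [uIcc_of_le ht.1] at hs'
    exact ⟨hpos s ⟨hs'.1, hs'.2.trans ht.2⟩, (le_abs_self _).trans (hR s hs)⟩
  obtain ⟨C, hC⟩ := (isCompact_Icc (a := (0 : ℝ)) (b := R)).exists_bound_of_continuousOn
    (hψ.mono Icc_subset_Ici_self)
  have hLip : LipschitzOnWith C.toNNReal Ψ (Icc 0 R) :=
    (convex_Icc 0 R).lipschitzOnWith_of_nnnorm_hasDerivWithin_le
      (fun z hz => (hΨ z hz.1).hasDerivWithinAt) (fun z hz => by
        rw [← NNReal.coe_le_coe, coe_nnnorm]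
        exact (hC z hz).trans (Real.le_coe_toNNReal C))
  have hcomp := hUac.lipschitzOnWith_comp hLip hmaps
  have hint := hcomp.integral_deriv_eq_sub
  have hU0 : U 0 = u₀ := by simp [hUdef]
  rw [hU0] at hint
  rw [← sub_eq_iff_eq_add', ← hint]
  refine intervalIntegral.integral_congr_ae ?_
  filter_upwards [hDt.ae_hasDerivAt_integral] with s hs hs1
  have hs2 : s ∈ uIcc 0 t := uIoc_subset_uIcc hs1
  have hd : HasDerivAt U (D s) s := (hs hs2 0 left_mem_uIcc).const_add u₀
  exact ((hΨ (U s) (hmaps hs2).1).comp s hd).deriv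

variable {d : ℕ} {T : ℝ}

instance isFiniteMeasure_spaceTime : IsFiniteMeasure (spaceTime d T) := by
  unfold spaceTime; infer_instance

theorem setIntegral_spaceTime_eq {E : Type*} [NormedAddCommGroup E] [NormedSpace ℝ E]
    {f : ℝ → Torus d → E}
    (hf : Integrable (Function.uncurry f) (spaceTime d T)) {t : ℝ} (ht : t ∈ Icc (0 : ℝ) T) :
    ∫ z in Ioc 0 t ×ˢ univ, f z.1 z.2 ∂(spaceTime d T) = ∫ r in (0 : ℝ)..t, ∫ x, f r x := by
  have hsub : Ioc 0 t ⊆ Icc 0 T := fun s hs => ⟨hs.1.le, hs.2.trans ht.2⟩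
  have h1 := setIntegral_prod (fun z : ℝ × Torus d => f z.1 z.2) (s := Ioc 0 t) (t := univ)
    (μ := volume.restrict (Icc (0 : ℝ) T)) (ν := volume) hf.integrableOn
  rw [intervalIntegral.integral_of_le ht.1]
  simpa [spaceTime, Measure.restrict_restrict measurableSet_Ioc, inter_eq_left.2 hsub] using h1

theorem setIntegral_spaceTime_eq_swap {f : ℝ → Torus d → ℝ}
    (hf : Integrable (Function.uncurry f) (spaceTime d T)) {t : ℝ} (ht : t ∈ Icc (0 : ℝ) T) :
    ∫ z in Ioc 0 t ×ˢ univ, f z.1 z.2 ∂(spaceTime d T) = ∫ x, ∫ r in (0 : ℝ)..t, f r x := by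
  rw [setIntegral_spaceTime_eq hf ht]
  have hsub : Ioc 0 t ⊆ Icc 0 T := fun s hs => ⟨hs.1.le, hs.2.trans ht.2⟩
  simp only [intervalIntegral.integral_of_le ht.1]
  refine integral_integral_swap ?_
  have := hf.integrableOn (s := Ioc 0 t ×ˢ univ)
  rwa [IntegrableOn, spaceTime, ← Measure.prod_restrict,
    Measure.restrict_restrict measurableSet_Ioc, inter_eq_left.2 hsub, Measure.restrict_univ] at this

theorem ae_aestronglyMeasurable_slice {E : Type*} [NormedAddCommGroup E] {f : ℝ → Torus d → E}
    (hf : AEStronglyMeasurable (Function.uncurry f) (spaceTime d T)) :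
    ∀ᵐ t ∂(volume.restrict (Icc (0 : ℝ) T)), AEStronglyMeasurable (f t) volume :=
  hf.prodMk_left

theorem ae_memLp_two_slice {E : Type*} [NormedAddCommGroup E] {f : ℝ → Torus d → E}
    (hf : MemLp (Function.uncurry f) 2 (spaceTime d T)) :
    ∀ᵐ t ∂(volume.restrict (Icc (0 : ℝ) T)), MemLp (f t) 2 volume := by
  have h1 : ∫⁻ z, ‖f z.1 z.2‖ₑ ^ 2 ∂(spaceTime d T) < ⊤ := by
    have := eLpNorm_two_sq (spaceTime d T) (Function.uncurry f)
    rw [show (∫⁻ z, ‖f z.1 z.2‖ₑ ^ 2 ∂(spaceTime d T))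
      = ∫⁻ z, ‖Function.uncurry f z‖ₑ ^ 2 ∂(spaceTime d T) from rfl, ← this]
    exact ENNReal.pow_lt_top hf.2
  have hm : AEMeasurable (fun z : ℝ × Torus d => ‖f z.1 z.2‖ₑ ^ 2) (spaceTime d T) :=
    hf.1.enorm.pow_const 2
  rw [spaceTime, lintegral_prod _ hm] at h1
  filter_upwards [ae_lt_top' hm.lintegral_prod_right' h1.ne, ae_aestronglyMeasurable_slice hf.1]
    with t ht hmt
  refine ⟨hmt, ?_⟩
  have := eLpNorm_two_sq volume (f t)
  rw [← this] at ht
  exact (ENNReal.pow_lt_top_iff.1 ht).resolve_right two_ne_zero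

theorem Skeleton.memLp_apply {α : Type*} [MeasurableSpace α] {μ : Measure α} {p : ℝ≥0∞}
    {F : α → Vec d} (hF : MemLp F p μ) (i : Fin d) : MemLp (fun z => F z i) p μ :=
  (EuclideanSpace.proj (𝕜 := ℝ) i : Vec d →L[ℝ] ℝ).comp_memLp' hF

theorem aestronglyMeasurable_tconv {φ : Torus d → ℝ} (hφ : Continuous φ) {f : ℝ → Torus d → ℝ}
    (hf : AEStronglyMeasurable (Function.uncurry f) (spaceTime d T)) :
    AEStronglyMeasurable (fun z : ℝ × Torus d => tconv φ (f z.1) z.2) (spaceTime d T) := by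
  have h1 : Measure.QuasiMeasurePreserving (fun z : (ℝ × Torus d) × Torus d => (z.1.1, z.2))
      ((spaceTime d T).prod volume) (spaceTime d T) :=
    QuasiMeasurePreserving.prodMap Measure.quasiMeasurePreserving_fst
      (Measure.QuasiMeasurePreserving.id _)
  have h2 : Continuous fun z : (ℝ × Torus d) × Torus d => φ (z.1.2 - z.2) :=
    hφ.comp (by fun_prop)
  exact ((hf.comp_quasiMeasurePreserving h1).mul h2.aestronglyMeasurable).integral_prod_right'

/-- Almost every slice converges in `L²`, and the contraction property dominates the squared slice
error by `4‖f(t)‖₂²`, which is integrable in time. -/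
theorem tendsto_eLpNorm_tconv_sub_spaceTime {f : ℝ → Torus d → ℝ}
    (hf : MemLp (Function.uncurry f) 2 (spaceTime d T)) :
    Tendsto (fun n => eLpNorm (fun z : ℝ × Torus d => tconv (peakKernel d n) (f z.1) z.2 - f z.1 z.2)
      2 (spaceTime d T)) atTop (𝓝 0) := by
  have hm : ∀ n, AEMeasurable (fun z : ℝ × Torus d =>
      ‖tconv (peakKernel d n) (f z.1) z.2 - f z.1 z.2‖ₑ ^ 2) (spaceTime d T) := fun n =>
    ((aestronglyMeasurable_tconv (continuous_peakKernel n) hf.1).sub hf.1).enorm.pow_const 2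
  have hm0 : AEMeasurable (fun z : ℝ × Torus d => ‖f z.1 z.2‖ₑ ^ 2) (spaceTime d T) :=
    hf.1.enorm.pow_const 2
  have hfin : ∫⁻ z, ‖f z.1 z.2‖ₑ ^ 2 ∂(spaceTime d T) < ⊤ := by
    have := eLpNorm_two_sq (spaceTime d T) (Function.uncurry f)
    rw [show (∫⁻ z, ‖f z.1 z.2‖ₑ ^ 2 ∂(spaceTime d T))
      = ∫⁻ z, ‖Function.uncurry f z‖ₑ ^ 2 ∂(spaceTime d T) from rfl, ← this]
    exact ENNReal.pow_lt_top hf.2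
  have key : Tendsto (fun n => eLpNorm
      (fun z : ℝ × Torus d => tconv (peakKernel d n) (f z.1) z.2 - f z.1 z.2)
      2 (spaceTime d T) ^ 2) atTop (𝓝 0) := by
    simp only [eLpNorm_two_sq]
    simp_rw [spaceTime] at hm hm0 hfin ⊢
    simp_rw [fun n => lintegral_prod _ (hm n)]
    rw [lintegral_prod _ hm0] at hfin
    rw [show (0 : ℝ≥0∞) = ∫⁻ _ : ℝ, 0 ∂(volume.restrict (Icc (0 : ℝ) T)) by simp]
    refine tendsto_lintegral_of_dominated_convergence' (fun t => 4 * ∫⁻ x, ‖f t x‖ₑ ^ 2)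
      (fun n => (hm n).lintegral_prod_right') (fun n => ?_) ?_ ?_
    · filter_upwards [ae_memLp_two_slice hf] with t ht
      have hfi := ht.integrable (by norm_num)
      have h1 := eLpNorm_sub_le
        ((continuous_tconv (continuous_peakKernel n) hfi).aestronglyMeasurable (μ := volume))
        ht.1 (p := 2) (by norm_num)
      have h2 := eLpNorm_tconv_le (continuous_peakKernel n) (peakKernel_nonneg n)
        (integral_peakKernel n) ht.1
      have h3 := pow_le_pow_left' (h1.trans (add_le_add h2 le_rfl)) 2
      rw [← two_mul, mul_pow, eLpNorm_two_sq, eLpNorm_two_sq] at h3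
      norm_num at h3
      exact h3
    · rw [lintegral_const_mul' _ _ (by norm_num)]
      exact ENNReal.mul_ne_top (by norm_num) hfin.ne
    · filter_upwards [ae_memLp_two_slice hf] with t ht
      have h1 := ((ENNReal.continuous_pow 2).tendsto _).comp (tendsto_eLpNorm_tconv_sub ht)
      simp only [ne_eq, OfNat.ofNat_ne_zero, not_false_eq_true, zero_pow] at h1
      refine h1.congr fun n => ?_
      simp only [Function.comp, eLpNorm_two_sq, Pi.sub_apply]
  have h6 := ((ENNReal.continuous_rpow_const (y := 1 / 2)).tendsto 0).comp key
  rw [ENNReal.zero_rpow_of_pos (by norm_num)] at h6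
  refine h6.congr fun n => ?_
  simp only [Function.comp]
  rw [← ENNReal.rpow_natCast, ← ENNReal.rpow_mul]
  norm_num

end TimeDependent

/-! ### The mollified continuity equation and its entropy balance -/

section ContinuityEquation

variable {d : ℕ} {T : ℝ} {ρ₀ : Torus d → ℝ} {ρ : ℝ → Torus d → ℝ} {G F : ℝ → Torus d → Vec d}

/-- `ρ ≥ 0` is a weak solution of `∂ₜρ + ∇·F = 0`, `ρ(0) = ρ₀`, with square integrable flux `F` and
weak gradient `G`. -/
structure ContinuityEquation (T : ℝ) (ρ₀ : Torus d → ℝ) (ρ : ℝ → Torus d → ℝ)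
    (G F : ℝ → Torus d → Vec d) : Prop where
  pos : 0 < T
  nonneg : ∀ᵐ z ∂(spaceTime d T), 0 ≤ ρ z.1 z.2
  init : MemLp ρ₀ ⊤ volume
  init_nonneg : ∀ᵐ x, 0 ≤ ρ₀ x
  l2h1 : IsL2H1WithGrad T ρ G
  flux : MemLp (Function.uncurry F) 2 (spaceTime d T)
  weak : ∀ ψ : Torus d → ℝ, SmoothOnTorus ψ → ∀ᵐ t ∂(volume.restrict (Icc (0 : ℝ) T)),
    ∫ x, ρ t x * ψ x
      = (∫ x, ρ₀ x * ψ x) + ∫ r in (0 : ℝ)..t, ∫ x, inner ℝ (F r x) (grad ψ x)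

/-- The convolution of `-∇·F` with `φ`. -/
noncomputable def fluxDiv (φ : Torus d → ℝ) (F : ℝ → Torus d → Vec d) (s : ℝ) (x : Torus d) : ℝ :=
  -∑ i, tconv (partialDeriv i φ) (fun y => F s y i) x

/-- The `L¹` norms of the components of `F`, weighted by bounds of the derivatives of a kernel. -/
noncomputable def fluxBound (C : Fin d → ℝ) (F : ℝ → Torus d → Vec d) (s : ℝ) : ℝ :=
  ∑ i, C i * ∫ y, |F s y i|

theorem integrable_component (hF : MemLp (Function.uncurry F) 2 (spaceTime d T)) (i : Fin d) :
    Integrable (fun z : ℝ × Torus d => F z.1 z.2 i) (spaceTime d T) :=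
  (memLp_apply hF i).integrable (by norm_num)

theorem integrable_fluxBound (hF : MemLp (Function.uncurry F) 2 (spaceTime d T)) (C : Fin d → ℝ) :
    Integrable (fluxBound C F) (volume.restrict (Icc (0 : ℝ) T)) := by
  unfold fluxBound
  exact integrable_finsetSum _ fun i _ =>
    ((integrable_component hF i).abs.integral_prod_left).const_mul (C i)

theorem abs_fluxDiv_le {φ : Torus d → ℝ} {C : Fin d → ℝ} (hC : ∀ i x, |partialDeriv i φ x| ≤ C i)
    {s : ℝ} (hF : MemLp (F s) 2 volume) (x : Torus d) : |fluxDiv φ F s x| ≤ fluxBound C F s := by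
  unfold fluxDiv fluxBound
  rw [abs_neg]
  refine (Finset.abs_sum_le_sum_abs _ _).trans (Finset.sum_le_sum fun i _ => ?_)
  exact abs_tconv_le (hC i) ((memLp_apply hF i).integrable (by norm_num)) x

theorem exists_bound_partialDeriv {φ : Torus d → ℝ} (hφ : SmoothOnTorus φ) :
    ∃ C : Fin d → ℝ, ∀ i x, |partialDeriv i φ x| ≤ C i := by
  choose C _ hC using fun i => exists_bound_of_continuous (hφ.hasPartial i).cont'
  exact ⟨C, hC⟩

theorem integrable_fluxDiv (hF : MemLp (Function.uncurry F) 2 (spaceTime d T))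
    {φ : Torus d → ℝ} (hφ : SmoothOnTorus φ) :
    Integrable (Function.uncurry (fluxDiv φ F)) (spaceTime d T) := by
  obtain ⟨C, hC⟩ := exists_bound_partialDeriv hφ
  have hm : AEStronglyMeasurable (Function.uncurry (fluxDiv φ F)) (spaceTime d T) := by
    refine AEStronglyMeasurable.neg ?_
    exact Finset.aestronglyMeasurable_fun_sum _ fun i _ =>
      aestronglyMeasurable_tconv (f := fun s y => F s y i) (hφ.hasPartial i).cont'
        (integrable_component hF i).1
  refine ((integrable_fluxBound hF C).comp_fst volume).mono' hm ?_
  have h1 := Measure.quasiMeasurePreserving_fst (μ := volume.restrict (Icc (0 : ℝ) T))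
    (ν := (volume : Measure (Torus d))) |>.ae (ae_memLp_two_slice hF)
  filter_upwards [h1] with z hz
  exact abs_fluxDiv_le hC hz z.2

theorem integrable_fluxDiv_slice (hF : MemLp (Function.uncurry F) 2 (spaceTime d T))
    {φ : Torus d → ℝ} (hφ : SmoothOnTorus φ) (x : Torus d) :
    Integrable (fun s => fluxDiv φ F s x) (volume.restrict (Icc (0 : ℝ) T)) := by
  obtain ⟨C, hC⟩ := exists_bound_partialDeriv hφ
  refine (integrable_fluxBound hF C).mono' ?_
    ((ae_memLp_two_slice hF).mono fun s hs => abs_fluxDiv_le hC hs x)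
  refine AEStronglyMeasurable.neg (Finset.aestronglyMeasurable_fun_sum _ fun i _ => ?_)
  unfold tconv
  refine AEStronglyMeasurable.integral_prod_right' (ν := volume)
    (f := fun z : ℝ × Torus d => F z.1 z.2 i * partialDeriv i φ (x - z.2)) ?_
  exact (integrable_component hF i).1.mul
    ((hφ.hasPartial i).cont'.comp (by fun_prop)).aestronglyMeasurable

theorem continuous_fluxDiv {φ : Torus d → ℝ} (hφ : SmoothOnTorus φ) {s : ℝ}
    (hF : MemLp (F s) 2 volume) : Continuous (fluxDiv φ F s) :=
  (continuous_finsetSum _ fun i _ => continuous_tconv (hφ.hasPartial i).cont'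
    ((memLp_apply hF i).integrable (by norm_num))).neg

theorem integral_inner_grad_comp_sub {φ : Torus d → ℝ} (hφ : SmoothOnTorus φ) {s : ℝ}
    (hF : MemLp (F s) 2 volume) (x : Torus d) :
    ∫ y, inner ℝ (F s y) (grad (fun y => φ (x - y)) y) = fluxDiv φ F s x := by
  have h1 : ∀ y, inner ℝ (F s y) (grad (fun y => φ (x - y)) y)
      = ∑ i, -(F s y i * partialDeriv i φ (x - y)) := fun y => by
    rw [PiLp.inner_apply]
    refine Finset.sum_congr rfl fun i _ => ?_
    simp only [grad, partialDeriv_comp_sub_left, RCLike.inner_apply, conj_trivial]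
    ring
  simp only [h1, Finset.sum_neg_distrib]
  rw [integral_neg, integral_finsetSum _ fun i _ => integrable_mul_comp_sub
    (hφ.hasPartial i).cont' ((memLp_apply hF i).integrable (by norm_num)) x]
  rfl

theorem ae_Icc_mem : ∀ᵐ t ∂(volume.restrict (Icc (0 : ℝ) T)), t ∈ Icc (0 : ℝ) T :=
  ae_restrict_mem measurableSet_Icc

theorem ae_uIoc_of_ae_Icc {p : ℝ → Prop} (h : ∀ᵐ s ∂(volume.restrict (Icc (0 : ℝ) T)), p s) {t : ℝ}
    (ht : t ∈ Icc (0 : ℝ) T) : ∀ᵐ s, s ∈ uIoc 0 t → p s := by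
  rw [ae_restrict_iff' measurableSet_Icc] at h
  filter_upwards [h] with s hs hst
  rw [uIoc_of_le ht.1] at hst
  exact hs ⟨hst.1.le, hst.2.trans ht.2⟩

theorem Integrable.intervalIntegrable_of_mem_Icc {E : Type*} [NormedAddCommGroup E] {f : ℝ → E}
    (hf : Integrable f (volume.restrict (Icc (0 : ℝ) T))) {t : ℝ}
    (ht : t ∈ Icc (0 : ℝ) T) : IntervalIntegrable f volume 0 t := by
  rw [intervalIntegrable_iff_integrableOn_Ioc_of_le ht.1]
  exact IntegrableOn.mono_set hf fun s hs => ⟨hs.1.le, hs.2.trans ht.2⟩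

theorem hasDerivAt_entropyFn_add {δ : ℝ} (hδ : 0 < δ) {z : ℝ} (hz : 0 ≤ z) :
    HasDerivAt (fun z => entropyFn (z + δ)) (Real.log (z + δ)) z := by
  unfold entropyFn
  have h0 : z + δ ≠ 0 := by positivity
  have h1 : HasDerivAt (fun z : ℝ => z + δ) 1 z := (hasDerivAt_id z).add_const δ
  have h2 := (h1.mul (h1.log h0)).sub h1
  rw [one_mul, mul_one_div_cancel h0, add_sub_cancel_right] at h2
  exact h2

theorem hasDerivAt_log_add {δ : ℝ} (hδ : 0 < δ) {z : ℝ} (hz : 0 ≤ z) :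
    HasDerivAt (fun z => Real.log (z + δ)) (z + δ)⁻¹ z := by
  have h0 : z + δ ≠ 0 := by positivity
  have h1 : HasDerivAt (fun z : ℝ => z + δ) 1 z := (hasDerivAt_id z).add_const δ
  simpa using h1.log h0

namespace ContinuityEquation

theorem ae_nonneg (h : ContinuityEquation T ρ₀ ρ G F) :
    ∀ᵐ t ∂(volume.restrict (Icc (0 : ℝ) T)), ∀ᵐ x, 0 ≤ ρ t x :=
  Measure.ae_ae_of_ae_prod h.nonneg

theorem ae_memLp (h : ContinuityEquation T ρ₀ ρ G F) :
    ∀ᵐ t ∂(volume.restrict (Icc (0 : ℝ) T)), MemLp (ρ t) 2 volume :=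
  ae_memLp_two_slice h.l2h1.1

/-- Conservation of mass: the test function is the constant `1`. -/
theorem integral_eq (h : ContinuityEquation T ρ₀ ρ G F) :
    ∀ᵐ t ∂(volume.restrict (Icc (0 : ℝ) T)), ∫ x, ρ t x = ∫ x, ρ₀ x := by
  filter_upwards [h.weak _ (smoothOnTorus_const 1)] with t ht
  have hg : ∀ x : Torus d, grad (fun _ : Torus d => (1 : ℝ)) x = 0 := fun x => by
    ext i; simp [grad, partialDeriv_const]
  simpa [hg] using ht

theorem init_integrable (h : ContinuityEquation T ρ₀ ρ G F) : Integrable ρ₀ :=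
  h.init.integrable (by simp)

/-- Testing with `φ (x - ·)` yields the identity outside a null set of times that depends on `x`.
Taking `x` in a countable dense set and using continuity of both sides in `x` gives one null set for
all `x`. -/
theorem tconv_eq (h : ContinuityEquation T ρ₀ ρ G F) {φ : Torus d → ℝ} (hφ : SmoothOnTorus φ) :
    ∀ᵐ t ∂(volume.restrict (Icc (0 : ℝ) T)), ∀ x,
      tconv φ (ρ t) x = tconv φ ρ₀ x + ∫ s in (0 : ℝ)..t, fluxDiv φ F s x := by
  have hφc := (hφ.continuous : Continuous fun x => φ (proj x))
  have hφc : Continuous φ := isOpenQuotientMap_proj.isQuotientMap.continuous_iff.2 hφc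
  have hFs := ae_memLp_two_slice h.flux
  have h1 : ∀ x, ∀ᵐ t ∂(volume.restrict (Icc (0 : ℝ) T)),
      tconv φ (ρ t) x = tconv φ ρ₀ x + ∫ s in (0 : ℝ)..t, fluxDiv φ F s x := by
    intro x
    filter_upwards [h.weak _ (hφ.comp_sub_left x), ae_Icc_mem] with t ht htm
    unfold tconv
    rw [ht]
    congr 1
    refine intervalIntegral.integral_congr_ae ?_
    filter_upwards [ae_uIoc_of_ae_Icc hFs htm] with s hs hst
    exact integral_inner_grad_comp_sub hφ (hs hst) x
  obtain ⟨S, hSc, hSd⟩ := TopologicalSpace.exists_countable_dense (Torus d)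
  obtain ⟨C, hC⟩ := exists_bound_partialDeriv hφ
  filter_upwards [(ae_ball_iff hSc).2 fun x _ => h1 x, ae_Icc_mem, h.ae_memLp] with t ht htm hρ
  have hcont : Continuous fun x => tconv φ ρ₀ x + ∫ s in (0 : ℝ)..t, fluxDiv φ F s x := by
    refine (continuous_tconv hφc h.init_integrable).add ?_
    refine intervalIntegral.continuous_of_dominated_interval (bound := fluxBound C F)
      (fun x => ?_) (fun x => ?_) ?_ ?_
    · refine (integrable_fluxDiv_slice h.flux hφ x).1.mono_measure (Measure.restrict_mono ?_ le_rfl)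
      rw [uIoc_of_le htm.1]
      exact fun s hs => ⟨hs.1.le, hs.2.trans htm.2⟩
    · filter_upwards [ae_uIoc_of_ae_Icc hFs htm] with s hs hst
      exact abs_fluxDiv_le hC (hs hst) x
    · exact Integrable.intervalIntegrable_of_mem_Icc (integrable_fluxBound h.flux C) htm
    · filter_upwards [ae_uIoc_of_ae_Icc hFs htm] with s hs hst
      exact continuous_fluxDiv hφ (hs hst)
  exact fun x => congrFun (Continuous.ext_on hSd
    (continuous_tconv hφc (hρ.integrable (by norm_num))) hcont ht) x

theorem abs_tconv_le_of_bound (h : ContinuityEquation T ρ₀ ρ G F) {φ : Torus d → ℝ} {C : ℝ}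
    (hC : ∀ x, |φ x| ≤ C) :
    ∀ᵐ t ∂(volume.restrict (Icc (0 : ℝ) T)), ∀ x, |tconv φ (ρ t) x| ≤ C * ∫ x, ρ₀ x := by
  filter_upwards [h.ae_memLp, h.integral_eq, h.ae_nonneg] with t h1 h2 h3 x
  rw [← h2, ← integral_congr_ae (h3.mono fun y hy => abs_of_nonneg hy)]
  exact abs_tconv_le hC (h1.integrable (by norm_num)) x

/-- The entropy balance for the mollified solution. -/
theorem integral_entropyFn_tconv (h : ContinuityEquation T ρ₀ ρ G F) {φ : Torus d → ℝ}
    (hφ : SmoothOnTorus φ) (hφ0 : ∀ x, 0 ≤ φ x) {δ : ℝ} (hδ : 0 < δ) :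
    ∀ᵐ t ∂(volume.restrict (Icc (0 : ℝ) T)),
      ∫ x, entropyFn (tconv φ (ρ t) x + δ) = (∫ x, entropyFn (tconv φ ρ₀ x + δ))
        + ∫ r in (0 : ℝ)..t, ∫ x, ∑ i, (tconv φ (ρ r) x + δ)⁻¹ *
            (tconv φ (fun y => G r y i) x * tconv φ (fun y => F r y i) x) := by
  have hφc := (hφ.continuous : Continuous fun x => φ (proj x))
  have hφc : Continuous φ := isOpenQuotientMap_proj.isQuotientMap.continuous_iff.2 hφc
  obtain ⟨C, hC0, hC⟩ := exists_bound_of_continuous hφc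
  have hFs := ae_memLp_two_slice h.flux
  have hGs := ae_memLp_two_slice h.l2h1.2.1
  have hconv := h.tconv_eq hφ
  have hu0 : ∀ t x, (∀ᵐ x, 0 ≤ ρ t x) → 0 ≤ tconv φ (ρ t) x := fun t x ht => tconv_nonneg hφ0 ht x
  have hDint := integrable_fluxDiv h.flux hφ
  -- integrability of the entropy production
  have hint : Integrable (Function.uncurry fun s x =>
      Real.log (tconv φ (ρ s) x + δ) * fluxDiv φ F s x) (spaceTime d T) := by
    have hlogc : ContinuousOn (fun z => Real.log (z + δ)) (Icc 0 (C * ∫ x, ρ₀ x)) := fun z hz =>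
      (hasDerivAt_log_add hδ hz.1).continuousAt.continuousWithinAt
    obtain ⟨K, hK⟩ := isCompact_Icc.exists_bound_of_continuousOn hlogc
    refine hDint.bdd_mul (c := K) ?_ ?_
    · exact (Real.measurable_log.comp_aemeasurable ((aestronglyMeasurable_tconv hφc
        h.l2h1.1.1).aemeasurable.add_const δ)).aestronglyMeasurable
    · have h1 := Measure.quasiMeasurePreserving_fst (μ := volume.restrict (Icc (0 : ℝ) T))
        (ν := (volume : Measure (Torus d))) |>.ae
        ((h.abs_tconv_le_of_bound hC).and h.ae_nonneg)
      filter_upwards [h1] with z hz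
      exact hK _ ⟨hu0 _ _ hz.2, (le_abs_self _).trans (hz.1 z.2)⟩
  -- the slices in time of `D` are integrable for every `x`
  have hDx : ∀ x, Integrable (fun s => fluxDiv φ F s x) (volume.restrict (Icc (0 : ℝ) T)) := by
    exact integrable_fluxDiv_slice h.flux hφ
  -- The chain rule needs nonnegativity at every time. At almost every time the expression is the
  -- mollified density; continuity of the primitive does the rest.
  have hUpos : ∀ x, ∀ t ∈ Icc (0 : ℝ) T,
      0 ≤ tconv φ ρ₀ x + ∫ s in (0 : ℝ)..t, fluxDiv φ F s x := by
    intro x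
    have hTm : T ∈ Icc (0 : ℝ) T := ⟨h.pos.le, le_rfl⟩
    have hI := Integrable.intervalIntegrable_of_mem_Icc (hDx x) hTm
    have hcont : ContinuousOn (fun t => -(tconv φ ρ₀ x + ∫ s in (0 : ℝ)..t, fluxDiv φ F s x))
        (Icc 0 T) := by
      have := intervalIntegral.continuousOn_primitive_interval (μ := volume)
        (f := fun s => fluxDiv φ F s x) (a := 0) (b := T)
        (by rw [uIcc_of_le h.pos.le]; exact hDx x)
      rw [uIcc_of_le h.pos.le] at this
      exact (continuousOn_const.add this).neg
    have := ae_le_forall_le (K := 0) h.pos hcont (by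
      filter_upwards [hconv, h.ae_nonneg] with t ht1 ht2
      rw [← ht1 x]
      exact neg_nonpos.2 (hu0 _ _ ht2))
    exact fun t ht => neg_nonpos.1 (this t ht)
  filter_upwards [hconv, ae_Icc_mem] with t ht htm
  have hTm : T ∈ Icc (0 : ℝ) T := ⟨h.pos.le, le_rfl⟩
  have hchain : ∀ x, entropyFn (tconv φ (ρ t) x + δ) = entropyFn (tconv φ ρ₀ x + δ)
      + ∫ s in (0 : ℝ)..t, Real.log (tconv φ (ρ s) x + δ) * fluxDiv φ F s x := by
    intro x
    rw [ht x]
    rw [comp_add_integral_eq (Ψ := fun z => entropyFn (z + δ)) (ψ := fun z => Real.log (z + δ))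
      (Integrable.intervalIntegrable_of_mem_Icc (hDx x) hTm) (hUpos x)
      (fun z hz => hasDerivAt_entropyFn_add hδ hz)
      (fun z hz => (hasDerivAt_log_add hδ hz).continuousAt.continuousWithinAt) htm]
    congr 1
    refine intervalIntegral.integral_congr_ae ?_
    filter_upwards [ae_uIoc_of_ae_Icc hconv htm] with s hs hst
    rw [hs hst x]
  simp only [hchain]
  have hInt0 : Integrable fun x => entropyFn (tconv φ ρ₀ x + δ) := by
    refine Continuous.integrable_torus (continuous_iff_continuousAt.2 fun x => ?_)
    exact ContinuousAt.comp (g := fun z => entropyFn (z + δ))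
      (hasDerivAt_entropyFn_add hδ (tconv_nonneg hφ0 h.init_nonneg x)).continuousAt
      (continuous_tconv hφc h.init_integrable).continuousAt
  have hInt1 : Integrable fun x =>
      ∫ s in (0 : ℝ)..t, Real.log (tconv φ (ρ s) x + δ) * fluxDiv φ F s x := by
    have h2 := hint.integrableOn (s := Ioc 0 t ×ˢ univ)
    have hsub : Ioc 0 t ⊆ Icc 0 T := fun s hs => ⟨hs.1.le, hs.2.trans htm.2⟩
    rw [IntegrableOn, spaceTime, ← Measure.prod_restrict,
      Measure.restrict_restrict measurableSet_Ioc, inter_eq_left.2 hsub,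
      Measure.restrict_univ] at h2
    simp only [intervalIntegral.integral_of_le htm.1]
    exact h2.integral_prod_right
  rw [integral_add hInt0 hInt1, ← setIntegral_spaceTime_eq_swap hint htm,
    setIntegral_spaceTime_eq hint htm]
  congr 1
  refine intervalIntegral.integral_congr_ae ?_
  have hall := h.ae_memLp.and (h.ae_nonneg.and (hFs.and (hGs.and h.l2h1.2.2)))
  filter_upwards [ae_uIoc_of_ae_Icc hall htm] with s hs hst
  obtain ⟨h1, h2, h3, h4, h5⟩ := hs hst
  have hFi : ∀ i, Integrable fun y => F s y i := fun i =>
    (memLp_apply h3 i).integrable (by norm_num)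
  have hlogP : ∀ i, HasPartial i (fun x => Real.log (tconv φ (ρ s) x + δ))
      (fun x => (tconv φ (ρ s) x + δ)⁻¹ * tconv φ (fun y => G s y i) x) := fun i =>
    (h5.hasPartial_tconv hφ i).comp (H := fun z => Real.log (z + δ)) (h := fun z => (z + δ)⁻¹)
      (fun x => hasDerivAt_log_add hδ (hu0 s x h2))
      (((continuous_tconv hφc h5.1).add continuous_const).inv₀
        fun x => (add_pos_of_nonneg_of_pos (hu0 s x h2) hδ).ne')
  have hFP : ∀ i, HasPartial i (tconv φ fun y => F s y i)
      (tconv (partialDeriv i φ) fun y => F s y i) := fun i => (hφ.hasPartial i).tconv (hFi i)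
  rw [integral_finsetSum _ fun i _ => ?_]
  · simp only [fluxDiv, mul_neg, Finset.mul_sum]
    have hI : ∀ i, Integrable fun x => Real.log (tconv φ (ρ s) x + δ) *
        tconv (partialDeriv i φ) (fun y => F s y i) x := fun i =>
      ((hlogP i).cont.mul (hFP i).cont').integrable_torus
    rw [integral_neg, integral_finsetSum _ fun i _ => hI i, ← Finset.sum_neg_distrib]
    refine Finset.sum_congr rfl fun i _ => ?_
    -- The derivative moves from the mollified flux to the logarithm, and the sign this produces
    -- cancels the one in `fluxDiv`.
    rw [(hlogP i).integral_mul_eq_neg (hFP i), neg_neg]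
    simp only [mul_assoc]
  · refine ((hlogP i).cont'.mul (hFP i).cont).integrable_torus.congr
      (Eventually.of_forall fun x => ?_)
    simp only [Pi.mul_apply, mul_assoc]

end ContinuityEquation

end ContinuityEquation

/-! ### Convergence of products in `L¹` -/

section Lebesgue

variable {α : Type*} [MeasurableSpace α] {μ : Measure α}

theorem eLpNorm_one_mul_le {f g : α → ℝ} (hf : AEStronglyMeasurable f μ)
    (hg : AEStronglyMeasurable g μ) :
    eLpNorm (fun x => f x * g x) 1 μ ≤ eLpNorm f 2 μ * eLpNorm g 2 μ := by
  have h := eLpNorm_smul_le_mul_eLpNorm (𝕜 := ℝ) (E := ℝ) (p := 2) (q := 2) (r := 1) (μ := μ)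
    (f := g) hg (φ := f) hf
  have e : f • g = fun x => f x * g x := rfl
  rwa [e] at h

theorem tendsto_eLpNorm_one_mul_sub {f g : α → ℝ} {fn gn : ℕ → α → ℝ} (hf : MemLp f 2 μ)
    (hg : MemLp g 2 μ) (hfn : ∀ n, AEStronglyMeasurable (fn n) μ)
    (hgn : ∀ n, AEStronglyMeasurable (gn n) μ)
    (hf' : Tendsto (fun n => eLpNorm (fun x => fn n x - f x) 2 μ) atTop (𝓝 0))
    (hg' : Tendsto (fun n => eLpNorm (fun x => gn n x - g x) 2 μ) atTop (𝓝 0)) :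
    Tendsto (fun n => eLpNorm (fun x => fn n x * gn n x - f x * g x) 1 μ) atTop (𝓝 0) := by
  have hlim : Tendsto (fun n => eLpNorm (fun x => fn n x - f x) 2 μ *
      eLpNorm (fun x => gn n x - g x) 2 μ + (eLpNorm (fun x => fn n x - f x) 2 μ * eLpNorm g 2 μ
      + eLpNorm f 2 μ * eLpNorm (fun x => gn n x - g x) 2 μ)) atTop (𝓝 0) := by
    have h1 := ENNReal.Tendsto.mul hf' (Or.inr ENNReal.zero_ne_top) hg'
      (Or.inr ENNReal.zero_ne_top)
    have h2 := ENNReal.Tendsto.mul_const hf' (Or.inr hg.2.ne)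
    have h3 := ENNReal.Tendsto.const_mul hg' (Or.inr hf.2.ne)
    simpa using h1.add (h2.add h3)
  refine tendsto_of_tendsto_of_tendsto_of_le_of_le tendsto_const_nhds hlim (fun _ => zero_le)
    fun n => ?_
  have e : (fun x => fn n x * gn n x - f x * g x) = (fun x => (fn n x - f x) * (gn n x - g x))
      + ((fun x => (fn n x - f x) * g x) + fun x => f x * (gn n x - g x)) := by
    funext x; simp only [Pi.add_apply]; ring
  have m1 := (hfn n).sub hf.1
  have m2 := (hgn n).sub hg.1
  rw [e]
  refine (eLpNorm_add_le (m1.mul m2) ((m1.mul hg.1).add (hf.1.mul m2)) le_rfl).trans ?_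
  refine add_le_add (eLpNorm_one_mul_le m1 m2) ?_
  refine (eLpNorm_add_le (m1.mul hg.1) (hf.1.mul m2) le_rfl).trans ?_
  exact add_le_add (eLpNorm_one_mul_le m1 hg.1) (eLpNorm_one_mul_le hf.1 m2)

/-- Write `bₙaₙ - ba = bₙ(aₙ - a) + (bₙ - b)a`: the first summand has a bounded multiplier, the
second is treated by dominated convergence. -/
theorem tendsto_eLpNorm_one_bdd_mul_sub {a b : α → ℝ} {an bn : ℕ → α → ℝ} {K : ℝ}
    (ha : Integrable a μ) (han : ∀ n, AEStronglyMeasurable (an n) μ)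
    (hbn : ∀ n, AEStronglyMeasurable (bn n) μ) (hb : AEStronglyMeasurable b μ)
    (hbnK : ∀ n, ∀ᵐ x ∂μ, |bn n x| ≤ K) (hbK : ∀ᵐ x ∂μ, |b x| ≤ K)
    (hlim : ∀ᵐ x ∂μ, Tendsto (fun n => bn n x) atTop (𝓝 (b x)))
    (ha' : Tendsto (fun n => eLpNorm (fun x => an n x - a x) 1 μ) atTop (𝓝 0)) :
    Tendsto (fun n => eLpNorm (fun x => bn n x * an n x - b x * a x) 1 μ) atTop (𝓝 0) := by
  have h1 : Tendsto (fun n => eLpNorm (fun x => (bn n x - b x) * a x) 1 μ) atTop (𝓝 0) := by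
    simp only [eLpNorm_one_eq_lintegral_enorm]
    rw [show (0 : ℝ≥0∞) = ∫⁻ _ : α, 0 ∂μ by simp]
    refine tendsto_lintegral_of_dominated_convergence' (fun x => ENNReal.ofReal (2 * K) * ‖a x‖ₑ)
      (fun n => (((hbn n).sub hb).mul ha.1).enorm) (fun n => ?_) ?_ ?_
    · filter_upwards [hbnK n, hbK] with x h1 h2
      rw [enorm_mul, Real.enorm_eq_ofReal_abs (bn n x - b x)]
      gcongr
      exact (abs_sub _ _).trans (by linarith)
    · rw [lintegral_const_mul' _ _ ENNReal.ofReal_ne_top]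
      exact ENNReal.mul_ne_top ENNReal.ofReal_ne_top ha.2.ne
    · filter_upwards [hlim] with x hx
      have h3 : Tendsto (fun n => (bn n x - b x) * a x) atTop (𝓝 0) := by
        simpa using (hx.sub_const (b x)).mul_const (a x)
      have h4 := ((continuous_enorm (E := ℝ)).tendsto 0).comp h3
      rw [enorm_zero] at h4
      exact h4
  have h2 : Tendsto (fun n => ENNReal.ofReal K * eLpNorm (fun x => an n x - a x) 1 μ
      + eLpNorm (fun x => (bn n x - b x) * a x) 1 μ) atTop (𝓝 0) := by
    have := ENNReal.Tendsto.const_mul (a := ENNReal.ofReal K) ha' (Or.inr ENNReal.ofReal_ne_top)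
    simpa using this.add h1
  refine tendsto_of_tendsto_of_tendsto_of_le_of_le tendsto_const_nhds h2 (fun _ => zero_le)
    fun n => ?_
  have e : (fun x => bn n x * an n x - b x * a x) = (fun x => bn n x * (an n x - a x))
      + fun x => (bn n x - b x) * a x := by
    funext x; simp only [Pi.add_apply]; ring
  have m1 := (han n).sub ha.1
  rw [e]
  refine (eLpNorm_add_le ((hbn n).mul m1) (((hbn n).sub hb).mul ha.1) le_rfl).trans ?_
  refine add_le_add ?_ le_rfl
  simp only [eLpNorm_one_eq_lintegral_enorm]
  rw [← lintegral_const_mul' _ _ ENNReal.ofReal_ne_top]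
  refine lintegral_mono_ae ((hbnK n).mono fun x hx => ?_)
  simp only [Pi.mul_apply, Pi.sub_apply]
  rw [enorm_mul, Real.enorm_eq_ofReal_abs (bn n x)]
  gcongr

theorem tendsto_integral_of_eLpNorm_one {f : α → ℝ} {fn : ℕ → α → ℝ} (hf : Integrable f μ)
    (hfn : ∀ n, Integrable (fn n) μ)
    (h : Tendsto (fun n => eLpNorm (fun x => fn n x - f x) 1 μ) atTop (𝓝 0)) :
    Tendsto (fun n => ∫ x, fn n x ∂μ) atTop (𝓝 (∫ x, f x ∂μ)) :=
  tendsto_integral_of_L1' f hf.1 (Eventually.of_forall hfn) h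

theorem eLpNorm_one_le_two [IsProbabilityMeasure μ] {f : α → ℝ} (hf : AEStronglyMeasurable f μ) :
    eLpNorm f 1 μ ≤ eLpNorm f 2 μ :=
  eLpNorm_le_eLpNorm_of_exponent_le (by norm_num) hf

theorem tendsto_eLpNorm_one_of_two [IsProbabilityMeasure μ] {fn : ℕ → α → ℝ}
    (hfn : ∀ n, AEStronglyMeasurable (fn n) μ)
    (h : Tendsto (fun n => eLpNorm (fn n) 2 μ) atTop (𝓝 0)) :
    Tendsto (fun n => eLpNorm (fn n) 1 μ) atTop (𝓝 0) :=
  tendsto_of_tendsto_of_tendsto_of_le_of_le tendsto_const_nhds h (fun _ => zero_le)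
    fun n => eLpNorm_one_le_two (hfn n)

end Lebesgue

/-! ### Elementary inequalities for the entropy function -/

section Entropy

/-- A convex function lies above its tangent at `a`, whose slope is `log a`; after division by `b`
it reads `1 - 1/x ≤ log x` at `x = b/a`. -/
theorem entropyFn_add_log_mul_le {a b : ℝ} (ha : 0 < a) (hb : 0 < b) :
    entropyFn a + Real.log a * (b - a) ≤ entropyFn b := by
  unfold entropyFn
  have h := Real.one_sub_inv_le_log_of_pos (div_pos hb ha)
  rw [Real.log_div hb.ne' ha.ne', inv_div] at h
  have h2 := mul_le_mul_of_nonneg_left h hb.le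
  have h3 : b * (1 - a / b) = b - a := by field_simp
  rw [h3] at h2
  linarith

/-- Crude linear growth suffices: it puts `log (ρ + δ)` in `L²` as soon as `ρ` is there, and bounds
it when `ρ` is bounded. -/
theorem abs_log_add_le {δ z : ℝ} (hδ : 0 < δ) (hz : 0 ≤ z) :
    |Real.log (z + δ)| ≤ z + (δ + δ⁻¹) := by
  have hp : 0 < z + δ := by positivity
  have h1 := Real.one_sub_inv_le_log_of_pos hp
  have h2 := Real.log_le_sub_one_of_pos hp
  have h3 : (z + δ)⁻¹ ≤ δ⁻¹ := inv_anti₀ hδ (by linarith)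
  have h4 : 0 < δ⁻¹ := by positivity
  rw [abs_le]
  constructor <;> linarith

theorem neg_one_le_entropyFn {z : ℝ} (hz : 0 ≤ z) : -1 ≤ entropyFn z := by
  unfold entropyFn
  rcases hz.eq_or_lt with rfl | hp
  · simp
  · have h1 := mul_le_mul_of_nonneg_left (Real.one_sub_inv_le_log_of_pos hp) hz
    rw [mul_sub, mul_inv_cancel₀ hp.ne'] at h1
    linarith

theorem entropyFn_le_sq {z : ℝ} (hz : 0 ≤ z) : entropyFn z ≤ z ^ 2 := by
  unfold entropyFn
  rcases hz.eq_or_lt with rfl | hp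
  · simp
  · have h1 := mul_le_mul_of_nonneg_left (Real.log_le_sub_one_of_pos hp) hz
    nlinarith

theorem abs_entropyFn_le {z : ℝ} (hz : 0 ≤ z) : |entropyFn z| ≤ z ^ 2 + 1 := by
  rw [abs_le]
  constructor
  · linarith [neg_one_le_entropyFn hz, sq_nonneg z]
  · linarith [entropyFn_le_sq hz]

theorem measurable_entropyFn : Measurable entropyFn := by
  unfold entropyFn
  fun_prop

theorem integrable_entropyFn_add {α : Type*} [MeasurableSpace α] {μ : Measure α}
    [IsFiniteMeasure μ] {f : α → ℝ} (hf : MemLp f 2 μ) (hf0 : ∀ᵐ x ∂μ, 0 ≤ f x) {δ : ℝ}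
    (hδ : 0 ≤ δ) : Integrable (fun x => entropyFn (f x + δ)) μ := by
  have h1 : MemLp (fun x => f x + δ) 2 μ := hf.add (memLp_const δ)
  refine (h1.integrable_sq.add (integrable_const 1)).mono'
    (measurable_entropyFn.comp_aemeasurable h1.1.aemeasurable).aestronglyMeasurable ?_
  filter_upwards [hf0] with x hx
  exact abs_entropyFn_le (by positivity)

end Entropy

/-! ### Removing the mollification at fixed `δ` -/

section EntropyInequality

variable {d : ℕ} {T : ℝ} {ρ₀ : Torus d → ℝ} {ρ : ℝ → Torus d → ℝ} {G F : ℝ → Torus d → Vec d}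

theorem memLp_tconv_spaceTime (n : ℕ) {f : ℝ → Torus d → ℝ}
    (hf : MemLp (Function.uncurry f) 2 (spaceTime d T)) :
    MemLp (fun z : ℝ × Torus d => tconv (peakKernel d n) (f z.1) z.2) 2 (spaceTime d T) := by
  have hm := aestronglyMeasurable_tconv (continuous_peakKernel n) hf.1
  refine ⟨hm, ?_⟩
  suffices hs : eLpNorm (fun z : ℝ × Torus d => tconv (peakKernel d n) (f z.1) z.2) 2
      (spaceTime d T) ^ 2 ≤ eLpNorm (Function.uncurry f) 2 (spaceTime d T) ^ 2 from
    (ENNReal.pow_lt_top_iff.1 (hs.trans_lt (ENNReal.pow_lt_top hf.2))).resolve_right two_ne_zero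
  rw [eLpNorm_two_sq, eLpNorm_two_sq]
  rw [spaceTime, lintegral_prod _ (hm.enorm.pow_const 2), lintegral_prod _ (hf.1.enorm.pow_const 2)]
  refine lintegral_mono_ae ((ae_memLp_two_slice hf).mono fun t ht => ?_)
  have := pow_le_pow_left' (eLpNorm_tconv_le (continuous_peakKernel n) (peakKernel_nonneg n)
    (integral_peakKernel n) ht.1) 2
  rwa [eLpNorm_two_sq, eLpNorm_two_sq] at this

theorem tendsto_integral_mul_tconv_sub {f g : Torus d → ℝ} (hf : MemLp f 2 volume)
    (hg : MemLp g 2 volume) :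
    Tendsto (fun n => ∫ x, g x * (f x - tconv (peakKernel d n) f x)) atTop (𝓝 0) := by
  have hfi := hf.integrable (by norm_num)
  have hm : ∀ n, MemLp (tconv (peakKernel d n) f) 2 volume := fun n =>
    ⟨(continuous_tconv (continuous_peakKernel n) hfi).aestronglyMeasurable,
      (eLpNorm_tconv_le (continuous_peakKernel n) (peakKernel_nonneg n)
        (integral_peakKernel n) hf.1).trans_lt hf.2⟩
  have h1 := tendsto_integral_of_eLpNorm_one (fn := fun n x => g x * (tconv (peakKernel d n) f x))
    (hg.integrable_mul hf)
    (fun n => hg.integrable_mul (hm n))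
    (tendsto_eLpNorm_one_mul_sub hg hf (fun _ => hg.1) (fun n => (hm n).1) (by simp)
      (tendsto_eLpNorm_tconv_sub hf))
  have h2 := h1.const_sub (∫ x, g x * f x)
  simp only [Pi.mul_apply, sub_self] at h2
  refine h2.congr fun n => ?_
  have h3 := integral_sub (hg.integrable_mul hf) (hg.integrable_mul (hm n))
  simp only [Pi.mul_apply] at h3
  simp only [mul_sub]
  exact h3.symm

theorem abs_inv_add_le {δ z : ℝ} (hδ : 0 < δ) (hz : 0 ≤ z) : |(z + δ)⁻¹| ≤ δ⁻¹ := by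
  rw [abs_of_nonneg (by positivity)]
  exact inv_anti₀ hδ (by linarith)

namespace ContinuityEquation

theorem integrable_inv_mul_inner (h : ContinuityEquation T ρ₀ ρ G F) {δ : ℝ} (hδ : 0 < δ) :
    Integrable (fun z : ℝ × Torus d => (ρ z.1 z.2 + δ)⁻¹ * inner ℝ (G z.1 z.2) (F z.1 z.2))
      (spaceTime d T) := by
  have h1 : Integrable (fun z : ℝ × Torus d => inner ℝ (G z.1 z.2) (F z.1 z.2))
      (spaceTime d T) := by
    simp only [PiLp.inner_apply, RCLike.inner_apply, conj_trivial]
    exact integrable_finsetSum _ fun i _ => (memLp_apply h.flux i).integrable_mul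
      (memLp_apply h.l2h1.2.1 i)
  refine h1.bdd_mul (c := δ⁻¹) ?_ (h.nonneg.mono fun z hz => abs_inv_add_le hδ hz)
  exact (h.l2h1.1.1.aemeasurable.add_const δ).inv.aestronglyMeasurable

/-- The limit of the entropy production of the mollified solutions along a subsequence. -/
theorem exists_tendsto_entropyProduction (h : ContinuityEquation T ρ₀ ρ G F) {δ : ℝ}
    (hδ : 0 < δ) : ∃ ns : ℕ → ℕ, StrictMono ns ∧ ∀ t ∈ Icc (0 : ℝ) T,
      Tendsto (fun k => ∫ r in (0 : ℝ)..t, ∫ x, ∑ i, (tconv (peakKernel d (ns k)) (ρ r) x + δ)⁻¹ *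
          (tconv (peakKernel d (ns k)) (fun y => G r y i) x *
            tconv (peakKernel d (ns k)) (fun y => F r y i) x)) atTop
        (𝓝 (∫ z in Ioc 0 t ×ˢ univ, (ρ z.1 z.2 + δ)⁻¹ * inner ℝ (G z.1 z.2) (F z.1 z.2)
          ∂(spaceTime d T))) := by
  have hρ := h.l2h1.1
  have hGi := fun i => memLp_apply h.l2h1.2.1 i
  have hFi := fun i => memLp_apply h.flux i
  have hρn := fun n => memLp_tconv_spaceTime n hρ
  have hGn := fun n i => memLp_tconv_spaceTime n (f := fun r y => G r y i) (hGi i)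
  have hFn := fun n i => memLp_tconv_spaceTime n (f := fun r y => F r y i) (hFi i)
  -- Only the factor `(ρ + δ)⁻¹` needs almost everywhere convergence. The subsequence is extracted
  -- on all of space-time, so it serves every `t`.
  obtain ⟨ns, hns, hlim⟩ := (tendstoInMeasure_of_tendsto_eLpNorm two_ne_zero
    (fun n => (hρn n).1) hρ.1 (tendsto_eLpNorm_tconv_sub_spaceTime hρ)).exists_seq_tendsto_ae
  refine ⟨ns, hns, fun t ht => ?_⟩
  have hpos : ∀ n, ∀ᵐ z ∂(spaceTime d T), 0 ≤ tconv (peakKernel d n) (ρ z.1) z.2 := by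
    intro n
    have h1 := Measure.quasiMeasurePreserving_fst (μ := volume.restrict (Icc (0 : ℝ) T))
      (ν := (volume : Measure (Torus d))) |>.ae h.ae_nonneg
    exact h1.mono fun z hz => tconv_nonneg (peakKernel_nonneg n) hz z.2
  have hbm : ∀ n, AEStronglyMeasurable
      (fun z : ℝ × Torus d => (tconv (peakKernel d n) (ρ z.1) z.2 + δ)⁻¹) (spaceTime d T) :=
    fun n => ((hρn n).1.aemeasurable.add_const δ).inv.aestronglyMeasurable
  have hb : AEStronglyMeasurable (fun z : ℝ × Torus d => (ρ z.1 z.2 + δ)⁻¹) (spaceTime d T) :=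
    (hρ.1.aemeasurable.add_const δ).inv.aestronglyMeasurable
  have hterm : ∀ i, Tendsto (fun k => eLpNorm (fun z : ℝ × Torus d =>
      (tconv (peakKernel d (ns k)) (ρ z.1) z.2 + δ)⁻¹ *
          (tconv (peakKernel d (ns k)) (fun y => G z.1 y i) z.2 *
            tconv (peakKernel d (ns k)) (fun y => F z.1 y i) z.2)
        - (ρ z.1 z.2 + δ)⁻¹ * (G z.1 z.2 i * F z.1 z.2 i)) 1 (spaceTime d T)) atTop (𝓝 0) := by
    intro i
    refine tendsto_eLpNorm_one_bdd_mul_sub (K := δ⁻¹) ((hGi i).integrable_mul (hFi i))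
      (fun k => (hGn (ns k) i).1.mul (hFn (ns k) i).1) (fun k => hbm (ns k)) hb
      (fun k => (hpos (ns k)).mono fun z hz => abs_inv_add_le hδ hz)
      (h.nonneg.mono fun z hz => abs_inv_add_le hδ hz) ?_ ?_
    · filter_upwards [hlim, h.nonneg] with z hz hz0
      exact (hz.add_const δ).inv₀ (add_pos_of_nonneg_of_pos hz0 hδ).ne'
    · exact (tendsto_eLpNorm_one_mul_sub (hGi i) (hFi i) (fun n => (hGn n i).1)
        (fun n => (hFn n i).1) (tendsto_eLpNorm_tconv_sub_spaceTime (f := fun r y => G r y i) (hGi i))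
        (tendsto_eLpNorm_tconv_sub_spaceTime (f := fun r y => F r y i) (hFi i))).comp
        hns.tendsto_atTop
  have hI : ∀ i, Integrable (fun z : ℝ × Torus d =>
      (ρ z.1 z.2 + δ)⁻¹ * (G z.1 z.2 i * F z.1 z.2 i)) (spaceTime d T) := fun i =>
    ((hGi i).integrable_mul (hFi i)).bdd_mul (c := δ⁻¹) hb
      (h.nonneg.mono fun z hz => abs_inv_add_le hδ hz)
  have hIn : ∀ n i, Integrable (fun z : ℝ × Torus d =>
      (tconv (peakKernel d n) (ρ z.1) z.2 + δ)⁻¹ *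
          (tconv (peakKernel d n) (fun y => G z.1 y i) z.2 *
            tconv (peakKernel d n) (fun y => F z.1 y i) z.2)) (spaceTime d T) := fun n i =>
    ((hGn n i).integrable_mul (hFn n i)).bdd_mul (c := δ⁻¹) (hbm n)
      ((hpos n).mono fun z hz => abs_inv_add_le hδ hz)
  set S : Set (ℝ × Torus d) := Ioc 0 t ×ˢ univ
  have hfin : Tendsto (fun k => ∑ i, ∫ z in S,
      (tconv (peakKernel d (ns k)) (ρ z.1) z.2 + δ)⁻¹ *
          (tconv (peakKernel d (ns k)) (fun y => G z.1 y i) z.2 *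
            tconv (peakKernel d (ns k)) (fun y => F z.1 y i) z.2) ∂(spaceTime d T)) atTop
      (𝓝 (∑ i, ∫ z in S, (ρ z.1 z.2 + δ)⁻¹ * (G z.1 z.2 i * F z.1 z.2 i) ∂(spaceTime d T))) := by
    refine tendsto_finsetSum _ fun i _ => ?_
    refine tendsto_integral_of_eLpNorm_one (hI i).integrableOn (fun k => (hIn (ns k) i).integrableOn)
      (tendsto_of_tendsto_of_tendsto_of_le_of_le tendsto_const_nhds (hterm i) (fun _ => zero_le)
        fun k => eLpNorm_restrict_le _ _ _ _)
  rw [← integral_finsetSum _ fun i _ => (hI i).integrableOn] at hfin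
  have e1 : ∀ z : ℝ × Torus d, ∑ i, (ρ z.1 z.2 + δ)⁻¹ * (G z.1 z.2 i * F z.1 z.2 i)
      = (ρ z.1 z.2 + δ)⁻¹ * inner ℝ (G z.1 z.2) (F z.1 z.2) := fun z => by
    simp only [PiLp.inner_apply, RCLike.inner_apply, conj_trivial, Finset.mul_sum, mul_comm]
  simp only [e1] at hfin
  refine hfin.congr fun k => ?_
  rw [← integral_finsetSum _ fun i _ => (hIn (ns k) i).integrableOn]
  exact setIntegral_spaceTime_eq
    (f := fun r x => ∑ i, (tconv (peakKernel d (ns k)) (ρ r) x + δ)⁻¹ *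
          (tconv (peakKernel d (ns k)) (fun y => G r y i) x *
            tconv (peakKernel d (ns k)) (fun y => F r y i) x))
    (integrable_finsetSum _ fun i _ => hIn (ns k) i) ht

theorem exists_init_bound (h : ContinuityEquation T ρ₀ ρ G F) : ∃ R, ∀ᵐ x, |ρ₀ x| ≤ R := by
  refine ⟨(eLpNorm ρ₀ ⊤ volume).toReal, ?_⟩
  have := ae_le_eLpNormEssSup (f := ρ₀) (μ := (volume : Measure (Torus d)))
  filter_upwards [this] with x hx
  rw [← Real.norm_eq_abs, ← toReal_enorm]
  exact ENNReal.toReal_mono h.init.2.ne (by rwa [eLpNorm_exponent_top])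

/-- Tangent line at the mollified datum. Mollification preserves the essential bound of `ρ₀`, so the
slope is bounded uniformly in `n` and the error is controlled by an `L¹` distance. -/
theorem integral_entropyFn_tconv_init_le (h : ContinuityEquation T ρ₀ ρ G F) {δ : ℝ}
    (hδ : 0 < δ) : ∃ K : ℝ, ∀ n, ∫ x, entropyFn (tconv (peakKernel d n) ρ₀ x + δ)
      ≤ (∫ x, entropyFn (ρ₀ x + δ)) + K * ∫ x, |tconv (peakKernel d n) ρ₀ x - ρ₀ x| := by
  obtain ⟨R, hR⟩ := h.exists_init_bound
  have h2 : MemLp ρ₀ 2 volume := h.init.mono_exponent le_top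
  refine ⟨R + (δ + δ⁻¹), fun n => ?_⟩
  have hc := continuous_tconv (continuous_peakKernel n) h.init_integrable
  have hcm : MemLp (tconv (peakKernel d n) ρ₀) 2 volume :=
    ⟨hc.aestronglyMeasurable, (eLpNorm_tconv_le (continuous_peakKernel n) (peakKernel_nonneg n)
        (integral_peakKernel n) h2.1).trans_lt h2.2⟩
  have h0 : ∀ x, 0 ≤ tconv (peakKernel d n) ρ₀ x :=
    tconv_nonneg (peakKernel_nonneg n) h.init_nonneg
  have hI : Integrable fun x => (R + (δ + δ⁻¹)) * |tconv (peakKernel d n) ρ₀ x - ρ₀ x| :=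
    ((hc.integrable_torus.sub h.init_integrable).abs).const_mul (R + (δ + δ⁻¹))
  rw [← integral_const_mul, ← integral_add (integrable_entropyFn_add h2 h.init_nonneg hδ.le) hI]
  refine integral_mono_ae (integrable_entropyFn_add hcm (Eventually.of_forall h0) hδ.le)
    ((integrable_entropyFn_add h2 h.init_nonneg hδ.le).add hI) ?_
  filter_upwards [h.init_nonneg] with x hx
  have h3 := entropyFn_add_log_mul_le (a := tconv (peakKernel d n) ρ₀ x + δ) (b := ρ₀ x + δ)
    (add_pos_of_nonneg_of_pos (h0 x) hδ) (by positivity)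
  have h4 := (abs_log_add_le hδ (h0 x)).trans (add_le_add
    ((le_abs_self _).trans (abs_tconv_peakKernel_le hR n x)) le_rfl)
  have h5 : Real.log (tconv (peakKernel d n) ρ₀ x + δ) * (tconv (peakKernel d n) ρ₀ x - ρ₀ x)
      ≤ (R + (δ + δ⁻¹)) * |tconv (peakKernel d n) ρ₀ x - ρ₀ x| := by
    refine (le_abs_self _).trans ?_
    rw [abs_mul]
    exact mul_le_mul_of_nonneg_right h4 (abs_nonneg _)
  simp only [add_sub_add_right_eq_sub] at h3
  have h6 : Real.log (tconv (peakKernel d n) ρ₀ x + δ) * (ρ₀ x - tconv (peakKernel d n) ρ₀ x)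
    = -(Real.log (tconv (peakKernel d n) ρ₀ x + δ) * (tconv (peakKernel d n) ρ₀ x - ρ₀ x)) := by
    ring
  linarith

/-- The entropy inequality for the regularized entropy `ζ ↦ Ψ(ζ + δ)`. -/
theorem integral_entropyFn_add_le (h : ContinuityEquation T ρ₀ ρ G F) {δ : ℝ} (hδ : 0 < δ) :
    ∀ᵐ t ∂(volume.restrict (Icc (0 : ℝ) T)),
      ∫ x, entropyFn (ρ t x + δ) ≤ (∫ x, entropyFn (ρ₀ x + δ))
        + ∫ z in Ioc 0 t ×ˢ univ, (ρ z.1 z.2 + δ)⁻¹ * inner ℝ (G z.1 z.2) (F z.1 z.2)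
          ∂(spaceTime d T) := by
  obtain ⟨ns, hns, hlim⟩ := h.exists_tendsto_entropyProduction hδ
  obtain ⟨K, hK⟩ := h.integral_entropyFn_tconv_init_le hδ
  have hall := ae_all_iff.2 fun n => h.integral_entropyFn_tconv
    (smoothOnTorus_peakKernel n) (peakKernel_nonneg n) hδ
  have h2 : MemLp ρ₀ 2 volume := h.init.mono_exponent le_top
  have hinit : Tendsto (fun n => ∫ x, |tconv (peakKernel d n) ρ₀ x - ρ₀ x|) atTop (𝓝 0) := by
    have hm : ∀ n, AEStronglyMeasurable (tconv (peakKernel d n) ρ₀ - ρ₀) volume := fun n =>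
      (continuous_tconv (continuous_peakKernel n) h.init_integrable).aestronglyMeasurable.sub h2.1
    have h3 := tendsto_eLpNorm_one_of_two hm (tendsto_eLpNorm_tconv_sub h2)
    have h4 := (ENNReal.tendsto_toReal ENNReal.zero_ne_top).comp h3
    refine h4.congr fun n => ?_
    simp only [Function.comp, eLpNorm_one_eq_lintegral_enorm]
    rw [← integral_norm_eq_lintegral_enorm (hm n)]
    rfl
  filter_upwards [hall, h.ae_memLp, h.ae_nonneg, ae_Icc_mem] with t ht hρt hρ0 htm
  have hlog : MemLp (fun x => Real.log (ρ t x + δ)) 2 volume := by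
    refine (hρt.add (memLp_const (δ + δ⁻¹))).of_le
      (Real.measurable_log.comp_aemeasurable
        (hρt.1.aemeasurable.add_const δ)).aestronglyMeasurable ?_
    filter_upwards [hρ0] with x hx
    rw [Real.norm_eq_abs, Real.norm_eq_abs]
    exact (abs_log_add_le hδ hx).trans (le_abs_self _)
  have hL := tendsto_integral_mul_tconv_sub hρt hlog
  have hsum : Tendsto (fun k => (∫ x, entropyFn (ρ₀ x + δ))
      + K * (∫ x, |tconv (peakKernel d (ns k)) ρ₀ x - ρ₀ x|)
      + (∫ r in (0 : ℝ)..t, ∫ x, ∑ i, (tconv (peakKernel d (ns k)) (ρ r) x + δ)⁻¹ *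
          (tconv (peakKernel d (ns k)) (fun y => G r y i) x *
            tconv (peakKernel d (ns k)) (fun y => F r y i) x))
      + ∫ x, Real.log (ρ t x + δ) * (ρ t x - tconv (peakKernel d (ns k)) (ρ t) x)) atTop
      (𝓝 ((∫ x, entropyFn (ρ₀ x + δ)) + K * 0
        + (∫ z in Ioc 0 t ×ˢ univ, (ρ z.1 z.2 + δ)⁻¹ * inner ℝ (G z.1 z.2) (F z.1 z.2)
          ∂(spaceTime d T)) + 0)) :=
    ((tendsto_const_nhds.add ((hinit.comp hns.tendsto_atTop).const_mul K)).add (hlim t htm)).add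
      (hL.comp hns.tendsto_atTop)
  rw [mul_zero, add_zero, add_zero] at hsum
  refine ge_of_tendsto' hsum fun k => ?_
  have hρi := hρt.integrable (by norm_num)
  have hcm : MemLp (tconv (peakKernel d (ns k)) (ρ t)) 2 volume :=
    ⟨(continuous_tconv (continuous_peakKernel _) hρi).aestronglyMeasurable,
      (eLpNorm_tconv_le (continuous_peakKernel _) (peakKernel_nonneg _)
        (integral_peakKernel _) hρt.1).trans_lt hρt.2⟩
  have h0 : ∀ x, 0 ≤ tconv (peakKernel d (ns k)) (ρ t) x :=
    tconv_nonneg (peakKernel_nonneg _) hρ0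
  have hI1 := integrable_entropyFn_add hcm (Eventually.of_forall h0) hδ.le
  have hI2 : Integrable fun x =>
      Real.log (ρ t x + δ) * (ρ t x - tconv (peakKernel d (ns k)) (ρ t) x) :=
    hlog.integrable_mul (hρt.sub hcm)
  -- Here the tangent is taken at `ρ t + δ` itself: the error pairs the fixed `L²` function `log (ρ
  -- t + δ)` with a mollification error, so convergence of the mollified entropies is not needed.
  have h3 : ∫ x, entropyFn (ρ t x + δ) ≤ (∫ x, entropyFn (tconv (peakKernel d (ns k)) (ρ t) x + δ))
      + ∫ x, Real.log (ρ t x + δ) * (ρ t x - tconv (peakKernel d (ns k)) (ρ t) x) := by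
    rw [← integral_add hI1 hI2]
    refine integral_mono_ae (integrable_entropyFn_add hρt hρ0 hδ.le) (hI1.add hI2) ?_
    filter_upwards [hρ0] with x hx
    have := entropyFn_add_log_mul_le (a := ρ t x + δ)
      (b := tconv (peakKernel d (ns k)) (ρ t) x + δ) (by positivity)
      (add_pos_of_nonneg_of_pos (h0 x) hδ)
    rw [add_sub_add_right_eq_sub] at this
    have h6 : Real.log (ρ t x + δ) * (ρ t x - tconv (peakKernel d (ns k)) (ρ t) x)
      = -(Real.log (ρ t x + δ) * (tconv (peakKernel d (ns k)) (ρ t) x - ρ t x)) := by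
      ring
    linarith
  rw [ht (ns k)] at h3
  linarith [hK (ns k)]

end ContinuityEquation

end EntropyInequality

/-! ### Chain rule for weak gradients -/

section WeakChainRule

variable {d : ℕ}

theorem hasDerivAt_primitive {k : ℝ → ℝ} (hk : Continuous k) (z : ℝ) :
    HasDerivAt (fun z => ∫ y in (0 : ℝ)..z, k y) (k z) z :=
  intervalIntegral.integral_hasDerivAt_right (hk.intervalIntegrable _ _)
    (hk.stronglyMeasurableAtFilter _ _) hk.continuousAt

theorem abs_primitive_sub_le {k : ℝ → ℝ} (hk : Continuous k) {K : ℝ} (hK : ∀ z, |k z| ≤ K)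
    (a b : ℝ) : |(∫ y in (0 : ℝ)..a, k y) - ∫ y in (0 : ℝ)..b, k y| ≤ K * |a - b| := by
  rw [intervalIntegral.integral_interval_sub_left (hk.intervalIntegrable _ _)
    (hk.intervalIntegrable _ _)]
  rw [← Real.norm_eq_abs]
  exact intervalIntegral.norm_integral_le_of_norm_le_const fun x _ => hK x

/-- A subsequence of the mollifications of a square integrable function converges a.e. -/
theorem exists_seq_tendsto_tconv {f : Torus d → ℝ} (hf : MemLp f 2 volume) :
    ∃ ns : ℕ → ℕ, StrictMono ns ∧
      ∀ᵐ x, Tendsto (fun k => tconv (peakKernel d (ns k)) f x) atTop (𝓝 (f x)) :=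
  (tendstoInMeasure_of_tendsto_eLpNorm two_ne_zero
    (fun n => (continuous_tconv (continuous_peakKernel n)
      (hf.integrable (by norm_num))).aestronglyMeasurable) hf.1
    (tendsto_eLpNorm_tconv_sub hf)).exists_seq_tendsto_ae

theorem tendsto_eLpNorm_one_tconv_sub {f : Torus d → ℝ} (hf : MemLp f 2 volume) :
    Tendsto (fun n => eLpNorm (fun x => tconv (peakKernel d n) f x - f x) 1 volume) atTop (𝓝 0) :=
  tendsto_eLpNorm_one_of_two (fun n => (continuous_tconv (continuous_peakKernel n)
      (hf.integrable (by norm_num))).aestronglyMeasurable.sub hf.1) (tendsto_eLpNorm_tconv_sub hf)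

/-- Chain rule for weak gradients and `C¹` functions with bounded derivative. -/
theorem Skeleton.IsWeakGrad.comp_primitive {f : Torus d → ℝ} {G : Torus d → Vec d}
    (h : IsWeakGrad f G) (hf : MemLp f 2 volume) (hG : MemLp G 2 volume) {k : ℝ → ℝ}
    (hk : Continuous k) {K : ℝ} (hK : ∀ z, |k z| ≤ K) :
    IsWeakGrad (fun x => ∫ y in (0 : ℝ)..f x, k y) (fun x => k (f x) • G x) := by
  have hHc : Continuous fun z => ∫ y in (0 : ℝ)..z, k y :=
    continuous_iff_continuousAt.2 fun z => (hasDerivAt_primitive hk z).continuousAt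
  have hkm : ∀ {u : Torus d → ℝ}, AEStronglyMeasurable u volume →
      AEStronglyMeasurable (fun x => k (u x)) volume := fun hu =>
    hk.comp_aestronglyMeasurable hu
  have hHi : ∀ {u : Torus d → ℝ}, Integrable u →
      Integrable fun x => ∫ y in (0 : ℝ)..u x, k y := fun {u} hu => by
    refine (hu.abs.const_mul K).mono' (hHc.comp_aestronglyMeasurable hu.1)
      (Eventually.of_forall fun x => ?_)
    have := abs_primitive_sub_le hk hK (u x) 0
    simpa using this
  refine ⟨hHi h.1, h.2.1.bdd_smul K (hkm h.1.1) (Eventually.of_forall fun x => hK _), ?_⟩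
  intro φ hφ i
  have hφi := hφ.hasPartial i
  obtain ⟨ns, hns, hlim⟩ := exists_seq_tendsto_tconv hf
  have hGi : MemLp (fun x => G x i) 2 volume := memLp_apply hG i
  have hfn : ∀ n, Continuous (tconv (peakKernel d n) f) := fun n =>
    continuous_tconv (continuous_peakKernel n) h.1
  have hGn : ∀ n, Continuous (tconv (peakKernel d n) fun x => G x i) := fun n =>
    continuous_tconv (continuous_peakKernel n) (hGi.integrable (by norm_num))
  obtain ⟨B, hB0, hB⟩ := exists_bound_of_continuous hφi.cont'
  obtain ⟨B', hB'0, hB'⟩ := exists_bound_of_continuous hφi.cont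
  have hK0 : 0 ≤ K := (abs_nonneg _).trans (hK 0)
  have hL : Tendsto (fun n => ∫ x, (∫ y in (0 : ℝ)..tconv (peakKernel d n) f x, k y)
      * partialDeriv i φ x) atTop
      (𝓝 (∫ x, (∫ y in (0 : ℝ)..f x, k y) * partialDeriv i φ x)) := by
    refine tendsto_integral_of_eLpNorm_one
      ((hHi h.1).mul_bdd (c := B) hφi.cont'.aestronglyMeasurable (Eventually.of_forall hB))
      (fun n => ((hHc.comp (hfn n)).mul hφi.cont').integrable_torus) ?_
    have h1 := ENNReal.Tendsto.const_mul (a := ENNReal.ofReal (K * B))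
      (tendsto_eLpNorm_one_tconv_sub hf) (Or.inr ENNReal.ofReal_ne_top)
    rw [mul_zero] at h1
    refine tendsto_of_tendsto_of_tendsto_of_le_of_le tendsto_const_nhds h1 (fun _ => zero_le)
      fun n => ?_
    simp only [eLpNorm_one_eq_lintegral_enorm]
    rw [← lintegral_const_mul' _ _ ENNReal.ofReal_ne_top]
    refine lintegral_mono fun x => ?_
    rw [Real.enorm_eq_ofReal_abs, Real.enorm_eq_ofReal_abs, ← ENNReal.ofReal_mul (by positivity),
      ← sub_mul, abs_mul]
    refine ENNReal.ofReal_le_ofReal ?_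
    calc _ ≤ (K * |tconv (peakKernel d n) f x - f x|) * B :=
          mul_le_mul (abs_primitive_sub_le hk hK _ _) (hB x) (abs_nonneg _) (by positivity)
      _ = _ := by ring
  have hR : Tendsto (fun n => ∫ x, (k (tconv (peakKernel d (ns n)) f x) * φ x) *
      tconv (peakKernel d (ns n)) (fun x => G x i) x) atTop
      (𝓝 (∫ x, (k (f x) * φ x) * G x i)) := by
    have hbd : ∀ z x, |k z * φ x| ≤ K * B' := fun z x => by
      rw [abs_mul]
      exact mul_le_mul (hK z) (hB' x) (abs_nonneg _) hK0
    refine tendsto_integral_of_eLpNorm_one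
      ((hGi.integrable (by norm_num)).bdd_mul (c := K * B')
        ((hkm h.1.1).mul hφi.cont.aestronglyMeasurable) (Eventually.of_forall fun x => hbd _ x))
      (fun n => (((hk.comp (hfn _)).mul hφi.cont).mul (hGn _)).integrable_torus) ?_
    refine tendsto_eLpNorm_one_bdd_mul_sub (K := K * B') (hGi.integrable (by norm_num))
      (fun n => (hGn _).aestronglyMeasurable)
      (fun n => ((hk.comp (hfn _)).mul hφi.cont).aestronglyMeasurable)
      ((hkm h.1.1).mul hφi.cont.aestronglyMeasurable)
      (fun n => Eventually.of_forall fun x => hbd _ x) (Eventually.of_forall fun x => hbd _ x) ?_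
      ((tendsto_eLpNorm_one_tconv_sub hGi).comp hns.tendsto_atTop)
    filter_upwards [hlim] with x hx
    exact ((hk.tendsto _).comp hx).mul_const _
  -- For mollified functions the identity is the classical chain rule and integration by parts.
  have heq : ∀ n, ∫ x, (∫ y in (0 : ℝ)..tconv (peakKernel d n) f x, k y) * partialDeriv i φ x
      = -∫ x, (k (tconv (peakKernel d n) f x) * φ x) * tconv (peakKernel d n) (fun x => G x i) x := by
    intro n
    have hP := (h.hasPartial_tconv (smoothOnTorus_peakKernel n) i).comp
      (fun x => hasDerivAt_primitive hk (tconv (peakKernel d n) f x)) (hk.comp (hfn n))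
    rw [hP.integral_mul_eq_neg hφi]
    congr 1
    refine integral_congr_ae (Eventually.of_forall fun x => ?_)
    simp only
    ring
  have hu := tendsto_nhds_unique ((hL.comp hns.tendsto_atTop).congr fun n => heq (ns n)) hR.neg
  rw [hu]
  congr 1
  refine integral_congr_ae (Eventually.of_forall fun x => ?_)
  simp only [PiLp.smul_apply, smul_eq_mul]
  ring

/-- Test with the constant `1`. Combined with the chain rule, this makes the drift term blind to
constant fields. -/
theorem Skeleton.IsWeakGrad.integral_eq_zero {f : Torus d → ℝ} {G : Torus d → Vec d}
    (h : IsWeakGrad f G) (i : Fin d) : ∫ x, G x i = 0 := by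
  have := h.2.2 _ (smoothOnTorus_const 1) i
  simpa [partialDeriv_const] using this

end WeakChainRule

/-! ### Poincaré and Sobolev inequalities on the torus -/

section Sobolev

variable {d : ℕ}

/-- The fundamental theorem of calculus along the arc from `0` to the representative of `c` in `[0,
1)`; the arc is then enlarged to the whole circle. -/
theorem HasPartial.abs_sub_le {i : Fin d} {u u' : Torus d → ℝ} (h : HasPartial i u u')
    (x : Torus d) (c : UnitAddCircle) :
    |u (x + Pi.single i c) - u x| ≤ ∫ r : UnitAddCircle, |u' (x + Pi.single i r)| := by
  obtain ⟨s, hs, rfl⟩ : ∃ s ∈ Ico (0 : ℝ) (0 + 1), (s : UnitAddCircle) = c := by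
    have := AddCircle.coe_image_Ico_eq (p := (1 : ℝ)) 0
    have hc : c ∈ ((↑) '' Ico (0 : ℝ) (0 + 1) : Set UnitAddCircle) := by rw [this]; trivial
    exact hc
  rw [zero_add] at hs
  have hc' : Continuous fun r : ℝ => u' (x + Pi.single i (r : UnitAddCircle)) :=
    h.cont'.comp (continuous_shift i x)
  have hftc := intervalIntegral.integral_eq_sub_of_hasDerivAt (a := 0) (b := s)
    (fun r _ => h.hasDerivAt x r) (hc'.intervalIntegrable _ _)
  have h0 : u (x + Pi.single i ((0 : ℝ) : UnitAddCircle)) = u x := by simp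
  rw [h0] at hftc
  rw [← hftc]
  have hper := UnitAddCircle.intervalIntegral_preimage 0 fun r => |u' (x + Pi.single i r)|
  rw [zero_add] at hper
  rw [← hper]
  calc _ ≤ ∫ r in (0 : ℝ)..s, |u' (x + Pi.single i (r : UnitAddCircle))| :=
        intervalIntegral.abs_integral_le_integral_abs hs.1
    _ ≤ _ := intervalIntegral.integral_mono_interval le_rfl hs.1 hs.2.le
        (Eventually.of_forall fun r => abs_nonneg _) (hc'.abs.intervalIntegrable _ _)

theorem integral_shift {i : Fin d} {v : UnitAddCircle → ℝ} (x : Torus d)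
    {w : Torus d → ℝ} (hv : ∀ c, v c = w (Function.update x i c)) :
    ∫ r : UnitAddCircle, w (x + Pi.single i r) = ∫ c, v c := by
  rw [← integral_add_left_eq_self v (x i)]
  congr 1
  funext r
  rw [hv]
  congr 1
  funext j
  by_cases hj : j = i
  · subst hj; simp
  · simp [hj]

theorem integrable_prod_of_continuous {X Y : Type*} [TopologicalSpace X] [CompactSpace X]
    [MeasurableSpace X] [OpensMeasurableSpace X] [TopologicalSpace Y] [CompactSpace Y]
    [MeasurableSpace Y] [OpensMeasurableSpace Y] [SecondCountableTopology X]
    [SecondCountableTopology Y] {μ : Measure X} {ν : Measure Y} [IsFiniteMeasure μ]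
    [IsFiniteMeasure ν] {f : X × Y → ℝ} (hf : Continuous f) : Integrable f (μ.prod ν) := by
  obtain ⟨C, hC⟩ := (isCompact_range hf).isBounded.exists_norm_le
  exact Integrable.of_bound hf.aestronglyMeasurable C
    (Eventually.of_forall fun x => hC _ ⟨x, rfl⟩)

theorem continuous_add_single (i : Fin d) :
    Continuous fun z : Torus d × UnitAddCircle => z.1 + Pi.single i z.2 :=
  continuous_fst.add ((continuous_single i).comp continuous_snd)

theorem integral_integral_shift {w : Torus d → ℝ} (hw : Continuous w) (i : Fin d) :
    ∫ x : Torus d, ∫ r : UnitAddCircle, w (x + Pi.single i r) = ∫ x, w x := by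
  have hs := integral_integral_swap (μ := (volume : Measure (Torus d)))
    (ν := (volume : Measure UnitAddCircle))
    (f := fun (x : Torus d) (r : UnitAddCircle) => w (x + (Pi.single i r : Torus d)))
    (integrable_prod_of_continuous (hw.comp (continuous_add_single i)))
  refine hs.trans ?_
  simp only [integral_add_right_eq_self w]
  simp

theorem HasPartial.integral_abs_sub_le {i : Fin d} {u u' : Torus d → ℝ} (h : HasPartial i u u')
    (c : UnitAddCircle) : ∫ x, |u (x + Pi.single i c) - u x| ≤ ∫ x, |u' x| := by
  rw [← integral_integral_shift h.cont'.abs i]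
  refine integral_mono (((h.cont.comp (continuous_add_const _)).sub h.cont).abs).integrable_torus
    ?_ fun x => h.abs_sub_le x c
  exact (integrable_prod_of_continuous (μ := volume) (ν := volume)
    (h.cont'.abs.comp (continuous_add_single i))).integral_prod_left

/-- The shift by `y` is performed one coordinate at a time, and translation invariance discards the
part already performed. -/
theorem integral_abs_shift_sub_le {u : Torus d → ℝ} {u' : Fin d → Torus d → ℝ}
    (h : ∀ i, HasPartial i u (u' i)) (hu : Continuous u) (y : Torus d) :
    ∫ x, |u (x + y) - u x| ≤ ∑ i, ∫ x, |u' i x| := by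
  classical
  suffices hs : ∀ S : Finset (Fin d), ∫ x, |u (x + ∑ i ∈ S, Pi.single i (y i)) - u x|
      ≤ ∑ i ∈ S, ∫ x, |u' i x| by
    have := hs Finset.univ
    rwa [Finset.univ_sum_single] at this
  intro S
  induction S using Finset.induction_on with
  | empty => simp
  | insert i S hi ih =>
    rw [Finset.sum_insert hi, Finset.sum_insert hi]
    set v : Torus d := ∑ i ∈ S, Pi.single i (y i)
    have c1 : ∀ a : Torus d, Continuous fun x : Torus d => u (x + a) := fun a =>
      hu.comp (continuous_add_const a)
    have h1 : ∫ x, |u (x + v + Pi.single i (y i)) - u (x + v)| ≤ ∫ x, |u' i x| := by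
      refine le_trans (le_of_eq ?_) ((h i).integral_abs_sub_le (y i))
      exact integral_add_right_eq_self (μ := (volume : Measure (Torus d)))
        (fun x => |u (x + Pi.single i (y i)) - u x|) v
    calc ∫ x, |u (x + (Pi.single i (y i) + v)) - u x|
        ≤ ∫ x, (|u (x + v + Pi.single i (y i)) - u (x + v)| + |u (x + v) - u x|) := by
          refine integral_mono ((c1 _).sub hu).abs.integrable_torus ?_ fun x => ?_
          · refine Continuous.integrable_torus (Continuous.add ?_ ((c1 _).sub hu).abs)
            exact (((c1 _).comp (continuous_add_const v)).sub (c1 v)).abs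
          · have : x + (Pi.single i (y i) + v) = x + v + Pi.single i (y i) := by abel
            simp only [this]
            exact abs_sub_le _ _ _
      _ = (∫ x, |u (x + v + Pi.single i (y i)) - u (x + v)|) + ∫ x, |u (x + v) - u x| := by
          refine integral_add ?_ ((c1 _).sub hu).abs.integrable_torus
          exact (((c1 (Pi.single i (y i))).comp (continuous_add_const v)).sub
            (c1 v)).abs.integrable_torus
      _ ≤ _ := add_le_add h1 ih

/-- Poincaré inequality in `L¹` on the torus. -/
theorem integral_abs_sub_integral_le {u : Torus d → ℝ} {u' : Fin d → Torus d → ℝ}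
    (h : ∀ i, HasPartial i u (u' i)) (hu : Continuous u) :
    ∫ x, |u x - ∫ y, u y| ≤ ∑ i, ∫ x, |u' i x| := by
  have hcont : Continuous fun z : Torus d × Torus d => |u (z.1 + z.2) - u z.1| :=
    ((hu.comp (continuous_fst.add continuous_snd)).sub (hu.comp continuous_fst)).abs
  have hint := integrable_prod_of_continuous (μ := volume) (ν := volume) hcont
  -- The mean of `u` is the average over `y` of `u (x + y)`.
  have hpt : ∀ x, |u x - ∫ y, u y| ≤ ∫ y, |u (x + y) - u x| := by
    intro x
    have hx : Continuous fun y => u (x + y) := hu.comp (continuous_const_add x)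
    have e : u x - ∫ y, u y = -∫ y, (u (x + y) - u x) := by
      rw [integral_sub hx.integrable_torus (integrable_const _), integral_add_left_eq_self u x]
      simp
    rw [e, abs_neg]
    exact abs_integral_le_integral_abs
  calc _ ≤ ∫ x, ∫ y, |u (x + y) - u x| :=
        integral_mono (hu.sub continuous_const).abs.integrable_torus hint.integral_prod_left hpt
    _ = ∫ y, ∫ x, |u (x + y) - u x| := integral_integral_swap hint
    _ ≤ ∫ _ : Torus d, ∑ i, ∫ x, |u' i x| :=
        integral_mono hint.integral_prod_right (integrable_const _)
          fun y => integral_abs_shift_sub_le h hu y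
    _ = _ := by simp

/-- The Gagliardo–Nirenberg–Sobolev inequality on the torus. -/
theorem lintegral_enorm_rpow_le {u : Torus d → ℝ} {u' : Fin d → Torus d → ℝ}
    (h : ∀ i, HasPartial i u (u' i)) (hu : Continuous u) {p : ℝ}
    (hp : Real.HolderConjugate (d : ℝ) p) :
    ∫⁻ x, ‖u x‖ₑ ^ p ≤ (ENNReal.ofReal ((∫ x, |u x|) + ∑ i, ∫ x, |u' i x|)) ^ p := by
  set w : Torus d → ℝ := fun x => |u x| + ∑ i, |u' i x| with hw
  have hwc : Continuous w := hu.abs.add (continuous_finsetSum _ fun i _ => (h i).cont'.abs)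
  have hw0 : ∀ x, 0 ≤ w x := fun x =>
    add_nonneg (abs_nonneg _) (Finset.sum_nonneg fun _ _ => abs_nonneg _)
  have hd1 : (1 : ℝ) < d := hp.lt
  -- The bound `|u x| ≤ |u (x + r eᵢ)| + ∫ |∂ᵢu|` is averaged over `r` in the circle, which has
  -- length one. The term `|u|` in `w` replaces compact support.
  have hline : ∀ x i, ‖u x‖ₑ ≤ ∫⁻ c, ENNReal.ofReal (w (Function.update x i c)) := by
    intro x i
    have hc1 : Continuous fun r : UnitAddCircle => x + Pi.single i r :=
      (continuous_add_single i).comp (continuous_const.prodMk continuous_id)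
    have hic : ∀ {v : UnitAddCircle → ℝ}, Continuous v → Integrable v := fun hv =>
      hv.integrable_of_hasCompactSupport (HasCompactSupport.of_compactSpace _)
    have hup : Continuous fun c => w (Function.update x i c) :=
      hwc.comp (continuous_const.update i continuous_id)
    rw [← ofReal_integral_eq_lintegral_ofReal (hic hup) (Eventually.of_forall fun c => hw0 _),
      Real.enorm_eq_ofReal_abs]
    refine ENNReal.ofReal_le_ofReal ?_
    rw [← integral_shift (w := w) (i := i) x fun c => rfl]
    have e1 : |u x| = ∫ _ : UnitAddCircle, |u x| := by simp
    rw [e1]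
    set J : ℝ := ∫ r : UnitAddCircle, |u' i (x + Pi.single i r)| with hJ
    have i1 : Integrable fun r : UnitAddCircle => |u (x + Pi.single i r)| :=
      hic (hu.comp hc1).abs
    have i2 : Integrable fun r : UnitAddCircle => |u' i (x + Pi.single i r)| :=
      hic ((h i).cont'.comp hc1).abs
    calc ∫ _ : UnitAddCircle, |u x| ≤ ∫ r : UnitAddCircle, (|u (x + Pi.single i r)| + J) := by
          refine integral_mono (integrable_const _) (i1.add (integrable_const _)) fun r => ?_
          have h1 := (h i).abs_sub_le x r
          have h2 := abs_sub_abs_le_abs_sub (u x) (u (x + Pi.single i r))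
          rw [abs_sub_comm] at h2
          simp only
          linarith
      _ = ∫ r : UnitAddCircle, (|u (x + Pi.single i r)| + |u' i (x + Pi.single i r)|) := by
          rw [integral_add i1 (integrable_const _), integral_add i1 i2]
          simp [hJ]
      _ ≤ _ := by
          refine integral_mono (i1.add i2) (hic (hwc.comp hc1)) fun r => ?_
          simp only [hw]
          gcongr
          exact Finset.single_le_sum (f := fun j => |u' j (x + (Pi.single i r : Torus d))|)
            (fun _ _ => abs_nonneg _) (Finset.mem_univ i)
  -- The grid-lines inequality, of Loomis–Whitney type: the integral of the product of the line
  -- integrals, each to the power `1/(d-1)`, is at most the full integral to the power `d/(d-1)`.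
  have hgrid := lintegral_prod_lintegral_pow_le (fun _ : Fin d => (volume : Measure UnitAddCircle))
    (p := p) (by simpa using hp) (f := fun x => ENNReal.ofReal (w x))
    hwc.measurable.ennreal_ofReal
  simp only [Fintype.card_fin] at hgrid
  have hvol : (volume : Measure (Torus d)) = Measure.pi fun _ => volume := rfl
  rw [← hvol] at hgrid
  have hsum : ENNReal.ofReal ((∫ x, |u x|) + ∑ i, ∫ x, |u' i x|) = ∫⁻ x, ENNReal.ofReal (w x) := by
    rw [← ofReal_integral_eq_lintegral_ofReal hwc.integrable_torus (Eventually.of_forall hw0), hw,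
      integral_add hu.abs.integrable_torus (continuous_finsetSum _ fun i _ =>
        (h i).cont'.abs).integrable_torus,
      integral_finsetSum _ fun i _ => (h i).cont'.abs.integrable_torus]
  rw [hsum]
  refine le_trans (lintegral_mono fun x => ?_) hgrid
  calc ‖u x‖ₑ ^ p = ∏ _i : Fin d, ‖u x‖ₑ ^ ((1 : ℝ) / (d - 1 : ℝ)) := by
        rw [Finset.prod_const, Finset.card_univ, Fintype.card_fin, ← ENNReal.rpow_mul_natCast]
        congr 1
        rw [hp.conjugate_eq]
        field_simp
    _ ≤ _ := Finset.prod_le_prod' fun i _ =>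
        ENNReal.rpow_le_rpow (hline x i) (by rw [one_div_nonneg]; linarith)

/-- For `u` minus its mean, Poincaré bounds the zeroth-order term of Sobolev's inequality by the
gradient term; hence the factor `2`. -/
theorem lintegral_enorm_sub_integral_rpow_le {u : Torus d → ℝ} {u' : Fin d → Torus d → ℝ}
    (h : ∀ i, HasPartial i u (u' i)) (hu : Continuous u) {p : ℝ}
    (hp : Real.HolderConjugate (d : ℝ) p) :
    ∫⁻ x, ‖u x - ∫ y, u y‖ₑ ^ p ≤ (ENNReal.ofReal (2 * ∑ i, ∫ x, |u' i x|)) ^ p := by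
  have h1 : ∀ i, HasPartial i (fun x => u x - ∫ y, u y) (u' i) := fun i =>
    ⟨hu.sub continuous_const, (h i).cont', fun x => ((h i).deriv x).sub_const _⟩
  refine (lintegral_enorm_rpow_le h1 (hu.sub continuous_const) hp).trans ?_
  refine ENNReal.rpow_le_rpow (ENNReal.ofReal_le_ofReal ?_) hp.symm.nonneg
  linarith [integral_abs_sub_integral_le h hu]

/-- The Sobolev–Poincaré inequality for weakly differentiable functions on the torus. -/
theorem Skeleton.IsWeakGrad.lintegral_enorm_sub_integral_rpow_le {f : Torus d → ℝ}
    {G : Torus d → Vec d}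
    (h : IsWeakGrad f G) (hf : MemLp f 2 volume) (hG : MemLp G 2 volume) {p : ℝ}
    (hp : Real.HolderConjugate (d : ℝ) p) :
    ∫⁻ x, ‖f x - ∫ y, f y‖ₑ ^ p ≤ (ENNReal.ofReal (2 * ∑ i, ∫ x, |G x i|)) ^ p := by
  obtain ⟨ns, hns, hlim⟩ := exists_seq_tendsto_tconv hf
  have hGi : ∀ i, MemLp (fun x => G x i) 2 volume := fun i => memLp_apply hG i
  have hfn : ∀ n, Continuous (tconv (peakKernel d n) f) := fun n =>
    continuous_tconv (continuous_peakKernel n) h.1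
  have hGn : ∀ n i, Continuous (tconv (peakKernel d n) fun x => G x i) := fun n i =>
    continuous_tconv (continuous_peakKernel n) ((hGi i).integrable (by norm_num))
  have hm : Tendsto (fun n => ∫ x, tconv (peakKernel d n) f x) atTop (𝓝 (∫ x, f x)) :=
    tendsto_integral_of_eLpNorm_one h.1 (fun n => (hfn n).integrable_torus)
      (tendsto_eLpNorm_one_tconv_sub hf)
  have hGl : Tendsto (fun n => ∑ i, ∫ x, |tconv (peakKernel d n) (fun x => G x i) x|) atTop
      (𝓝 (∑ i, ∫ x, |G x i|)) := by
    refine tendsto_finsetSum _ fun i _ => ?_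
    refine tendsto_integral_of_eLpNorm_one ((hGi i).integrable (by norm_num)).abs
      (fun n => (hGn n i).abs.integrable_torus) ?_
    refine tendsto_of_tendsto_of_tendsto_of_le_of_le tendsto_const_nhds
      (tendsto_eLpNorm_one_tconv_sub (hGi i)) (fun _ => zero_le)
      fun n => eLpNorm_mono fun x => ?_
    exact abs_abs_sub_abs_le_abs_sub _ _
  have hR : Tendsto (fun k => (ENNReal.ofReal (2 * ∑ i, ∫ x,
      |tconv (peakKernel d (ns k)) (fun x => G x i) x|)) ^ p) atTop
      (𝓝 ((ENNReal.ofReal (2 * ∑ i, ∫ x, |G x i|)) ^ p)) :=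
    (ENNReal.continuous_rpow_const.tendsto _).comp
      ((ENNReal.continuous_ofReal.tendsto _).comp ((hGl.const_mul 2).comp hns.tendsto_atTop))
  have hpt : ∀ᵐ x, Tendsto (fun k => ‖tconv (peakKernel d (ns k)) f x
      - ∫ y, tconv (peakKernel d (ns k)) f y‖ₑ ^ p) atTop (𝓝 (‖f x - ∫ y, f y‖ₑ ^ p)) := by
    filter_upwards [hlim] with x hx
    exact (ENNReal.continuous_rpow_const.tendsto _).comp
      (((continuous_enorm (E := ℝ)).tendsto _).comp (hx.sub (hm.comp hns.tendsto_atTop)))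
  -- Fatou along mollifications that converge almost everywhere.
  calc ∫⁻ x, ‖f x - ∫ y, f y‖ₑ ^ p
      = ∫⁻ x, liminf (fun k => ‖tconv (peakKernel d (ns k)) f x
          - ∫ y, tconv (peakKernel d (ns k)) f y‖ₑ ^ p) atTop :=
        lintegral_congr_ae (hpt.mono fun x hx => hx.liminf_eq.symm)
    _ ≤ liminf (fun k => ∫⁻ x, ‖tconv (peakKernel d (ns k)) f x
          - ∫ y, tconv (peakKernel d (ns k)) f y‖ₑ ^ p) atTop :=
        lintegral_liminf_le fun k =>
          ((hfn (ns k)).sub continuous_const).enorm.measurable.pow_const p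
    _ ≤ liminf (fun k => (ENNReal.ofReal (2 * ∑ i, ∫ x,
          |tconv (peakKernel d (ns k)) (fun x => G x i) x|)) ^ p) atTop :=
        liminf_le_liminf (Eventually.of_forall fun k =>
          _root_.lintegral_enorm_sub_integral_rpow_le
            (fun i => h.hasPartial_tconv (smoothOnTorus_peakKernel (ns k)) i) (hfn (ns k)) hp)
    _ = _ := hR.liminf_eq

end Sobolev

/-! ### Interpolation of Lebesgue norms and Young's inequality -/

section Interpolation

/-- Hölder interpolation between `L¹` and `L^{d/(d-1)}`; the exponent is fixed by `(d - θ)/d = (1 -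
θ) + θ(d - 1)/d`. -/
theorem lintegral_rpow_interpolation {α : Type*} [MeasurableSpace α] {μ : Measure α}
    {φ : α → ℝ≥0∞} (hφ : AEMeasurable φ μ) {d θ : ℝ} (hd : 1 < d) (hθ0 : 0 ≤ θ) (hθ1 : θ ≤ 1) :
    (∫⁻ x, φ x ^ (d / (d - θ)) ∂μ) ^ (1 / (d / (d - θ)))
      ≤ (∫⁻ x, φ x ∂μ) ^ (1 - θ) *
        ((∫⁻ x, φ x ^ (d / (d - 1)) ∂μ) ^ (1 / (d / (d - 1)))) ^ θ := by
  have h1 : 0 < d - θ := by linarith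
  have h2 : 0 < d - 1 := by linarith
  have h3 : 0 < d := by linarith
  set r := d / (d - θ) with hr
  set e := d / (d - 1) with he
  have hr0 : 0 < r := by positivity
  have he0 : 0 < e := by positivity
  have ha : 0 ≤ r * (1 - θ) := mul_nonneg hr0.le (by linarith)
  have hb : 0 ≤ r * θ / e := by positivity
  have hsplit : ∀ x, φ x ^ r = φ x ^ (r * (1 - θ)) * (φ x ^ e) ^ (r * θ / e) := fun x => by
    rw [← ENNReal.rpow_mul, mul_div_cancel₀ _ he0.ne',
      ← ENNReal.rpow_add_of_nonneg _ _ ha (by positivity)]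
    congr 1; ring
  have key := ENNReal.lintegral_mul_norm_pow_le hφ (hφ.pow_const e) ha hb (by
    rw [hr, he]; field_simp; ring)
  simp only [← hsplit] at key
  calc _ ≤ ((∫⁻ x, φ x ∂μ) ^ (r * (1 - θ)) * (∫⁻ x, φ x ^ e ∂μ) ^ (r * θ / e)) ^ (1 / r) :=
        ENNReal.rpow_le_rpow key (by positivity)
    _ = _ := by
        rw [ENNReal.mul_rpow_of_nonneg _ _ (by positivity), ← ENNReal.rpow_mul, ← ENNReal.rpow_mul,
          ← ENNReal.rpow_mul]
        congr 2 <;> field_simp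

/-- Young's inequality with explicit constants: if `4X ≤ Y^(1/q)` the first summand suffices,
otherwise the second. -/
theorem mul_rpow_one_sub_inv_le {X Y q : ℝ} (hX : 0 ≤ X) (hY : 0 ≤ Y) (hq : 1 ≤ q) :
    X * Y ^ (1 - 1 / q) ≤ Y / 4 + (4 * X) ^ q := by
  have hq0 : 0 < q := by linarith
  have h4 : 0 ≤ (4 * X) ^ q := by positivity
  have hsub : 0 ≤ 1 - 1 / q := by rw [sub_nonneg]; exact (div_le_one hq0).2 hq
  rcases le_total (4 * X) (Y ^ (1 / q)) with h | h
  · have h1 : Y ^ (1 / q) * Y ^ (1 - 1 / q) = Y := by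
      rw [← Real.rpow_add_of_nonneg hY (by positivity) hsub]
      simp
    have h2 := mul_le_mul_of_nonneg_right h (Real.rpow_nonneg hY (1 - 1 / q))
    rw [h1] at h2
    linarith
  · have h1 : Y ≤ (4 * X) ^ q := by
      have := Real.rpow_le_rpow (Real.rpow_nonneg hY _) h hq0.le
      rwa [← Real.rpow_mul hY, one_div_mul_cancel hq0.ne', Real.rpow_one] at this
    have h2 : Y ^ (1 - 1 / q) ≤ (4 * X) ^ (q - 1) := by
      refine (Real.rpow_le_rpow hY h1 hsub).trans_eq ?_
      rw [← Real.rpow_mul (by positivity)]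
      congr 1; field_simp
    have h3 : 4 * X * (4 * X) ^ (q - 1) = (4 * X) ^ q := by
      rcases hX.eq_or_lt with rfl | hp
      · rw [mul_zero, zero_mul, Real.zero_rpow hq0.ne']
      · rw [mul_comm, ← Real.rpow_add_one (by positivity)]
        simp
    have h5 := mul_le_mul_of_nonneg_left h2 hX
    have h6 : 0 ≤ X * (4 * X) ^ (q - 1) := by positivity
    linarith

end Interpolation

/-! ### The drift estimate at a fixed time -/

section SliceEstimates

variable {d : ℕ} {f : Torus d → ℝ} {G : Torus d → Vec d}

/-- The hypothesis on `p'` says `p' ≤ d/(d - θ)`, and on a probability space the exponent may be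
raised to this value. It interpolates between `L¹`, where the deviation from the mean is at most
twice the mass, and the Sobolev–Poincaré exponent. -/
theorem eLpNorm_sub_integral_le (h : IsWeakGrad f G) (hf : MemLp f 2 volume)
    (hG : MemLp G 2 volume) (hf0 : ∀ᵐ x, 0 ≤ f x) (hd : 2 ≤ d) {θ : ℝ} (hθ0 : 0 ≤ θ)
    (hθ1 : θ ≤ 1) {p' : ℝ≥0∞} (hp' : 1 - ENNReal.ofReal (θ / d) ≤ p'⁻¹) :
    eLpNorm (fun x => f x - ∫ y, f y) p' volume
      ≤ ENNReal.ofReal ((2 * ∫ y, f y) ^ (1 - θ) * (2 * ∑ i, ∫ x, |G x i|) ^ θ) := by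
  have hd1 : (1 : ℝ) < d := by exact_mod_cast hd
  have hdθ : 0 < (d : ℝ) - θ := by linarith
  set r : ℝ := d / (d - θ) with hr
  have hr0 : 0 < r := div_pos (by linarith) hdθ
  have hM0 : 0 ≤ ∫ y, f y := integral_nonneg_of_ae hf0
  have hS0 : 0 ≤ ∑ i, ∫ x, |G x i| :=
    Finset.sum_nonneg fun i _ => integral_nonneg fun x => abs_nonneg _
  have hm : AEStronglyMeasurable (fun x => f x - ∫ y, f y) volume :=
    hf.1.sub aestronglyMeasurable_const
  have hpr : p' ≤ ENNReal.ofReal r := by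
    rw [← ENNReal.inv_le_inv]
    refine le_trans ?_ hp'
    rw [← ENNReal.ofReal_inv_of_pos hr0, ← ENNReal.ofReal_one,
      ← ENNReal.ofReal_sub _ (by positivity)]
    refine ENNReal.ofReal_le_ofReal (le_of_eq ?_)
    rw [hr]; field_simp
  refine (eLpNorm_le_eLpNorm_of_exponent_le hpr hm).trans ?_
  rw [eLpNorm_eq_lintegral_rpow_enorm_toReal (by simpa using hr0) ENNReal.ofReal_ne_top,
    ENNReal.toReal_ofReal hr0.le]
  refine (lintegral_rpow_interpolation hm.enorm hd1 hθ0 hθ1).trans ?_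
  have hconj : Real.HolderConjugate (d : ℝ) (d / (d - 1)) := Real.HolderConjugate.conjExponent hd1
  have h1 : ∫⁻ x, ‖f x - ∫ y, f y‖ₑ ≤ ENNReal.ofReal (2 * ∫ y, f y) := by
    have hi : Integrable fun x => f x + ∫ y, f y := h.1.add (integrable_const _)
    calc _ ≤ ∫⁻ x, ENNReal.ofReal (f x + ∫ y, f y) := by
          refine lintegral_mono_ae (hf0.mono fun x hx => ?_)
          rw [Real.enorm_eq_ofReal_abs]
          refine ENNReal.ofReal_le_ofReal ((abs_sub _ _).trans ?_)
          rw [abs_of_nonneg hx, abs_of_nonneg hM0]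
      _ = ENNReal.ofReal (∫ x, (f x + ∫ y, f y)) :=
          (ofReal_integral_eq_lintegral_ofReal hi (hf0.mono fun x hx => add_nonneg hx hM0)).symm
      _ = _ := by
          rw [integral_add h.1 (integrable_const _)]
          simp [two_mul]
  have h2 : (∫⁻ x, ‖f x - ∫ y, f y‖ₑ ^ ((d : ℝ) / (d - 1))) ^ (1 / ((d : ℝ) / (d - 1)))
      ≤ ENNReal.ofReal (2 * ∑ i, ∫ x, |G x i|) := by
    have he0 : 0 < (d : ℝ) / (d - 1) := hconj.symm.pos
    refine (ENNReal.rpow_le_rpow (h.lintegral_enorm_sub_integral_rpow_le hf hG hconj)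
      (by positivity)).trans_eq ?_
    rw [← ENNReal.rpow_mul, mul_one_div_cancel he0.ne', ENNReal.rpow_one]
  rw [ENNReal.ofReal_mul (by positivity), ← ENNReal.ofReal_rpow_of_nonneg (by positivity)
    (by linarith), ← ENNReal.ofReal_rpow_of_nonneg (by positivity) hθ0]
  exact mul_le_mul' (ENNReal.rpow_le_rpow h1 (by linarith)) (ENNReal.rpow_le_rpow h2 hθ0)

theorem integrable_inv_mul_norm_sq (hf : MemLp f 2 volume) (hG : MemLp G 2 volume)
    (hf0 : ∀ᵐ x, 0 ≤ f x) {δ : ℝ} (hδ : 0 < δ) :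
    Integrable fun x => (f x + δ)⁻¹ * ‖G x‖ ^ 2 :=
  (hG.norm.integrable_sq).bdd_mul (c := δ⁻¹)
    (hf.1.aemeasurable.add_const δ).inv.aestronglyMeasurable
    (hf0.mono fun _ hx => abs_inv_add_le hδ hx)

/-- Cauchy–Schwarz for the factorization `‖G‖ = √(f + δ) · (‖G‖ / √(f + δ))`. -/
theorem integral_norm_le (h : IsWeakGrad f G) (hf : MemLp f 2 volume)
    (hG : MemLp G 2 volume) (hf0 : ∀ᵐ x, 0 ≤ f x) {δ : ℝ} (hδ : 0 < δ) :
    ∫ x, ‖G x‖ ≤ ((∫ x, f x) + δ) ^ (1 / 2 : ℝ) * (∫ x, (f x + δ)⁻¹ * ‖G x‖ ^ 2) ^ (1 / 2 : ℝ) := by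
  have hI := integrable_inv_mul_norm_sq hf hG hf0 hδ
  have hfm : AEMeasurable (fun x => √(f x + δ)) volume :=
    Real.continuous_sqrt.measurable.comp_aemeasurable (hf.1.aemeasurable.add_const δ)
  have ha2 : ∀ᵐ x, √(f x + δ) ^ 2 = f x + δ :=
    hf0.mono fun x hx => Real.sq_sqrt (by positivity)
  have hb2 : ∀ᵐ x, (‖G x‖ / √(f x + δ)) ^ 2 = (f x + δ)⁻¹ * ‖G x‖ ^ 2 :=
    ha2.mono fun x hx => by rw [div_pow, hx]; ring
  have hfi : Integrable fun x => f x + δ := h.1.add (integrable_const δ)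
  have ha : MemLp (fun x => √(f x + δ)) (ENNReal.ofReal 2) volume := by
    rw [ENNReal.ofReal_ofNat]
    exact (memLp_two_iff_integrable_sq hfm.aestronglyMeasurable).2
      (hfi.congr (ha2.mono fun x hx => hx.symm))
  have hb : MemLp (fun x => ‖G x‖ / √(f x + δ)) (ENNReal.ofReal 2) volume := by
    rw [ENNReal.ofReal_ofNat]
    exact (memLp_two_iff_integrable_sq (hG.1.norm.aemeasurable.div hfm).aestronglyMeasurable).2
      (hI.congr (hb2.mono fun x hx => hx.symm))
  have key := integral_mul_le_Lp_mul_Lq_of_nonneg (μ := (volume : Measure (Torus d)))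
    Real.HolderConjugate.two_two (Eventually.of_forall fun x => Real.sqrt_nonneg (f x + δ))
    (Eventually.of_forall fun x => div_nonneg (norm_nonneg (G x)) (Real.sqrt_nonneg (f x + δ)))
    ha hb
  simp only [Real.rpow_ofNat] at key
  rw [integral_congr_ae ha2, integral_congr_ae hb2, integral_add h.1 (integrable_const δ)] at key
  simp only [integral_const, probReal_univ, one_smul] at key
  refine le_trans (le_of_eq (integral_congr_ae (hf0.mono fun x hx => ?_))) key
  have : √(f x + δ) ≠ 0 := (Real.sqrt_pos.2 (by positivity)).ne'
  simp only
  field_simp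

theorem sum_integral_abs_le (hG : Integrable G) : ∑ i, ∫ x, |G x i| ≤ d * ∫ x, ‖G x‖ := by
  have h1 : ∀ i ∈ Finset.univ, ∫ x, |G x i| ≤ ∫ x, ‖G x‖ := fun i _ => by
    refine integral_mono_of_nonneg (Eventually.of_forall fun x => abs_nonneg _) hG.norm
      (Eventually.of_forall fun x => ?_)
    exact PiLp.norm_apply_le (G x) i
  refine (Finset.sum_le_sum h1).trans_eq ?_
  simp

/-- The drift constant in the entropy estimate. -/
noncomputable def driftConst (c₁ : ℝ) (d : ℕ) (θ M : ℝ) : ℝ :=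
  c₁ ^ 2 * ((2 * M) ^ (1 - θ) * (2 * d) ^ θ * (M + 1) ^ ((1 + θ) / 2))

/-- The central estimate. Since `k(f) G` is the weak gradient of a function of `f`, it has mean zero
and the constant `w₀` can be subtracted from `w`. The rest is at most a multiple of `N ‖G‖₁^(1+θ)`,
and `‖G‖₁` is controlled by the square root of the dissipation. The dissipation therefore appears
with exponent `(1 + θ)/2 = 1 - 1/q < 1`, and Young absorbs it. -/
theorem integral_drift_le (h : IsWeakGrad f G) (hf : MemLp f 2 volume)
    (hG : MemLp G 2 volume) (hf0 : ∀ᵐ x, 0 ≤ f x) {δ : ℝ} (hδ : 0 < δ) (hδ1 : δ ≤ 1)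
    {θ q : ℝ} (hθ0 : 0 ≤ θ) (hq : 1 ≤ q) (hθq : (1 + θ) / 2 = 1 - 1 / q)
    {k : ℝ → ℝ} (hk : Continuous k) {c₁ : ℝ} (hkc : ∀ z, |k z| ≤ c₁ ^ 2)
    {w : Torus d → Vec d} {w₀ : Vec d} (hw : AEStronglyMeasurable w volume) {N : ℝ} (hN : 0 ≤ N)
    (hwN : ∀ᵐ x, ‖w x - w₀‖ ≤
      N * ((2 * ∫ y, f y) ^ (1 - θ) * (2 * ∑ i, ∫ x, |G x i|) ^ θ)) :
    ∫ x, k (f x) * inner ℝ (G x) (w x)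
      ≤ (∫ x, (f x + δ)⁻¹ * ‖G x‖ ^ 2) / 4 + (4 * (driftConst c₁ d θ (∫ y, f y) * N)) ^ q := by
  have hM0 : 0 ≤ ∫ y, f y := integral_nonneg_of_ae hf0
  set M := ∫ y, f y with hM
  set A := ∫ x, (f x + δ)⁻¹ * ‖G x‖ ^ 2 with hA
  have hA0 : 0 ≤ A := integral_nonneg_of_ae (hf0.mono fun x hx => by
    simp only [Pi.zero_apply]; positivity)
  set B := ∫ x, ‖G x‖ with hB
  have hB0 : 0 ≤ B := integral_nonneg fun x => norm_nonneg _
  have hS0 : 0 ≤ ∑ i, ∫ x, |G x i| :=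
    Finset.sum_nonneg fun i _ => integral_nonneg fun x => abs_nonneg _
  set D := N * ((2 * M) ^ (1 - θ) * (2 * ∑ i, ∫ x, |G x i|) ^ θ) with hD
  have hkG := h.comp_primitive hf hG hk hkc
  have hkm : AEStronglyMeasurable (fun x => k (f x)) volume := hk.comp_aestronglyMeasurable hf.1
  have hinner : ∀ x, inner ℝ (G x) w₀ = inner ℝ w₀ (G x) := fun x => real_inner_comm _ _
  have hzero : ∫ x, k (f x) * inner ℝ (G x) w₀ = 0 := by
    have h1 : ∀ x, k (f x) * inner ℝ (G x) w₀ = ∑ i, w₀ i * (k (f x) • G x) i := fun x => by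
      simp only [PiLp.inner_apply, RCLike.inner_apply, conj_trivial, Finset.mul_sum,
        PiLp.smul_apply, smul_eq_mul]
      exact Finset.sum_congr rfl fun i _ => by ring
    simp only [h1]
    have hi : ∀ i, Integrable fun x => (k (f x) • G x) i := fun i =>
      (EuclideanSpace.proj (𝕜 := ℝ) i : Vec d →L[ℝ] ℝ).integrable_comp hkG.2.1
    rw [integral_finsetSum _ fun i _ => (hi i).const_mul (w₀ i)]
    refine Finset.sum_eq_zero fun i _ => ?_
    rw [integral_const_mul, hkG.integral_eq_zero i, mul_zero]
  have hi0 : Integrable fun x => k (f x) * inner ℝ (G x) w₀ := by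
    simp only [hinner]
    exact (((innerSL ℝ w₀).integrable_comp h.2.1).bdd_mul (c := c₁ ^ 2) hkm
      (Eventually.of_forall fun x => hkc _))
  have hbd : ∀ᵐ x, |k (f x) * inner ℝ (G x) (w x - w₀)| ≤ c₁ ^ 2 * D * ‖G x‖ := by
    filter_upwards [hwN] with x hx
    rw [abs_mul]
    calc _ ≤ c₁ ^ 2 * (‖G x‖ * ‖w x - w₀‖) :=
          mul_le_mul (hkc _) (abs_real_inner_le_norm _ _) (abs_nonneg _) (sq_nonneg _)
      _ ≤ c₁ ^ 2 * (‖G x‖ * D) := by gcongr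
      _ = _ := by ring
  have hi1 : Integrable fun x => k (f x) * inner ℝ (G x) (w x - w₀) :=
    (h.2.1.norm.const_mul (c₁ ^ 2 * D)).mono'
      (hkm.mul (h.2.1.1.inner (hw.sub aestronglyMeasurable_const))) hbd
  have hsplit : ∀ x, k (f x) * inner ℝ (G x) (w x)
      = k (f x) * inner ℝ (G x) w₀ + k (f x) * inner ℝ (G x) (w x - w₀) := fun x => by
    rw [inner_sub_right]; ring
  simp only [hsplit]
  rw [integral_add hi0 hi1, hzero, zero_add]
  have hstep : ∫ x, k (f x) * inner ℝ (G x) (w x - w₀) ≤ c₁ ^ 2 * D * B := by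
    rw [hB, ← integral_const_mul]
    exact integral_mono_ae hi1 (h.2.1.norm.const_mul _) (hbd.mono fun x hx => (le_abs_self _).trans hx)
  -- `δ ≤ 1` makes the constant independent of `δ`.
  have hBA : B ≤ (M + 1) ^ (1 / 2 : ℝ) * A ^ (1 / 2 : ℝ) := by
    refine (integral_norm_le h hf hG hf0 hδ).trans ?_
    gcongr
  have hfinal : c₁ ^ 2 * D * B ≤ driftConst c₁ d θ M * N * A ^ (1 - 1 / q) := by
    have h1 : (2 * ∑ i, ∫ x, |G x i|) ^ θ ≤ (2 * d) ^ θ * B ^ θ := by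
      rw [← Real.mul_rpow (by positivity) hB0]
      refine Real.rpow_le_rpow (by positivity) ?_ hθ0
      have := sum_integral_abs_le h.2.1
      linarith
    have h2 : B ^ θ * B ≤ (M + 1) ^ ((1 + θ) / 2) * A ^ (1 - 1 / q) := by
      have e1 : B ^ θ * B = B ^ (1 + θ) := by
        rw [Real.rpow_add_of_nonneg hB0 zero_le_one hθ0, Real.rpow_one, mul_comm]
      rw [e1]
      refine (Real.rpow_le_rpow hB0 hBA (by linarith)).trans_eq ?_
      rw [Real.mul_rpow (by positivity) (by positivity), ← Real.rpow_mul (by positivity),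
        ← Real.rpow_mul hA0, ← hθq]
      congr 2 <;> ring
    calc c₁ ^ 2 * D * B
        ≤ c₁ ^ 2 * (N * ((2 * M) ^ (1 - θ) * ((2 * d) ^ θ * B ^ θ))) * B := by
          rw [hD]; gcongr
      _ = c₁ ^ 2 * N * (2 * M) ^ (1 - θ) * (2 * d) ^ θ * (B ^ θ * B) := by ring
      _ ≤ c₁ ^ 2 * N * (2 * M) ^ (1 - θ) * (2 * d) ^ θ *
          ((M + 1) ^ ((1 + θ) / 2) * A ^ (1 - 1 / q)) := by gcongr
      _ = _ := by unfold driftConst; ring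
  have hK0 : 0 ≤ driftConst c₁ d θ M := by unfold driftConst; positivity
  exact hstep.trans (hfinal.trans (mul_rpow_one_sub_inv_le (by positivity) hA0 hq))

end SliceEstimates

/-! ### Space-time mollification of the interaction kernel -/

section SpaceTimeMollification

variable {d : ℕ}

/-- The norms in `L^p(𝕋ᵈ)` of the time slices of a field. -/
noncomputable def sliceNorm (p : ℝ≥0∞) (U : ℝ × Torus d → Vec d) (t : ℝ) : ℝ≥0∞ :=
  eLpNorm (fun x => U (t, x)) p volume

/-- Convolution of a field on `ℝ × 𝕋ᵈ` with a kernel on `ℝ × ℝᵈ`. -/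
noncomputable def mconv (k : ℝ × (Fin d → ℝ) → ℝ) (U : ℝ × Torus d → Vec d) (t : ℝ)
    (x : Torus d) : Vec d :=
  ∫ z, k z • U (t - z.1, x - proj z.2)

/-- The average in time of the slice norms against a kernel. -/
noncomputable def avgNorm (k : ℝ × (Fin d → ℝ) → ℝ) (p : ℝ≥0∞) (U : ℝ × Torus d → Vec d)
    (t : ℝ) : ℝ≥0∞ :=
  ∫⁻ z, ENNReal.ofReal (k z) * sliceNorm p U (t - z.1)

theorem continuous_proj : Continuous (proj : (Fin d → ℝ) → Torus d) :=
  isOpenQuotientMap_proj.continuous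

theorem measurable_shift_proj : Measurable fun w : (ℝ × Torus d) × (ℝ × (Fin d → ℝ)) =>
    (w.1.1 - w.2.1, w.1.2 - proj w.2.2) :=
  ((measurable_fst.comp measurable_fst).sub (measurable_fst.comp measurable_snd)).prodMk
    ((measurable_snd.comp measurable_fst).sub
      (continuous_proj.measurable.comp (measurable_snd.comp measurable_snd)))

/-- For `p = ⊤`, the essential supremum of a slice exceeds `a` exactly when the slice of `{a < ‖U‖}`
has positive measure, and that measure is measurable in `t`. -/
theorem measurable_sliceNorm (p : ℝ≥0∞) {U : ℝ × Torus d → Vec d} (hU : StronglyMeasurable U) :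
    Measurable (sliceNorm p U) := by
  have hm : Measurable fun z => ‖U z‖ₑ := hU.enorm
  unfold sliceNorm
  rcases eq_or_ne p 0 with rfl | hp0
  · simp
  rcases eq_or_ne p ⊤ with rfl | hp
  · simp only [eLpNorm_exponent_top]
    refine measurable_of_Ioi fun a => ?_
    have : (fun t => eLpNormEssSup (fun x => U (t, x)) volume) ⁻¹' Ioi a
        = {t | 0 < volume (Prod.mk t ⁻¹' {z : ℝ × Torus d | a < ‖U z‖ₑ})} := by
      ext t
      simp only [mem_preimage, mem_Ioi, Set.mem_ofPred_eq, pos_iff_ne_zero]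
      rw [← not_iff_not, not_lt, not_not]
      constructor
      · intro h
        have := (ae_le_eLpNormEssSup (f := fun x => U (t, x)) (μ := volume)).mono
          fun x hx => hx.trans h
        rw [ae_iff] at this
        simpa using this
      · intro h
        refine essSup_le_of_ae_le a ?_
        rw [EventuallyLE, ae_iff]
        simpa using h
    rw [this]
    exact measurableSet_lt measurable_const
      (measurable_measure_prodMk_left (measurableSet_lt measurable_const hm))
  · simp only [eLpNorm_eq_lintegral_rpow_enorm_toReal hp0 hp]
    exact (Measurable.lintegral_prod_right' (hm.pow_const _)).pow_const _

theorem stronglyMeasurable_mconv {k : ℝ × (Fin d → ℝ) → ℝ} (hk : Continuous k)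
    {U : ℝ × Torus d → Vec d} (hU : StronglyMeasurable U) :
    StronglyMeasurable (Function.uncurry (mconv k U)) := by
  have h1 : StronglyMeasurable fun w : (ℝ × Torus d) × (ℝ × (Fin d → ℝ)) =>
      k w.2 • U (w.1.1 - w.2.1, w.1.2 - proj w.2.2) :=
    ((hk.comp continuous_snd).stronglyMeasurable).smul (hU.comp_measurable measurable_shift_proj)
  exact h1.integral_prod_right'

theorem measurable_avgNorm {k : ℝ × (Fin d → ℝ) → ℝ} (hk : Continuous k) (p : ℝ≥0∞)
    {U : ℝ × Torus d → Vec d} (hU : StronglyMeasurable U) : Measurable (avgNorm k p U) := by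
  have h1 : Measurable fun w : ℝ × (ℝ × (Fin d → ℝ)) =>
      ENNReal.ofReal (k w.2) * sliceNorm p U (w.1 - w.2.1) :=
    (hk.comp continuous_snd).measurable.ennreal_ofReal.mul
      ((measurable_sliceNorm p hU).comp
        (measurable_fst.sub (measurable_fst.comp measurable_snd)))
  exact h1.lintegral_prod_right'

theorem lintegral_enorm_mul_shift_le {p p' : ℝ≥0∞} [ENNReal.HolderTriple p' p 1]
    {f : Torus d → ℝ} (hf : AEStronglyMeasurable f volume) {u : Torus d → Vec d}
    (hu : StronglyMeasurable u) (a : Torus d) :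
    ∫⁻ y, ‖f y‖ₑ * ‖u (a - y)‖ₑ ≤ eLpNorm f p' volume * eLpNorm u p volume := by
  have hmp := Measure.measurePreserving_sub_left (volume : Measure (Torus d)) a
  have hu' : AEStronglyMeasurable (fun y => u (a - y)) volume :=
    (hu.comp_measurable hmp.measurable).aestronglyMeasurable
  have h1 := eLpNorm_smul_le_mul_eLpNorm (p := p') (q := p) (r := 1) hu' hf
  have h2 : eLpNorm (fun y => u (a - y)) p volume = eLpNorm u p volume :=
    eLpNorm_comp_measurePreserving hu.aestronglyMeasurable hmp
  rw [h2, eLpNorm_one_eq_lintegral_enorm] at h1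
  refine le_trans (le_of_eq (lintegral_congr fun y => ?_)) h1
  rw [Pi.smul_apply', enorm_smul]

/-- By Tonelli, Hölder can be applied for each shift `z` separately, and a spatial shift leaves the
`L^p` norm unchanged. Only the average in time survives, with no constant depending on the kernel.
-/
theorem lintegral_enorm_mul_mconv_le {k : ℝ × (Fin d → ℝ) → ℝ} (hk : Continuous k)
    (hk0 : ∀ z, 0 ≤ k z) {U : ℝ × Torus d → Vec d} (hU : StronglyMeasurable U) {p p' : ℝ≥0∞}
    [ENNReal.HolderTriple p' p 1] {f : Torus d → ℝ} (hf : AEStronglyMeasurable f volume)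
    (t : ℝ) (x : Torus d) :
    ∫⁻ y, ‖f y‖ₑ * ‖mconv k U t (x - y)‖ₑ ≤ eLpNorm f p' volume * avgNorm k p U t := by
  have hmeas : Measurable fun w : Torus d × (ℝ × (Fin d → ℝ)) =>
      ENNReal.ofReal (k w.2) * ‖U (t - w.2.1, x - w.1 - proj w.2.2)‖ₑ := by
    refine (hk.comp continuous_snd).measurable.ennreal_ofReal.mul ?_
    exact hU.enorm.comp (measurable_shift_proj.comp
      ((measurable_const.prodMk (measurable_const.sub measurable_fst)).prodMk measurable_snd))
  calc ∫⁻ y, ‖f y‖ₑ * ‖mconv k U t (x - y)‖ₑ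
      ≤ ∫⁻ y, ∫⁻ z, ‖f y‖ₑ * (ENNReal.ofReal (k z) * ‖U (t - z.1, x - y - proj z.2)‖ₑ) := by
        refine lintegral_mono fun y => ?_
        rw [lintegral_const_mul' _ _ enorm_ne_top]
        refine mul_le_mul_right ((enorm_integral_le_lintegral_enorm _).trans_eq ?_) _
        refine lintegral_congr fun z => ?_
        rw [enorm_smul, Real.enorm_eq_ofReal (hk0 z)]
    _ = ∫⁻ z, ∫⁻ y, ‖f y‖ₑ * (ENNReal.ofReal (k z) * ‖U (t - z.1, x - y - proj z.2)‖ₑ) :=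
        lintegral_lintegral_swap
          ((hf.enorm.comp_quasiMeasurePreserving Measure.quasiMeasurePreserving_fst).mul
            hmeas.aemeasurable)
    _ ≤ ∫⁻ z, eLpNorm f p' volume * (ENNReal.ofReal (k z) * sliceNorm p U (t - z.1)) := by
        refine lintegral_mono fun z => ?_
        have hu : StronglyMeasurable fun y => U (t - z.1, y) :=
          hU.comp_measurable (measurable_const.prodMk measurable_id)
        have h1 := lintegral_enorm_mul_shift_le (p := p) (p' := p') hf hu (x - proj z.2)
        calc ∫⁻ y, ‖f y‖ₑ * (ENNReal.ofReal (k z) * ‖U (t - z.1, x - y - proj z.2)‖ₑ)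
            = ENNReal.ofReal (k z) * ∫⁻ y, ‖f y‖ₑ * ‖U (t - z.1, x - proj z.2 - y)‖ₑ := by
              rw [← lintegral_const_mul' _ _ ENNReal.ofReal_ne_top]
              refine lintegral_congr fun y => ?_
              rw [sub_right_comm]; ring
          _ ≤ ENNReal.ofReal (k z) * (eLpNorm f p' volume * sliceNorm p U (t - z.1)) :=
              mul_le_mul_right h1 _
          _ = _ := by ring
    _ = _ := by
        have hm2 : Measurable fun z : ℝ × (Fin d → ℝ) =>
            ENNReal.ofReal (k z) * sliceNorm p U (t - z.1) :=
          hk.measurable.ennreal_ofReal.mul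
            ((measurable_sliceNorm p hU).comp (measurable_const.sub measurable_fst))
        rw [lintegral_const_mul _ hm2]
        rfl

/-- Jensen for the probability measure `k(z) dz`, then translation invariance in time. This is why
the final constant does not depend on `γ`. -/
theorem lintegral_avgNorm_rpow_le {k : ℝ × (Fin d → ℝ) → ℝ} (hk : Continuous k)
    (hk0 : ∀ z, 0 ≤ k z) (hki : Integrable k) (hk1 : ∫ z, k z = 1) {U : ℝ × Torus d → Vec d}
    (hU : StronglyMeasurable U) (p : ℝ≥0∞) {q : ℝ} (hq : 1 ≤ q) :
    ∫⁻ t, avgNorm k p U t ^ q ≤ ∫⁻ t, sliceNorm p U t ^ q := by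
  set w : ℝ × (Fin d → ℝ) → ℝ≥0∞ := fun z => ENNReal.ofReal (k z) with hw
  have hwm : Measurable w := hk.measurable.ennreal_ofReal
  have hw1 : ∫⁻ z, w z = 1 := by
    rw [hw, ← ofReal_integral_eq_lintegral_ofReal hki (Eventually.of_forall hk0), hk1,
      ENNReal.ofReal_one]
  have : IsProbabilityMeasure (volume.withDensity w) :=
    ⟨by rw [withDensity_apply _ MeasurableSet.univ, Measure.restrict_univ, hw1]⟩
  have hs := measurable_sliceNorm p hU
  have hsz : ∀ t, Measurable fun z : ℝ × (Fin d → ℝ) => sliceNorm p U (t - z.1) := fun t =>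
    hs.comp (measurable_const.sub measurable_fst)
  have hpt : ∀ t, avgNorm k p U t ^ q ≤ ∫⁻ z, w z * sliceNorm p U (t - z.1) ^ q := by
    intro t
    have h2 := lintegral_rpow_le_of_isProbabilityMeasure (volume.withDensity w) hq
      (hsz t).aemeasurable
    rw [lintegral_withDensity_eq_lintegral_mul _ hwm (hsz t),
      lintegral_withDensity_eq_lintegral_mul _ hwm ((hsz t).pow_const q)] at h2
    exact h2
  have hmeas : Measurable (Function.uncurry fun (t : ℝ) (z : ℝ × (Fin d → ℝ)) =>
      w z * sliceNorm p U (t - z.1) ^ q) :=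
    (hwm.comp measurable_snd).mul ((hs.comp
      (measurable_fst.sub (measurable_fst.comp measurable_snd))).pow_const q)
  calc _ ≤ ∫⁻ t, ∫⁻ z, w z * sliceNorm p U (t - z.1) ^ q := lintegral_mono hpt
    _ = ∫⁻ z, ∫⁻ t, w z * sliceNorm p U (t - z.1) ^ q :=
        lintegral_lintegral_swap hmeas.aemeasurable
    _ = ∫⁻ z, w z * ∫⁻ t, sliceNorm p U t ^ q := by
        refine lintegral_congr fun z => ?_
        rw [lintegral_const_mul' _ _ ENNReal.ofReal_ne_top]
        congr 1
        exact lintegral_sub_right_eq_self (fun t => sliceNorm p U t ^ q) z.1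
    _ = _ := by rw [lintegral_mul_const _ hwm, hw1, one_mul]

/-- The constant depends on the kernel, hence on `γ`. It serves only qualitatively, for finiteness
and for square integrability of the drift field. -/
theorem exists_avgNorm_le {k : ℝ × (Fin d → ℝ) → ℝ} (hk : Continuous k)
    (hkc : HasCompactSupport k) {U : ℝ × Torus d → Vec d} (hU : StronglyMeasurable U)
    {p : ℝ≥0∞} (hfin : ∫⁻ t, sliceNorm p U t ≠ ⊤) :
    ∃ C : ℝ≥0, ∀ t, avgNorm k p U t ≤ C := by
  obtain ⟨K, hK⟩ := hk.bounded_above_of_compact_support hkc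
  obtain ⟨R, hR⟩ := hkc.isCompact.isBounded.subset_closedBall (0 : ℝ × (Fin d → ℝ))
  set B : Set (Fin d → ℝ) := Metric.closedBall 0 R
  have hBm : MeasurableSet B := Metric.isClosed_closedBall.measurableSet
  have hs := measurable_sliceNorm p hU
  have hkle : ∀ z, ENNReal.ofReal (k z) ≤ ENNReal.ofReal K * B.indicator 1 z.2 := by
    intro z
    by_cases hz : z ∈ tsupport k
    · have h1 := hR hz
      rw [mem_closedBall_zero_iff] at h1
      have h2 : z.2 ∈ B := by
        rw [mem_closedBall_zero_iff]
        exact (norm_snd_le z).trans h1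
      rw [indicator_of_mem h2, Pi.one_apply, mul_one]
      exact ENNReal.ofReal_le_ofReal ((le_abs_self _).trans (hK z))
    · rw [image_eq_zero_of_notMem_tsupport hz, ENNReal.ofReal_zero]
      exact zero_le
  have hC : ENNReal.ofReal K * ((∫⁻ t, sliceNorm p U t) * volume B) ≠ ⊤ :=
    ENNReal.mul_ne_top ENNReal.ofReal_ne_top
      (ENNReal.mul_ne_top hfin (isCompact_closedBall _ _).measure_lt_top.ne)
  refine ⟨(ENNReal.ofReal K * ((∫⁻ t, sliceNorm p U t) * volume B)).toNNReal, fun t => ?_⟩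
  rw [ENNReal.coe_toNNReal hC]
  calc avgNorm k p U t
      ≤ ∫⁻ z : ℝ × (Fin d → ℝ), ENNReal.ofReal K *
          (sliceNorm p U (t - z.1) * B.indicator 1 z.2) := by
        refine lintegral_mono fun z => ?_
        calc _ ≤ ENNReal.ofReal K * B.indicator 1 z.2 * sliceNorm p U (t - z.1) :=
              mul_le_mul_left (hkle z) _
          _ = _ := by ring
    _ = ENNReal.ofReal K * ∫⁻ z : ℝ × (Fin d → ℝ),
          sliceNorm p U (t - z.1) * B.indicator 1 z.2 :=
        lintegral_const_mul' _ _ ENNReal.ofReal_ne_top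
    _ = _ := by
        congr 1
        rw [Measure.volume_eq_prod, lintegral_prod_mul (f := fun s => sliceNorm p U (t - s))
          (hs.comp (measurable_const.sub measurable_id)).aemeasurable
          (measurable_one.indicator hBm).aemeasurable, lintegral_indicator_one hBm]
        congr 1
        exact lintegral_sub_left_eq_self (fun s => sliceNorm p U s) t

theorem quasiMeasurePreserving_shift_proj :
    Measure.QuasiMeasurePreserving (fun w : (ℝ × Torus d) × (ℝ × (Fin d → ℝ)) =>
      (w.1.1 - w.2.1, w.1.2 - proj w.2.2)) (volume.prod volume) volume := by
  refine QuasiMeasurePreserving.prod_of_left measurable_shift_proj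
    (Eventually.of_forall fun z => ?_)
  exact ((measurePreserving_sub_right (volume : Measure ℝ) z.1).prod
    (measurePreserving_sub_right (volume : Measure (Torus d)) (proj z.2))).quasiMeasurePreserving

theorem spaceTime_eq_restrict (T : ℝ) : spaceTime d T
    = (volume : Measure (ℝ × Torus d)).restrict (Icc (0 : ℝ) T ×ˢ univ) := by
  rw [spaceTime, Measure.volume_eq_prod, ← Measure.prod_restrict, Measure.restrict_univ]

/-- A strongly measurable representative of the extension of `V` by zero. -/
theorem exists_extension {T : ℝ} {V : ℝ → Torus d → Vec d}
    (hV : AEStronglyMeasurable (Function.uncurry V) (spaceTime d T)) :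
    ∃ U : ℝ × Torus d → Vec d, StronglyMeasurable U ∧
      ∀ᵐ z, (Icc (0 : ℝ) T).indicator (fun r => V r z.2) z.1 = U z := by
  obtain ⟨W, hW, h1⟩ := hV
  refine ⟨(Icc (0 : ℝ) T ×ˢ univ).indicator W,
    hW.indicator (measurableSet_Icc.prod MeasurableSet.univ), ?_⟩
  rw [spaceTime_eq_restrict, EventuallyEq,
    ae_restrict_iff' (measurableSet_Icc.prod MeasurableSet.univ)] at h1
  filter_upwards [h1] with z hz
  by_cases hm : z.1 ∈ Icc (0 : ℝ) T
  · have hm' : z ∈ Icc (0 : ℝ) T ×ˢ (univ : Set (Torus d)) := ⟨hm, trivial⟩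
    rw [indicator_of_mem hm, indicator_of_mem hm', ← hz hm']
    rfl
  · have hm' : z ∉ Icc (0 : ℝ) T ×ˢ (univ : Set (Torus d)) := fun h => hm h.1
    rw [indicator_of_notMem hm, indicator_of_notMem hm']

/-- The shift map pulls null sets back to null sets, so the mollification does not see the change of
representative, up to null sets. -/
theorem ae_mollify_eq {T : ℝ} {V : ℝ → Torus d → Vec d} {U : ℝ × Torus d → Vec d}
    (hU : ∀ᵐ z, (Icc (0 : ℝ) T).indicator (fun r => V r z.2) z.1 = U z)
    (κ : ℝ × (Fin d → ℝ) → ℝ) (γ : ℝ) :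
    ∀ᵐ t ∂(volume.restrict (Icc (0 : ℝ) T)), mollify T κ γ V t =ᵐ[volume]
      mconv (scaledKernel κ γ) U t := by
  have h1 := quasiMeasurePreserving_shift_proj.ae hU
  have h2 : ∀ᵐ z : ℝ × Torus d, mollify T κ γ V z.1 z.2 = mconv (scaledKernel κ γ) U z.1 z.2 := by
    filter_upwards [Measure.ae_ae_of_ae_prod h1] with z hz
    exact integral_congr_ae (hz.mono fun w hw => by simp only; rw [← hw])
  have h3 : ∀ᵐ z ∂(spaceTime d T), mollify T κ γ V z.1 z.2
      = mconv (scaledKernel κ γ) U z.1 z.2 := by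
    rw [spaceTime_eq_restrict]
    exact ae_restrict_of_ae h2
  exact Measure.ae_ae_of_ae_prod h3

theorem lintegral_sliceNorm_rpow {T : ℝ} {V : ℝ → Torus d → Vec d} {U : ℝ × Torus d → Vec d}
    (hU : ∀ᵐ z, (Icc (0 : ℝ) T).indicator (fun r => V r z.2) z.1 = U z) {p pstar : ℝ≥0∞}
    (h0 : pstar ≠ 0) (htop : pstar ≠ ⊤) :
    ∫⁻ t, sliceNorm p U t ^ pstar.toReal = mixedNorm T pstar p V ^ pstar.toReal := by
  have hq : 0 < pstar.toReal := ENNReal.toReal_pos h0 htop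
  have h1 : ∀ᵐ t, sliceNorm p U t
      = (Icc (0 : ℝ) T).indicator (fun r => eLpNorm (V r) p volume) t := by
    rw [Measure.volume_eq_prod] at hU
    filter_upwards [Measure.ae_ae_of_ae_prod hU] with t ht
    have h2 : sliceNorm p U t = eLpNorm (fun x => (Icc (0 : ℝ) T).indicator (fun r => V r x) t) p
        volume := eLpNorm_congr_ae (ht.mono fun x hx => hx.symm)
    rw [h2]
    by_cases hm : t ∈ Icc (0 : ℝ) T
    · simp only [indicator_of_mem hm]
    · simp only [indicator_of_notMem hm]
      exact eLpNorm_zero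
  have h3 : ∫⁻ t, sliceNorm p U t ^ pstar.toReal
      = ∫⁻ t in Icc (0 : ℝ) T, eLpNorm (V t) p volume ^ pstar.toReal := by
    rw [← lintegral_indicator measurableSet_Icc]
    refine lintegral_congr_ae (h1.mono fun t ht => ?_)
    simp only [ht]
    by_cases hm : t ∈ Icc (0 : ℝ) T
    · simp only [indicator_of_mem hm]
    · simp only [indicator_of_notMem hm, ENNReal.zero_rpow_of_pos hq]
  rw [h3, mixedNorm, eLpNorm_eq_lintegral_rpow_enorm_toReal h0 htop, ← ENNReal.rpow_mul,
    one_div_mul_cancel hq.ne', ENNReal.rpow_one]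
  simp only [enorm_eq_self]

/-- Almost all slices outside `[0, T]` vanish, and `y ≤ 1 + y^q` on the finite interval. -/
theorem lintegral_sliceNorm_ne_top {T : ℝ} {V : ℝ → Torus d → Vec d} {U : ℝ × Torus d → Vec d}
    (hU : ∀ᵐ z, (Icc (0 : ℝ) T).indicator (fun r => V r z.2) z.1 = U z) {p : ℝ≥0∞} {q : ℝ}
    (hq : 1 ≤ q) (hfin : ∫⁻ t, sliceNorm p U t ^ q ≠ ⊤) : ∫⁻ t, sliceNorm p U t ≠ ⊤ := by
  have h1 : ∀ᵐ t, t ∉ Icc (0 : ℝ) T → sliceNorm p U t = 0 := by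
    rw [Measure.volume_eq_prod] at hU
    filter_upwards [Measure.ae_ae_of_ae_prod hU] with t ht hm
    have h2 : sliceNorm p U t = eLpNorm (fun x => (Icc (0 : ℝ) T).indicator (fun r => V r x) t) p
        volume := eLpNorm_congr_ae (ht.mono fun x hx => hx.symm)
    rw [h2]
    simp only [indicator_of_notMem hm]
    exact eLpNorm_zero
  have h2 : ∫⁻ t, sliceNorm p U t
      ≤ ∫⁻ t, ((Icc (0 : ℝ) T).indicator 1 t + sliceNorm p U t ^ q) := by
    refine lintegral_mono_ae (h1.mono fun t ht => ?_)
    by_cases hm : t ∈ Icc (0 : ℝ) T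
    · rw [indicator_of_mem hm, Pi.one_apply]
      rcases le_total (sliceNorm p U t) 1 with h | h
      · exact h.trans le_self_add
      · exact (ENNReal.le_rpow_self_of_one_le h hq).trans le_add_self
    · rw [ht hm]; exact zero_le
  refine ne_top_of_le_ne_top ?_ h2
  rw [lintegral_add_left (measurable_one.indicator measurableSet_Icc),
    lintegral_indicator_one measurableSet_Icc]
  exact ENNReal.add_ne_top.2 ⟨by simp, hfin⟩

end SpaceTimeMollification

/-! ### The rescaled convolution kernel -/

section ScaledKernel

variable {d : ℕ} {κ : ℝ × (Fin d → ℝ) → ℝ}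

theorem continuous_scaledKernel (hκ : IsConvKernel κ) (γ : ℝ) : Continuous (scaledKernel κ γ) :=
  continuous_const.mul (hκ.smooth.continuous.comp (continuous_const_smul γ⁻¹))

theorem scaledKernel_nonneg (hκ : IsConvKernel κ) {γ : ℝ} (hγ : 0 < γ) (z : ℝ × (Fin d → ℝ)) :
    0 ≤ scaledKernel κ γ z :=
  mul_nonneg (by positivity) (hκ.nonneg _)

theorem hasCompactSupport_scaledKernel (hκ : IsConvKernel κ) {γ : ℝ} (hγ : 0 < γ) :
    HasCompactSupport (scaledKernel κ γ) :=
  (hκ.compact.comp_smul (inv_ne_zero hγ.ne')).mul_left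

theorem integral_scaledKernel (hκ : IsConvKernel κ) {γ : ℝ} (hγ : 0 < γ) :
    ∫ z, scaledKernel κ γ z = 1 := by
  unfold scaledKernel
  have : (volume : Measure (ℝ × (Fin d → ℝ))).IsAddHaarMeasure := by
    rw [Measure.volume_eq_prod]; infer_instance
  rw [integral_const_mul, Measure.integral_comp_inv_smul_of_nonneg _ _ hγ.le, hκ.mass]
  have : Module.finrank ℝ (ℝ × (Fin d → ℝ)) = d + 1 := by simp [add_comm]
  rw [this, smul_eq_mul, mul_one, inv_mul_cancel₀ (by positivity)]

end ScaledKernel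

/-! ### Spatial convolution with a vector field -/

section SpatialConvolution

variable {d : ℕ}

theorem conv_congr_ae {W W' : Torus d → Vec d} (h : W =ᵐ[volume] W') (f : Torus d → ℝ)
    (x : Torus d) : conv W f x = conv W' f x := by
  have := (Measure.measurePreserving_sub_left (volume : Measure (Torus d))
    x).quasiMeasurePreserving.ae_eq_comp h
  exact integral_congr_ae (this.mono fun y hy => by
    simp only [Function.comp] at hy
    simp only [hy])

theorem norm_conv_le {W : Torus d → Vec d} {f : Torus d → ℝ} {x : Torus d} {b : ℝ≥0∞}
    (hb : b ≠ ⊤) (h : ∫⁻ y, ‖f y‖ₑ * ‖W (x - y)‖ₑ ≤ b) : ‖conv W f x‖ ≤ b.toReal := by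
  rw [← toReal_enorm]
  refine ENNReal.toReal_mono hb ((enorm_integral_le_lintegral_enorm _).trans ?_)
  simpa only [enorm_smul] using h

theorem integrable_smul_shift {W : Torus d → Vec d} (hW : StronglyMeasurable W) {f : Torus d → ℝ}
    (hf : AEStronglyMeasurable f volume) {x : Torus d}
    (h : ∫⁻ y, ‖f y‖ₑ * ‖W (x - y)‖ₑ ≠ ⊤) : Integrable fun y => f y • W (x - y) := by
  refine ⟨hf.smul (hW.comp_measurable
    (measurable_const.sub measurable_id)).aestronglyMeasurable, ?_⟩
  rw [hasFiniteIntegral_iff_enorm]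
  simp only [enorm_smul]
  exact h.lt_top

/-- Convolving `W` with the constant `M` gives a field that is constant in space: it is the one the
drift term cannot see. -/
theorem conv_sub_const {W : Torus d → Vec d} (hW : StronglyMeasurable W) {f : Torus d → ℝ}
    (hf : AEStronglyMeasurable f volume) {x : Torus d}
    (h : ∫⁻ y, ‖f y‖ₑ * ‖W (x - y)‖ₑ ≠ ⊤) {M : ℝ}
    (hM : ∫⁻ y, ‖(fun _ : Torus d => M) y‖ₑ * ‖W (x - y)‖ₑ ≠ ⊤) :
    conv W f x - M • ∫ y, W y = conv W (fun y => f y - M) x := by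
  unfold conv
  simp only [sub_smul]
  rw [integral_sub (integrable_smul_shift hW hf h)
    (integrable_smul_shift hW aestronglyMeasurable_const hM), integral_smul,
    integral_sub_left_eq_self W volume x]

end SpatialConvolution

/-! ### From weak solutions to the continuity equation -/

section WeakSolution

variable {d : ℕ} {T : ℝ} {ρ₀ : Torus d → ℝ} {ρ : ℝ → Torus d → ℝ}
  {G F g w : ℝ → Torus d → Vec d}

theorem integrable_inner_grad (hF : MemLp (Function.uncurry F) 2 (spaceTime d T))
    {ψ : Torus d → ℝ} (hψ : SmoothOnTorus ψ) :
    Integrable (Function.uncurry fun r x => inner ℝ (F r x) (grad ψ x)) (spaceTime d T) := by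
  simp only [PiLp.inner_apply, RCLike.inner_apply, conj_trivial, Function.uncurry_def, grad]
  refine integrable_finsetSum _ fun i _ => ?_
  obtain ⟨C, _, hC⟩ := exists_bound_of_continuous (hψ.hasPartial i).cont'
  exact (integrable_component hF i).bdd_mul (c := C)
    (((hψ.hasPartial i).cont'.comp continuous_snd).aestronglyMeasurable)
    (Eventually.of_forall fun z => hC z.2)

theorem memLp_comp_smul {s : ℝ → ℝ} (hs : Continuous s) {K : ℝ} (hK : ∀ z, |s z| ≤ K)
    (hρ : AEStronglyMeasurable (Function.uncurry ρ) (spaceTime d T))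
    (hg : MemLp (Function.uncurry g) 2 (spaceTime d T)) :
    MemLp (Function.uncurry fun r x => s (ρ r x) • g r x) 2 (spaceTime d T) := by
  refine (hg.norm.const_mul K).mono' ((hs.comp_aestronglyMeasurable hρ).smul hg.1)
    (Eventually.of_forall fun z => ?_)
  simp only [Function.uncurry_def, norm_smul, Real.norm_eq_abs]
  exact mul_le_mul_of_nonneg_right (hK _) (norm_nonneg _)

/-- A weak solution of the Skeleton equation solves a continuity equation, after the coefficients
are replaced by regular representatives. -/
theorem Skeleton.IsWeakSolution.exists_continuityEquation (hT : 0 < T) (h0 : MemLp ρ₀ ⊤ volume)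
    (h00 : ∀ᵐ x, 0 ≤ ρ₀ x) (hg : MemLp (Function.uncurry g) 2 (spaceTime d T)) {σ s : ℝ → ℝ}
    {W : ℝ → Torus d → Vec d} (h : IsWeakSolution T σ W g ρ₀ ρ)
    (hs : Continuous s) {K : ℝ} (hK : ∀ z, |s z| ≤ K) (hsσ : ∀ z, 0 ≤ z → s z = σ z)
    (hw : MemLp (Function.uncurry w) 2 (spaceTime d T))
    (hwW : ∀ᵐ r ∂(volume.restrict (Icc (0 : ℝ) T)), ∀ x, conv (W r) (ρ r) x = w r x) :
    ∃ G, ContinuityEquation T ρ₀ ρ G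
      fun r x => s (ρ r x) ^ 2 • w r x + s (ρ r x) • g r x - G r x := by
  obtain ⟨hnn, -, G, hG, hweak⟩ := h
  have hA : MemLp (Function.uncurry fun r x => s (ρ r x) ^ 2 • w r x) 2 (spaceTime d T) :=
    memLp_comp_smul (s := fun z => s z ^ 2) (K := K ^ 2) (hs.pow 2) (fun z => by
      rw [abs_pow]; exact pow_le_pow_left₀ (abs_nonneg _) (hK z) 2) hG.1.1 hw
  have hB := memLp_comp_smul hs hK hG.1.1 hg
  refine ⟨G, hT, hnn, h0, h00, hG, (hA.add hB).sub hG.2.1, fun ψ hψ => ?_⟩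
  have iA := integrable_inner_grad hA hψ
  have iB := integrable_inner_grad hB hψ
  have iG := integrable_inner_grad hG.2.1 hψ
  have hnn' : ∀ᵐ r ∂(volume.restrict (Icc (0 : ℝ) T)), ∀ᵐ x, 0 ≤ ρ r x :=
    Measure.ae_ae_of_ae_prod hnn
  filter_upwards [hweak ψ hψ, ae_Icc_mem] with t ht htm
  rw [ht]
  have e1 : (∫ r in (0 : ℝ)..t, ∫ x, (σ (ρ r x)) ^ 2 * inner ℝ (conv (W r) (ρ r) x) (grad ψ x))
      = ∫ r in (0 : ℝ)..t, ∫ x, inner ℝ (s (ρ r x) ^ 2 • w r x) (grad ψ x) := by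
    refine intervalIntegral.integral_congr_ae (ae_uIoc_of_ae_Icc ?_ htm)
    filter_upwards [hwW, hnn'] with r h1 h2
    refine integral_congr_ae (h2.mono fun x hx => ?_)
    simp only [real_inner_smul_left, h1 x, hsσ _ hx]
  have e2 : (∫ r in (0 : ℝ)..t, ∫ x, σ (ρ r x) * inner ℝ (g r x) (grad ψ x))
      = ∫ r in (0 : ℝ)..t, ∫ x, inner ℝ (s (ρ r x) • g r x) (grad ψ x) := by
    refine intervalIntegral.integral_congr_ae (ae_uIoc_of_ae_Icc ?_ htm)
    filter_upwards [hnn'] with r h2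
    refine integral_congr_ae (h2.mono fun x hx => ?_)
    simp only [real_inner_smul_left, hsσ _ hx]
  -- All integrands are integrable on space-time, so the three separate integrals of the weak
  -- formulation can be merged into one flux.
  rw [e1, e2, ← setIntegral_spaceTime_eq iA htm, ← setIntegral_spaceTime_eq iB htm,
    ← setIntegral_spaceTime_eq iG htm,
    ← setIntegral_spaceTime_eq (integrable_inner_grad ((hA.add hB).sub hG.2.1) hψ) htm]
  have e3 : ∫ z in Ioc 0 t ×ˢ univ, inner ℝ (s (ρ z.1 z.2) ^ 2 • w z.1 z.2
        + s (ρ z.1 z.2) • g z.1 z.2 - G z.1 z.2) (grad ψ z.2) ∂(spaceTime d T)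
      = (∫ z in Ioc 0 t ×ˢ univ, inner ℝ (s (ρ z.1 z.2) ^ 2 • w z.1 z.2) (grad ψ z.2)
          ∂(spaceTime d T))
        + (∫ z in Ioc 0 t ×ˢ univ, inner ℝ (s (ρ z.1 z.2) • g z.1 z.2) (grad ψ z.2)
          ∂(spaceTime d T))
        - ∫ z in Ioc 0 t ×ˢ univ, inner ℝ (G z.1 z.2) (grad ψ z.2) ∂(spaceTime d T) := by
    simp only [inner_sub_left, inner_add_left]
    rw [integral_sub, integral_add]
    · exact iA.integrableOn
    · exact iB.integrableOn
    · exact iA.integrableOn.add iB.integrableOn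
    · exact iG.integrableOn
  refine Eq.trans ?_ (congrArg _ e3.symm)
  ring

end WeakSolution

/-! ### Integrability and size of the drift field -/

section DriftField

variable {d : ℕ} {T : ℝ} {ρ : ℝ → Torus d → ℝ} {k : ℝ × (Fin d → ℝ) → ℝ}
  {U : ℝ × Torus d → Vec d}

theorem aestronglyMeasurable_conv_mconv (hk : Continuous k) (hU : StronglyMeasurable U)
    (hρ : AEStronglyMeasurable (Function.uncurry ρ) (spaceTime d T)) :
    AEStronglyMeasurable (Function.uncurry fun r x => conv (mconv k U r) (ρ r) x)
      (spaceTime d T) := by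
  have h1 : Measure.QuasiMeasurePreserving (fun z : (ℝ × Torus d) × Torus d => (z.1.1, z.2))
      ((spaceTime d T).prod volume) (spaceTime d T) :=
    QuasiMeasurePreserving.prodMap Measure.quasiMeasurePreserving_fst
      (Measure.QuasiMeasurePreserving.id _)
  have h2 : Measurable fun z : (ℝ × Torus d) × Torus d => (z.1.1, z.1.2 - z.2) := by fun_prop
  have h3 : AEStronglyMeasurable (fun z : (ℝ × Torus d) × Torus d =>
      ρ z.1.1 z.2 • mconv k U z.1.1 (z.1.2 - z.2)) ((spaceTime d T).prod volume) :=
    (hρ.comp_quasiMeasurePreserving h1).smul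
      ((stronglyMeasurable_mconv hk hU).comp_measurable h2).aestronglyMeasurable
  exact h3.integral_prod_right'

/-- Since `p' ≤ 2`, Hölder bounds the field uniformly in `x` by a multiple of the `L²` norm of the
slice `ρ r`. -/
theorem memLp_conv_mconv (hk : Continuous k) (hk0 : ∀ z, 0 ≤ k z) (hU : StronglyMeasurable U)
    {p p' : ℝ≥0∞} [ENNReal.HolderTriple p' p 1] (hp' : p' ≤ 2) {C : ℝ≥0}
    (hC : ∀ t, avgNorm k p U t ≤ C) (hρ : MemLp (Function.uncurry ρ) 2 (spaceTime d T)) :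
    MemLp (Function.uncurry fun r x => conv (mconv k U r) (ρ r) x) 2 (spaceTime d T) := by
  refine ⟨aestronglyMeasurable_conv_mconv hk hU hρ.1, ?_⟩
  have hb : ∀ᵐ r ∂(volume.restrict (Icc (0 : ℝ) T)), ∀ x,
      ‖conv (mconv k U r) (ρ r) x‖ₑ ^ 2 ≤ (C : ℝ≥0∞) ^ 2 * ∫⁻ y, ‖ρ r y‖ₑ ^ 2 := by
    filter_upwards [ae_memLp_two_slice hρ] with r hr x
    rw [← eLpNorm_two_sq, ← mul_pow]
    refine pow_le_pow_left₀ zero_le ?_ 2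
    calc ‖conv (mconv k U r) (ρ r) x‖ₑ
        ≤ ∫⁻ y, ‖ρ r y‖ₑ * ‖mconv k U r (x - y)‖ₑ := by
          refine (enorm_integral_le_lintegral_enorm _).trans_eq ?_
          simp only [enorm_smul]
      _ ≤ eLpNorm (ρ r) p' volume * avgNorm k p U r :=
          lintegral_enorm_mul_mconv_le hk hk0 hU hr.1 r x
      _ ≤ eLpNorm (ρ r) 2 volume * C :=
          mul_le_mul' (eLpNorm_le_eLpNorm_of_exponent_le hp' hr.1) (hC r)
      _ = _ := mul_comm _ _
  have hb' : ∀ᵐ z ∂(spaceTime d T), ‖conv (mconv k U z.1) (ρ z.1) z.2‖ₑ ^ 2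
      ≤ (C : ℝ≥0∞) ^ 2 * ∫⁻ y, ‖ρ z.1 y‖ₑ ^ 2 :=
    (Measure.quasiMeasurePreserving_fst (μ := volume.restrict (Icc (0 : ℝ) T))
      (ν := (volume : Measure (Torus d))) |>.ae hb).mono fun z hz => hz z.2
  have hm : AEMeasurable (fun z : ℝ × Torus d => ‖ρ z.1 z.2‖ₑ ^ 2) (spaceTime d T) :=
    hρ.1.enorm.pow_const 2
  have hfin : eLpNorm (Function.uncurry fun r x => conv (mconv k U r) (ρ r) x) 2
      (spaceTime d T) ^ 2 < ⊤ := by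
    rw [eLpNorm_two_sq]
    calc _ ≤ ∫⁻ z, (C : ℝ≥0∞) ^ 2 * (∫⁻ y, ‖ρ z.1 y‖ₑ ^ 2) ∂(spaceTime d T) :=
          lintegral_mono_ae hb'
      _ = (C : ℝ≥0∞) ^ 2 * ∫⁻ z, ‖ρ z.1 z.2‖ₑ ^ 2 ∂(spaceTime d T) := by
          rw [lintegral_const_mul' _ _ (by simp), spaceTime, lintegral_prod _ hm,
            lintegral_prod]
          · simp
          · exact hm.lintegral_prod_right'.comp_quasiMeasurePreserving
              Measure.quasiMeasurePreserving_fst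
      _ = (C : ℝ≥0∞) ^ 2 * eLpNorm (Function.uncurry ρ) 2 (spaceTime d T) ^ 2 := by
          rw [eLpNorm_two_sq]; rfl
      _ < ⊤ := ENNReal.mul_lt_top (by simp) (ENNReal.pow_lt_top hρ.2)
  exact (ENNReal.pow_lt_top_iff.1 hfin).resolve_right (by norm_num)

theorem norm_conv_mconv_sub_le (hk : Continuous k) (hk0 : ∀ z, 0 ≤ k z)
    (hU : StronglyMeasurable U) {p p' : ℝ≥0∞} [ENNReal.HolderTriple p' p 1] (hp' : p' ≤ 2) {r : ℝ}
    (hr : avgNorm k p U r ≠ ⊤) {f : Torus d → ℝ} (hf : MemLp f 2 volume) (M : ℝ) {b : ℝ}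
    (hb : 0 ≤ b) (hfb : eLpNorm (fun y => f y - M) p' volume ≤ ENNReal.ofReal b) (x : Torus d) :
    ‖conv (mconv k U r) f x - M • ∫ y, mconv k U r y‖ ≤ (avgNorm k p U r).toReal * b := by
  have hW : StronglyMeasurable (mconv k U r) :=
    (stronglyMeasurable_mconv hk hU).comp_measurable (measurable_const.prodMk measurable_id)
  have hfin : ∀ f' : Torus d → ℝ, MemLp f' 2 volume →
      ∫⁻ y, ‖f' y‖ₑ * ‖mconv k U r (x - y)‖ₑ ≠ ⊤ := fun f' hf' =>
    ne_top_of_le_ne_top (ENNReal.mul_ne_top (hf'.mono_exponent hp').2.ne hr)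
      (lintegral_enorm_mul_mconv_le (p := p) (p' := p') hk hk0 hU hf'.1 r x)
  rw [conv_sub_const hW hf.1 (hfin f hf) (hfin _ (memLp_const M))]
  have h1 := lintegral_enorm_mul_mconv_le (p := p) (p' := p') hk hk0 hU
    (hf.1.sub (aestronglyMeasurable_const (b := M))) r x
  refine (norm_conv_le (b := ENNReal.ofReal b * avgNorm k p U r)
    (ENNReal.mul_ne_top ENNReal.ofReal_ne_top hr) (h1.trans (mul_le_mul_left hfb _))).trans_eq ?_
  rw [ENNReal.toReal_mul, ENNReal.toReal_ofReal hb, mul_comm]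

end DriftField

/-! ### The entropy estimate at fixed `δ` -/

section EntropyEstimate

variable {d : ℕ}

/-- Since `a² ≤ c₁²(z + δ)`, Young's inequality pays for the `g` term with a quarter of the
dissipation. -/
theorem inv_add_mul_inner_le {z δ c₁ a : ℝ} (hz : 0 ≤ z) (hδ : 0 < δ) (ha : 0 ≤ a)
    (hac : a ≤ c₁ * √z) (G g w : Vec d) :
    (z + δ)⁻¹ * inner ℝ G (a ^ 2 • w + a • g - G)
      ≤ a ^ 2 / (z + δ) * inner ℝ G w + c₁ ^ 2 * ‖g‖ ^ 2 - 3 / 4 * ((z + δ)⁻¹ * ‖G‖ ^ 2) := by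
  have hzδ : 0 < z + δ := by linarith
  have ha2 : a ^ 2 ≤ c₁ ^ 2 * (z + δ) := by
    calc a ^ 2 ≤ (c₁ * √z) ^ 2 := pow_le_pow_left₀ ha hac 2
      _ = c₁ ^ 2 * z := by rw [mul_pow, Real.sq_sqrt hz]
      _ ≤ _ := by gcongr; linarith
  have h1 : a * inner ℝ G g ≤ ‖G‖ ^ 2 / 4 + a ^ 2 * ‖g‖ ^ 2 := by
    have := mul_le_mul_of_nonneg_left (real_inner_le_norm G g) ha
    nlinarith [sq_nonneg (‖G‖ / 2 - a * ‖g‖)]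
  have h2 : a ^ 2 * ‖g‖ ^ 2 ≤ c₁ ^ 2 * (z + δ) * ‖g‖ ^ 2 := by gcongr
  have h3 : (z + δ)⁻¹ * (a * inner ℝ G g) ≤ (z + δ)⁻¹ * (‖G‖ ^ 2 / 4)
      + c₁ ^ 2 * ‖g‖ ^ 2 := by
    calc _ ≤ (z + δ)⁻¹ * (‖G‖ ^ 2 / 4 + c₁ ^ 2 * (z + δ) * ‖g‖ ^ 2) := by
          gcongr; linarith
      _ = _ := by field_simp
  rw [inner_sub_right, inner_add_right, real_inner_smul_right, real_inner_smul_right,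
    real_inner_self_eq_norm_sq]
  have h4 : a ^ 2 / (z + δ) * inner ℝ G w = (z + δ)⁻¹ * (a ^ 2 * inner ℝ G w) := by
    rw [div_eq_mul_inv]; ring
  rw [h4]
  linarith

/-- The drift takes a second quarter of the dissipation; one half is left. -/
theorem integral_inv_mul_inner_flux_le {f : Torus d → ℝ} {G g w : Torus d → Vec d}
    (h : IsWeakGrad f G) (hf : MemLp f 2 volume)
    (hG : MemLp G 2 volume) (hf0 : ∀ᵐ x, 0 ≤ f x) {δ : ℝ} (hδ : 0 < δ) (hδ1 : δ ≤ 1)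
    {θ q : ℝ} (hθ0 : 0 ≤ θ) (hq : 1 ≤ q) (hθq : (1 + θ) / 2 = 1 - 1 / q)
    {s : ℝ → ℝ} (hs : Continuous s) {c₁ : ℝ} (hs0 : ∀ z, 0 ≤ s z) (hsc : ∀ z, s z ≤ c₁ * √z)
    (hg : MemLp g 2 volume)
    {w₀ : Vec d} (hw : AEStronglyMeasurable w volume) {N : ℝ} (hN : 0 ≤ N)
    (hwN : ∀ᵐ x, ‖w x - w₀‖ ≤
      N * ((2 * ∫ y, f y) ^ (1 - θ) * (2 * ∑ i, ∫ x, |G x i|) ^ θ))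
    (hint : Integrable fun x =>
      (f x + δ)⁻¹ * inner ℝ (G x) (s (f x) ^ 2 • w x + s (f x) • g x - G x)) :
    ∫ x, (f x + δ)⁻¹ * inner ℝ (G x) (s (f x) ^ 2 • w x + s (f x) • g x - G x)
      ≤ c₁ ^ 2 * (∫ x, ‖g x‖ ^ 2) + (4 * (driftConst c₁ d θ (∫ y, f y) * N)) ^ q
        - (∫ x, (f x + δ)⁻¹ * ‖G x‖ ^ 2) / 2 := by
  -- The truncation `max z 0` makes `k` continuous and bounded on the whole line, as the weak chain
  -- rule requires.
  set k : ℝ → ℝ := fun z => s z ^ 2 / (max z 0 + δ) with hk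
  have hpos : ∀ z : ℝ, 0 < max z 0 + δ := fun z => by positivity
  have hkc : Continuous k :=
    (hs.pow 2).div₀ ((continuous_id.max continuous_const).add continuous_const)
      fun z => (hpos z).ne'
  have hkb : ∀ z, |k z| ≤ c₁ ^ 2 := fun z => by
    rw [abs_of_nonneg (div_nonneg (sq_nonneg _) (hpos z).le), div_le_iff₀ (hpos z)]
    calc s z ^ 2 ≤ (c₁ * √z) ^ 2 := pow_le_pow_left₀ (hs0 z) (hsc z) 2
      _ = c₁ ^ 2 * max z 0 := by
        rw [mul_pow]
        rcases le_total 0 z with hz | hz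
        · rw [Real.sq_sqrt hz, max_eq_left hz]
        · rw [Real.sqrt_eq_zero_of_nonpos hz, max_eq_right hz]; simp
      _ ≤ _ := by gcongr; linarith
  have hdrift := integral_drift_le h hf hG hf0 hδ hδ1 hθ0 hq hθq hkc hkb hw hN hwN
  set D := N * ((2 * ∫ y, f y) ^ (1 - θ) * (2 * ∑ i, ∫ x, |G x i|) ^ θ) with hD
  have hI := integrable_inv_mul_norm_sq hf hG hf0 hδ
  have hkw : Integrable fun x => k (f x) * inner ℝ (G x) (w x) := by
    refine (hG.integrable (by norm_num)).norm.const_mul (c₁ ^ 2 * (D + ‖w₀‖)) |>.mono'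
      ((hkc.comp_aestronglyMeasurable hf.1).mul (hG.1.inner hw)) ?_
    filter_upwards [hwN] with x hx
    have hwx : ‖w x‖ ≤ D + ‖w₀‖ := by
      calc ‖w x‖ = ‖(w x - w₀) + w₀‖ := by rw [sub_add_cancel]
        _ ≤ _ := (norm_add_le _ _).trans (by gcongr)
    rw [Real.norm_eq_abs, abs_mul]
    calc _ ≤ c₁ ^ 2 * (‖G x‖ * ‖w x‖) :=
          mul_le_mul (hkb _) (abs_real_inner_le_norm _ _) (abs_nonneg _) (sq_nonneg _)
      _ ≤ c₁ ^ 2 * (‖G x‖ * (D + ‖w₀‖)) := by gcongr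
      _ = _ := by ring
  have hg2 : Integrable fun x => c₁ ^ 2 * ‖g x‖ ^ 2 := (hg.norm.integrable_sq).const_mul _
  have hkey : ∫ x, (f x + δ)⁻¹ * inner ℝ (G x) (s (f x) ^ 2 • w x + s (f x) • g x - G x)
      ≤ ∫ x, (k (f x) * inner ℝ (G x) (w x) + c₁ ^ 2 * ‖g x‖ ^ 2
        - 3 / 4 * ((f x + δ)⁻¹ * ‖G x‖ ^ 2)) := by
    refine integral_mono_ae hint ((hkw.add hg2).sub (hI.const_mul _)) ?_
    filter_upwards [hf0] with x hx
    have := inv_add_mul_inner_le hx hδ (hs0 (f x)) (hsc (f x)) (G x) (g x) (w x)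
    simpa only [hk, max_eq_left hx] using this
  have hsum : Integrable fun x => k (f x) * inner ℝ (G x) (w x) + c₁ ^ 2 * ‖g x‖ ^ 2 :=
    hkw.add hg2
  rw [integral_sub hsum (hI.const_mul _), integral_add hkw hg2, integral_const_mul,
    integral_const_mul] at hkey
  linarith

variable {T : ℝ} {ρ₀ : Torus d → ℝ} {ρ : ℝ → Torus d → ℝ} {G F g w : ℝ → Torus d → Vec d}

theorem ContinuityEquation.integrable_inv_mul_norm_sq (h : ContinuityEquation T ρ₀ ρ G F) {δ : ℝ}
    (hδ : 0 < δ) : Integrable (fun z : ℝ × Torus d => (ρ z.1 z.2 + δ)⁻¹ * ‖G z.1 z.2‖ ^ 2)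
      (spaceTime d T) :=
  (h.l2h1.2.1.norm.integrable_sq).bdd_mul (c := δ⁻¹)
    (h.l2h1.1.1.aemeasurable.add_const δ).inv.aestronglyMeasurable
    (h.nonneg.mono fun _ hx => abs_inv_add_le hδ hx)

theorem integrable_integral_norm_sq (hg : MemLp (Function.uncurry g) 2 (spaceTime d T)) :
    Integrable (fun r => ∫ x, ‖g r x‖ ^ 2) (volume.restrict (Icc (0 : ℝ) T)) :=
  (hg.norm.integrable_sq).integral_prod_left

theorem integrable_toReal_rpow {α : Type*} [MeasurableSpace α] {μ : Measure α} {N : α → ℝ≥0∞}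
    (hN : Measurable N) {q : ℝ} {b : ℝ≥0∞} (hb : b ≠ ⊤) (h : ∫⁻ t, N t ^ q ∂μ ≤ b) :
    Integrable (fun t => (N t).toReal ^ q) μ ∧ ∫ t, (N t).toReal ^ q ∂μ ≤ b.toReal := by
  have h1 : ∀ t, (N t).toReal ^ q = (N t ^ q).toReal := fun t => ENNReal.toReal_rpow _ _
  simp only [h1]
  have hne : ∫⁻ t, N t ^ q ∂μ ≠ ⊤ := ne_top_of_le_ne_top hb h
  have hm : AEMeasurable (fun t => N t ^ q) μ := (hN.pow_const q).aemeasurable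
  refine ⟨integrable_toReal_of_lintegral_ne_top hm hne, ?_⟩
  rw [integral_toReal hm (ae_lt_top' hm hne)]
  exact ENNReal.toReal_mono hb h

/-- Time integration of the slicewise bound. The integrals of `‖g‖²` and `N^q` are enlarged to `[0,
T]` and to `ℝ`, which removes `t` from the constants. -/
theorem ContinuityEquation.entropy_add_dissipation_le {s : ℝ → ℝ}
    (h : ContinuityEquation T ρ₀ ρ G
      fun r x => s (ρ r x) ^ 2 • w r x + s (ρ r x) • g r x - G r x)
    (hg : MemLp (Function.uncurry g) 2 (spaceTime d T))
    (hw : AEStronglyMeasurable (Function.uncurry w) (spaceTime d T)) {δ : ℝ} (hδ : 0 < δ)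
    (hδ1 : δ ≤ 1) {θ q : ℝ} (hθ0 : 0 ≤ θ) (hq : 1 ≤ q) (hθq : (1 + θ) / 2 = 1 - 1 / q)
    (hs : Continuous s) {c₁ : ℝ} (hs0 : ∀ z, 0 ≤ s z) (hsc : ∀ z, s z ≤ c₁ * √z)
    {w₀ : ℝ → Vec d} {N : ℝ → ℝ≥0∞} (hNm : Measurable N) {b : ℝ≥0∞} (hb : b ≠ ⊤)
    (hNb : ∫⁻ t, N t ^ q ≤ b)
    (hwN : ∀ᵐ r ∂(volume.restrict (Icc (0 : ℝ) T)), ∀ x, ‖w r x - w₀ r‖ ≤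
      (N r).toReal * ((2 * ∫ y, ρ r y) ^ (1 - θ) * (2 * ∑ i, ∫ x, |G r x i|) ^ θ)) :
    ∀ᵐ t ∂(volume.restrict (Icc (0 : ℝ) T)), (∫ x, entropyFn (ρ t x + δ))
        + (∫ r in (0 : ℝ)..t, ∫ x, (ρ r x + δ)⁻¹ * ‖G r x‖ ^ 2) / 2
      ≤ (∫ x, entropyFn (ρ₀ x + δ)) + c₁ ^ 2 * (∫ z, ‖g z.1 z.2‖ ^ 2 ∂(spaceTime d T))
        + |(4 * driftConst c₁ d θ (∫ x, ρ₀ x)) ^ q| * b.toReal := by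
  obtain ⟨hNi, hNle⟩ := integrable_toReal_rpow hNm hb hNb
  have hE := h.integrable_inv_mul_inner hδ
  have hEs : ∀ᵐ r ∂(volume.restrict (Icc (0 : ℝ) T)), Integrable fun x => (ρ r x + δ)⁻¹
      * inner ℝ (G r x) (s (ρ r x) ^ 2 • w r x + s (ρ r x) • g r x - G r x) := hE.prod_right_ae
  have hA := h.integrable_inv_mul_norm_sq hδ
  have hAi : Integrable (fun r => ∫ x, (ρ r x + δ)⁻¹ * ‖G r x‖ ^ 2)
      (volume.restrict (Icc (0 : ℝ) T)) := hA.integral_prod_left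
  have hBi := integrable_integral_norm_sq hg
  set Q := (4 * driftConst c₁ d θ (∫ x, ρ₀ x)) ^ q with hQ
  have hslice : ∀ᵐ r ∂(volume.restrict (Icc (0 : ℝ) T)),
      ∫ x, (ρ r x + δ)⁻¹ * inner ℝ (G r x) (s (ρ r x) ^ 2 • w r x + s (ρ r x) • g r x - G r x)
        ≤ c₁ ^ 2 * (∫ x, ‖g r x‖ ^ 2) + Q * (N r).toReal ^ q
          - (∫ x, (ρ r x + δ)⁻¹ * ‖G r x‖ ^ 2) / 2 := by
    filter_upwards [hEs, h.ae_memLp, h.ae_nonneg, h.integral_eq, ae_memLp_two_slice h.l2h1.2.1,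
      h.l2h1.2.2, ae_memLp_two_slice hg, ae_aestronglyMeasurable_slice hw, hwN]
      with r h1 h2 h3 h4 h5 h6 h7 h8 h9
    have h10 := integral_inv_mul_inner_flux_le h6 h2 h5 h3 hδ hδ1 hθ0 hq hθq hs hs0 hsc h7 h8
      ENNReal.toReal_nonneg (Eventually.of_forall h9) h1
    have hM : 0 ≤ ∫ x, ρ₀ x := integral_nonneg_of_ae h.init_nonneg
    have hdc : 0 ≤ driftConst c₁ d θ (∫ x, ρ₀ x) := by unfold driftConst; positivity
    -- Conservation of mass, `h4`, makes the constant `Q` independent of time.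
    rwa [h4, ← mul_assoc, Real.mul_rpow (by positivity) ENNReal.toReal_nonneg] at h10
  filter_upwards [h.integral_entropyFn_add_le hδ, ae_Icc_mem] with t ht htm
  have hsub : Ioc 0 t ⊆ Icc 0 T := fun r hr => ⟨hr.1.le, hr.2.trans htm.2⟩
  rw [setIntegral_spaceTime_eq (f := fun r x => (ρ r x + δ)⁻¹ * inner ℝ (G r x)
    (s (ρ r x) ^ 2 • w r x + s (ρ r x) • g r x - G r x)) hE htm] at ht
  have hEi : Integrable (fun r => ∫ x, (ρ r x + δ)⁻¹ * inner ℝ (G r x)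
    (s (ρ r x) ^ 2 • w r x + s (ρ r x) • g r x - G r x)) (volume.restrict (Icc (0 : ℝ) T)) :=
    hE.integral_prod_left
  have iA := Integrable.intervalIntegrable_of_mem_Icc hAi htm
  have iB := Integrable.intervalIntegrable_of_mem_Icc hBi htm
  have iN := Integrable.intervalIntegrable_of_mem_Icc hNi.restrict htm
  have iE := Integrable.intervalIntegrable_of_mem_Icc hEi htm
  have hmono := intervalIntegral.integral_mono_ae_restrict htm.1 iE
    (((iB.const_mul (c₁ ^ 2)).add (iN.const_mul Q)).sub (iA.div_const 2))
    (ae_restrict_of_ae_restrict_of_subset (Icc_subset_Icc le_rfl htm.2) hslice)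
  have e1 : (∫ r in (0 : ℝ)..t, (c₁ ^ 2 * (∫ x, ‖g r x‖ ^ 2) + Q * (N r).toReal ^ q
        - (∫ x, (ρ r x + δ)⁻¹ * ‖G r x‖ ^ 2) / 2))
      = c₁ ^ 2 * (∫ r in (0 : ℝ)..t, ∫ x, ‖g r x‖ ^ 2) + Q * (∫ r in (0 : ℝ)..t, (N r).toReal ^ q)
        - (∫ r in (0 : ℝ)..t, ∫ x, (ρ r x + δ)⁻¹ * ‖G r x‖ ^ 2) / 2 := by
    rw [intervalIntegral.integral_sub ((iB.const_mul (c₁ ^ 2)).add (iN.const_mul Q))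
      (iA.div_const 2), intervalIntegral.integral_add (iB.const_mul (c₁ ^ 2)) (iN.const_mul Q),
      intervalIntegral.integral_const_mul, intervalIntegral.integral_const_mul,
      intervalIntegral.integral_div]
  have hB : ∫ r in (0 : ℝ)..t, ∫ x, ‖g r x‖ ^ 2 ≤ ∫ z, ‖g z.1 z.2‖ ^ 2 ∂(spaceTime d T) := by
    rw [← setIntegral_spaceTime_eq (f := fun r x => ‖g r x‖ ^ 2) hg.norm.integrable_sq htm]
    exact setIntegral_le_integral hg.norm.integrable_sq
      (Eventually.of_forall fun z => sq_nonneg _)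
  have hNt0 : 0 ≤ ∫ r in (0 : ℝ)..t, (N r).toReal ^ q :=
    intervalIntegral.integral_nonneg htm.1 fun r _ => by positivity
  have hNt : ∫ r in (0 : ℝ)..t, (N r).toReal ^ q ≤ b.toReal := by
    rw [intervalIntegral.integral_of_le htm.1]
    exact (setIntegral_le_integral hNi (Eventually.of_forall fun r =>
      Real.rpow_nonneg ENNReal.toReal_nonneg _)).trans hNle
  have hQN : Q * (∫ r in (0 : ℝ)..t, (N r).toReal ^ q) ≤ |Q| * b.toReal :=
    mul_le_mul (le_abs_self _) hNt hNt0 (abs_nonneg _)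
  have hcB := mul_le_mul_of_nonneg_left hB (sq_nonneg c₁)
  have hmono' := hmono.trans_eq e1
  linarith

end EntropyEstimate

/-! ### The weak gradient of the square root -/

section SquareRoot

variable {d : ℕ} {f : Torus d → ℝ} {G : Torus d → Vec d}

/-- The gradient of the square root of a nonnegative function. -/
noncomputable def sqrtGrad (z : ℝ) (G : Vec d) : Vec d := (2 * √z)⁻¹ • G

theorem tendsto_one_div_add_one : Tendsto (fun n : ℕ => 1 / ((n : ℝ) + 1)) atTop (𝓝 0) :=
  tendsto_one_div_add_atTop_nhds_zero_nat

theorem integral_inv_two_mul_sqrt {δ z : ℝ} (hδ : 0 < δ) (hz : 0 ≤ z) :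
    ∫ y in (0 : ℝ)..z, (2 * √(max y 0 + δ))⁻¹ = √(z + δ) - √δ := by
  have hd : ∀ y ∈ uIcc 0 z, HasDerivAt (fun y => √(y + δ)) ((2 * √(y + δ))⁻¹) y := by
    intro y hy
    rw [uIcc_of_le hz] at hy
    have := ((hasDerivAt_id y).add_const δ).sqrt (by simp only [id]; linarith [hy.1])
    simpa using this
  have hc : ContinuousOn (fun y => (2 * √(y + δ))⁻¹) (uIcc 0 z) := by
    rw [uIcc_of_le hz]
    refine ContinuousOn.inv₀ (by fun_prop) fun y hy => ?_
    have : 0 < √(y + δ) := Real.sqrt_pos.2 (by linarith [hy.1])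
    positivity
  have h1 := intervalIntegral.integral_eq_sub_of_hasDerivAt hd hc.intervalIntegrable
  rw [zero_add] at h1
  rw [← h1]
  refine intervalIntegral.integral_congr fun y hy => ?_
  rw [uIcc_of_le hz] at hy
  simp only [max_eq_left hy.1]

/-- The square root is not `C¹` at `0`, so the chain rule is applied to `√(f + δ) - √δ`. Because `G`
vanishes where `f` does, these gradients are dominated by the limiting one. -/
theorem Skeleton.IsWeakGrad.sqrt (h : IsWeakGrad f G) (hf : MemLp f 2 volume)
    (hG : MemLp G 2 volume) (hf0 : ∀ᵐ x, 0 ≤ f x) (hG0 : ∀ᵐ x, f x = 0 → G x = 0)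
    (hH : Integrable fun x => sqrtGrad (f x) (G x)) :
    IsWeakGrad (fun x => √(f x)) fun x => sqrtGrad (f x) (G x) := by
  set δ : ℕ → ℝ := fun n => 1 / ((n : ℝ) + 1) with hδ
  have hδ0 : ∀ n, 0 < δ n := fun n => by positivity
  have hδt : Tendsto δ atTop (𝓝 0) := tendsto_one_div_add_one
  have hfm : AEStronglyMeasurable (fun x => √(f x)) volume :=
    Real.continuous_sqrt.comp_aestronglyMeasurable hf.1
  have hsq : Integrable fun x => √(f x) := by
    refine (h.1.add (integrable_const 1)).mono' hfm (hf0.mono fun x hx => ?_)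
    rw [Real.norm_eq_abs, abs_of_nonneg (Real.sqrt_nonneg _)]
    simp only [Pi.add_apply]
    nlinarith [Real.sq_sqrt hx, sq_nonneg (√(f x) - 1)]
  set k : ℕ → ℝ → ℝ := fun n z => (2 * √(max z 0 + δ n))⁻¹ with hk
  have hpos : ∀ n z, 0 < √(max z 0 + δ n) := fun n z =>
    Real.sqrt_pos.2 (add_pos_of_nonneg_of_pos (le_max_right _ _) (hδ0 n))
  have hkc : ∀ n, Continuous (k n) := fun n => by
    refine Continuous.inv₀ (by fun_prop) fun z => ?_
    have := hpos n z
    positivity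
  have hkb : ∀ n z, |k n z| ≤ (2 * √(δ n))⁻¹ := fun n z => by
    have h1 := hpos n z
    have h2 : 0 < √(δ n) := Real.sqrt_pos.2 (hδ0 n)
    rw [abs_of_nonneg (by positivity)]
    refine inv_anti₀ (by positivity) ?_
    have := Real.sqrt_le_sqrt (le_add_of_nonneg_left (le_max_right z 0) : δ n ≤ max z 0 + δ n)
    linarith
  have hw := fun n => h.comp_primitive hf hG (hkc n) (hkb n)
  refine ⟨hsq, hH, fun φ hφ i => ?_⟩
  obtain ⟨C, _, hC⟩ := exists_bound_of_continuous (hφ.hasPartial i).cont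
  obtain ⟨C', _, hC'⟩ := exists_bound_of_continuous (hφ.hasPartial i).cont'
  have hφm := (hφ.hasPartial i).cont.aestronglyMeasurable (μ := (volume : Measure (Torus d)))
  have hφm' := (hφ.hasPartial i).cont'.aestronglyMeasurable (μ := (volume : Measure (Torus d)))
  have l1 : Tendsto (fun n => ∫ x, (∫ y in (0 : ℝ)..f x, k n y) * partialDeriv i φ x) atTop
      (𝓝 (∫ x, √(f x) * partialDeriv i φ x)) := by
    refine tendsto_integral_of_dominated_convergence (fun x => √(f x) * C')
      (fun n => (hw n).1.1.mul hφm') (hsq.mul_const C') (fun n => ?_) ?_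
    · filter_upwards [hf0] with x hx
      rw [integral_inv_two_mul_sqrt (hδ0 n) hx, norm_mul]
      refine mul_le_mul ?_ (hC' x) (norm_nonneg _) (Real.sqrt_nonneg _)
      rw [Real.norm_eq_abs, abs_of_nonneg
        (sub_nonneg.2 (Real.sqrt_le_sqrt (le_add_of_nonneg_left hx)))]
      have h1 : √(f x + δ n) ≤ √(f x) + √(δ n) := by
        rw [Real.sqrt_le_left (by positivity)]
        nlinarith [Real.sq_sqrt hx, Real.sq_sqrt (hδ0 n).le,
          mul_nonneg (Real.sqrt_nonneg (f x)) (Real.sqrt_nonneg (δ n))]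
      linarith
    · filter_upwards [hf0] with x hx
      refine Tendsto.mul_const _ ?_
      have h1 : Tendsto (fun n => √(f x + δ n) - √(δ n)) atTop (𝓝 (√(f x + 0) - √0)) :=
        ((Real.continuous_sqrt.tendsto _).comp (hδt.const_add (f x))).sub
          ((Real.continuous_sqrt.tendsto _).comp hδt)
      rw [add_zero, Real.sqrt_zero, sub_zero] at h1
      exact h1.congr fun n => (integral_inv_two_mul_sqrt (hδ0 n) hx).symm
  have l2 : Tendsto (fun n => ∫ x, (k n (f x) • G x) i * φ x) atTop
      (𝓝 (∫ x, sqrtGrad (f x) (G x) i * φ x)) := by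
    refine tendsto_integral_of_dominated_convergence (fun x => ‖sqrtGrad (f x) (G x)‖ * C)
      (fun n => ?_) (hH.norm.mul_const C) (fun n => ?_) ?_
    · exact ((EuclideanSpace.proj (𝕜 := ℝ) i : Vec d →L[ℝ] ℝ).continuous.comp_aestronglyMeasurable
        (hw n).2.1.1).mul hφm
    · filter_upwards [hf0, hG0] with x hx hx0
      rw [norm_mul]
      refine mul_le_mul ((PiLp.norm_apply_le _ i).trans ?_) (hC x) (norm_nonneg _) (norm_nonneg _)
      rcases hx.eq_or_lt with he | hp
      · rw [hx0 he.symm]; simp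
      · rw [sqrtGrad, norm_smul, norm_smul]
        refine mul_le_mul_of_nonneg_right ?_ (norm_nonneg _)
        have h1 : 0 < √(f x) := Real.sqrt_pos.2 hp
        have h2 := hpos n (f x)
        rw [Real.norm_eq_abs, Real.norm_eq_abs, abs_of_nonneg (by positivity),
          abs_of_nonneg (by positivity)]
        refine inv_anti₀ (by positivity) ?_
        rw [max_eq_left hx]
        have := Real.sqrt_le_sqrt (le_add_of_nonneg_right (hδ0 n).le : f x ≤ f x + δ n)
        linarith
    · filter_upwards [hf0, hG0] with x hx hx0
      refine Tendsto.mul_const _ ?_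
      rcases hx.eq_or_lt with he | hp
      · rw [hx0 he.symm]; simp [sqrtGrad]
      · simp only [sqrtGrad, PiLp.smul_apply, smul_eq_mul]
        refine Tendsto.mul_const _ (Tendsto.inv₀ (Tendsto.const_mul 2 ?_) ?_)
        · have h1 := (Real.continuous_sqrt.tendsto _).comp (hδt.const_add (f x))
          rw [add_zero] at h1
          simpa only [max_eq_left hx, Function.comp_def] using h1
        · have : 0 < √(f x) := Real.sqrt_pos.2 hp
          positivity
  refine tendsto_nhds_unique l1 ?_
  exact l2.neg.congr fun n => ((hw n).2.2 φ hφ i).symm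

/-- In `ℝ≥0∞` the limit is also correct at `z = 0`: it is `0` if `G = 0` and `⊤` otherwise. -/
theorem tendsto_inv_add_mul_enorm_sq {z : ℝ} (hz : 0 ≤ z) (G : Vec d) {δ : ℕ → ℝ}
    (hδ0 : ∀ n, 0 < δ n) (hδ : Tendsto δ atTop (𝓝 0)) :
    Tendsto (fun n => ENNReal.ofReal ((z + δ n)⁻¹ * ‖G‖ ^ 2)) atTop
      (𝓝 (‖G‖ₑ ^ 2 / ENNReal.ofReal z)) := by
  have h1 : ∀ n, ENNReal.ofReal ((z + δ n)⁻¹ * ‖G‖ ^ 2) = ‖G‖ₑ ^ 2 / ENNReal.ofReal (z + δ n) :=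
    fun n => by
      have : 0 < z + δ n := add_pos_of_nonneg_of_pos hz (hδ0 n)
      rw [ENNReal.ofReal_mul (by positivity), ENNReal.ofReal_inv_of_pos this,
        ENNReal.ofReal_pow (norm_nonneg _), ofReal_norm, div_eq_mul_inv, mul_comm]
  simp only [h1]
  refine ENNReal.Tendsto.const_div ?_ (Or.inr (by simp))
  have := (ENNReal.continuous_ofReal.tendsto _).comp (hδ.const_add z)
  rwa [add_zero] at this

/-- For `z > 0` this is an equality; at `z = 0` the left side vanishes because `0⁻¹ = 0`. -/
theorem enorm_sqrtGrad_sq_le {z : ℝ} (hz : 0 ≤ z) (G : Vec d) :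
    4 * ‖sqrtGrad z G‖ₑ ^ 2 ≤ ‖G‖ₑ ^ 2 / ENNReal.ofReal z := by
  rcases hz.eq_or_lt with rfl | hp
  · simp [sqrtGrad]
  · have h1 : 4 * ‖sqrtGrad z G‖ ^ 2 = ‖G‖ ^ 2 / z := by
      rw [sqrtGrad, norm_smul, mul_pow, norm_inv, norm_mul, Real.norm_eq_abs, Real.norm_eq_abs,
        abs_of_nonneg (Real.sqrt_nonneg z), inv_pow, mul_pow, Real.sq_sqrt hz]
      norm_num
      field_simp
    refine le_of_eq ?_
    rw [← ofReal_norm, ← ofReal_norm, ← ENNReal.ofReal_pow (norm_nonneg _),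
      ← ENNReal.ofReal_pow (norm_nonneg _), ← ENNReal.ofReal_div_of_pos hp, ← h1,
      ENNReal.ofReal_mul (by norm_num), ENNReal.ofReal_ofNat]

end SquareRoot

/-! ### The limit `δ → 0` -/

section VanishingRegularization

variable {d : ℕ} {T : ℝ} {ρ₀ : Torus d → ℝ} {ρ : ℝ → Torus d → ℝ} {G F : ℝ → Torus d → Vec d}

theorem tendsto_integral_entropyFn_add {f : Torus d → ℝ} (hf : MemLp f 2 volume)
    (hf0 : ∀ᵐ x, 0 ≤ f x) : Tendsto (fun n : ℕ => ∫ x, entropyFn (f x + 1 / ((n : ℝ) + 1))) atTop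
      (𝓝 (∫ x, entropyFn (f x))) := by
  have h1 : Integrable fun x => (f x + 1) ^ 2 + 1 :=
    ((hf.add (memLp_const 1)).integrable_sq).add (integrable_const 1)
  have hc : Continuous entropyFn := Real.continuous_mul_log.sub continuous_id
  refine tendsto_integral_of_dominated_convergence (fun x => (f x + 1) ^ 2 + 1)
    (fun n => hc.comp_aestronglyMeasurable (hf.1.add aestronglyMeasurable_const)) h1
    (fun n => ?_) (Eventually.of_forall fun x => ?_)
  · filter_upwards [hf0] with x hx
    have hn : (0 : ℝ) < 1 / ((n : ℝ) + 1) := by positivity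
    have hn1 : 1 / ((n : ℝ) + 1) ≤ 1 := by
      rw [div_le_one (by positivity)]
      linarith [(Nat.cast_nonneg n : (0 : ℝ) ≤ n)]
    refine (abs_entropyFn_le (by positivity)).trans ?_
    gcongr
  · have := (hc.tendsto _).comp (tendsto_one_div_add_one.const_add (f x))
    rwa [add_zero] at this

theorem lintegral_le_of_tendsto_of_integral_le {α : Type*} [MeasurableSpace α] {μ : Measure α}
    {a : ℕ → α → ℝ} {e : α → ℝ≥0∞} (hai : ∀ n, Integrable (a n) μ) (ha0 : ∀ n, 0 ≤ᵐ[μ] a n)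
    (he : ∀ᵐ x ∂μ, Tendsto (fun n => ENNReal.ofReal (a n x)) atTop (𝓝 (e x))) {B : ℕ → ℝ} {b : ℝ}
    (hB : Tendsto B atTop (𝓝 b)) (h : ∀ n, ∫ x, a n x ∂μ ≤ B n) :
    ∫⁻ x, e x ∂μ ≤ ENNReal.ofReal b := by
  calc ∫⁻ x, e x ∂μ = ∫⁻ x, liminf (fun n => ENNReal.ofReal (a n x)) atTop ∂μ :=
        lintegral_congr_ae (he.mono fun x hx => hx.liminf_eq.symm)
    _ ≤ liminf (fun n => ∫⁻ x, ENNReal.ofReal (a n x) ∂μ) atTop :=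
        lintegral_liminf_le' fun n => (hai n).1.aemeasurable.ennreal_ofReal
    _ ≤ liminf (fun n => ENNReal.ofReal (B n)) atTop := by
        refine liminf_le_liminf (Eventually.of_forall fun n => ?_)
        rw [← ofReal_integral_eq_lintegral_ofReal (hai n) (ha0 n)]
        exact ENNReal.ofReal_le_ofReal (h n)
    _ = _ := ((ENNReal.continuous_ofReal.tendsto b).comp hB).liminf_eq

/-- Fatou is used twice. Over all of `[0, T]` it shows that `‖G‖²/ρ` is integrable, which yields the
regularity of `√ρ`; over `[0, t]`, with the entropy at time `t` kept, it yields the inequality. -/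
theorem ContinuityEquation.entropy_le_of_regularized (h : ContinuityEquation T ρ₀ ρ G F) {R : ℝ}
    (hR : ∀ δ : ℝ, 0 < δ → δ ≤ 1 → ∀ᵐ t ∂(volume.restrict (Icc (0 : ℝ) T)),
      (∫ x, entropyFn (ρ t x + δ)) + (∫ r in (0 : ℝ)..t, ∫ x, (ρ r x + δ)⁻¹ * ‖G r x‖ ^ 2) / 2
        ≤ (∫ x, entropyFn (ρ₀ x + δ)) + R) :
    IsL2H1WithGrad T (fun t x => √(ρ t x)) (fun t x => sqrtGrad (ρ t x) (G t x)) ∧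
      ∀ᵐ t ∂(volume.restrict (Icc (0 : ℝ) T)), Integrable (fun x => entropyFn (ρ t x)) ∧
        (∫ x, entropyFn (ρ t x)) + (∫ s in (0 : ℝ)..t, ∫ x, ‖sqrtGrad (ρ s x) (G s x)‖ ^ 2)
          ≤ (∫ x, entropyFn (ρ₀ x)) + R := by
  set δ : ℕ → ℝ := fun n => 1 / ((n : ℝ) + 1) with hδ
  have hδ0 : ∀ n, 0 < δ n := fun n => by positivity
  have hδ1 : ∀ n, δ n ≤ 1 := fun n => by
    rw [hδ, div_le_one (by positivity)]
    linarith [(Nat.cast_nonneg n : (0 : ℝ) ≤ n)]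
  have hδt : Tendsto δ atTop (𝓝 0) := tendsto_one_div_add_one
  have hRn := ae_all_iff.2 fun n => hR (δ n) (hδ0 n) (hδ1 n)
  have hA := fun n => h.integrable_inv_mul_norm_sq (hδ0 n)
  have hA0 : ∀ n, 0 ≤ᵐ[spaceTime d T]
      fun z : ℝ × Torus d => (ρ z.1 z.2 + δ n)⁻¹ * ‖G z.1 z.2‖ ^ 2 := fun n =>
    h.nonneg.mono fun z hz => by
      have := hδ0 n
      simp only [Pi.zero_apply]; positivity
  have hAt : ∀ᵐ z ∂(spaceTime d T),
      Tendsto (fun n => ENNReal.ofReal ((ρ z.1 z.2 + δ n)⁻¹ * ‖G z.1 z.2‖ ^ 2)) atTop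
        (𝓝 (‖G z.1 z.2‖ₑ ^ 2 / ENNReal.ofReal (ρ z.1 z.2))) :=
    h.nonneg.mono fun z hz => tendsto_inv_add_mul_enorm_sq hz _ hδ0 hδt
  have hE₀ := tendsto_integral_entropyFn_add (h.init.mono_exponent le_top) h.init_nonneg
  have hAi : ∀ n, Integrable (fun r => ∫ x, (ρ r x + δ n)⁻¹ * ‖G r x‖ ^ 2)
      (volume.restrict (Icc (0 : ℝ) T)) := fun n => (hA n).integral_prod_left
  -- The `+ 1` comes from `Ψ ≥ -1` on a probability space. The hypothesis holds only for almost
  -- every `t`; continuity of the primitive in time brings it to `t = T`.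
  have hfull : ∫⁻ z, ‖G z.1 z.2‖ₑ ^ 2 / ENNReal.ofReal (ρ z.1 z.2) ∂(spaceTime d T)
      ≤ ENNReal.ofReal (2 * ((∫ x, entropyFn (ρ₀ x)) + R + 1)) := by
    refine lintegral_le_of_tendsto_of_integral_le hA hA0 hAt
      (((hE₀.add_const R).add_const 1).const_mul 2) fun n => ?_
    have h1 : ∀ t ∈ Icc (0 : ℝ) T, ∫ r in (0 : ℝ)..t, ∫ x, (ρ r x + δ n)⁻¹ * ‖G r x‖ ^ 2
        ≤ 2 * ((∫ x, entropyFn (ρ₀ x + δ n)) + R + 1) := by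
      refine ae_le_forall_le h.pos ?_ ?_
      · have hi : IntegrableOn (fun r => ∫ x, (ρ r x + δ n)⁻¹ * ‖G r x‖ ^ 2) (uIcc 0 T) := by
          rw [uIcc_of_le h.pos.le]; exact hAi n
        have := intervalIntegral.continuousOn_primitive_interval hi
        rwa [uIcc_of_le h.pos.le] at this
      · filter_upwards [hRn, h.ae_nonneg, h.ae_memLp] with t ht h2 h3
        have h4 : -1 ≤ ∫ x, entropyFn (ρ t x + δ n) := by
          have h5 := integral_mono_ae (integrable_const (-1 : ℝ))
            (integrable_entropyFn_add h3 h2 (hδ0 n).le)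
            (h2.mono fun x hx => neg_one_le_entropyFn (add_nonneg hx (hδ0 n).le))
          simpa using h5
        linarith [ht n]
    refine le_trans (le_of_eq ?_) (h1 T ⟨h.pos.le, le_rfl⟩)
    rw [intervalIntegral.integral_of_le h.pos.le, ← integral_Icc_eq_integral_Ioc]
    exact integral_prod _ (hA n)
  have hHm : AEStronglyMeasurable (Function.uncurry fun t x => sqrtGrad (ρ t x) (G t x))
      (spaceTime d T) :=
    ((Real.continuous_sqrt.measurable.comp_aemeasurable
      h.l2h1.1.1.aemeasurable).const_mul 2).inv.aestronglyMeasurable.smul h.l2h1.2.1.1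
  have hH : MemLp (Function.uncurry fun t x => sqrtGrad (ρ t x) (G t x)) 2 (spaceTime d T) := by
    refine ⟨hHm, ?_⟩
    have hfin : eLpNorm (Function.uncurry fun t x => sqrtGrad (ρ t x) (G t x)) 2
        (spaceTime d T) ^ 2 < ⊤ := by
      rw [eLpNorm_two_sq]
      refine lt_of_le_of_lt (lintegral_mono_ae ?_) (hfull.trans_lt ENNReal.ofReal_lt_top)
      filter_upwards [h.nonneg] with z hz
      refine le_trans ?_ (enorm_sqrtGrad_sq_le hz (G z.1 z.2))
      exact le_mul_of_one_le_left zero_le (by norm_num)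
    exact (ENNReal.pow_lt_top_iff.1 hfin).resolve_right (by norm_num)
  -- Where `ρ = 0` and `G ≠ 0` the quotient is `⊤`, which its finite integral forbids outside a null
  -- set.
  have hG0 : ∀ᵐ z ∂(spaceTime d T), ρ z.1 z.2 = 0 → G z.1 z.2 = 0 := by
    have hm : AEMeasurable (fun z : ℝ × Torus d =>
        ‖G z.1 z.2‖ₑ ^ 2 / ENNReal.ofReal (ρ z.1 z.2)) (spaceTime d T) :=
      (h.l2h1.2.1.1.enorm.pow_const 2).div h.l2h1.1.1.aemeasurable.ennreal_ofReal
    filter_upwards [ae_lt_top' hm (ne_top_of_le_ne_top ENNReal.ofReal_ne_top hfull)] with z hz hz0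
    by_contra hne
    rw [hz0, ENNReal.ofReal_zero, ENNReal.div_zero (by simp [hne])] at hz
    exact lt_irrefl _ hz
  have hsq : MemLp (Function.uncurry fun t x => √(ρ t x)) 2 (spaceTime d T) := by
    refine (memLp_two_iff_integrable_sq
      (Real.continuous_sqrt.comp_aestronglyMeasurable h.l2h1.1.1)).2 ?_
    refine (h.l2h1.1.integrable (by norm_num)).congr (h.nonneg.mono fun z hz => ?_)
    exact (Real.sq_sqrt hz).symm
  have hG0' : ∀ᵐ t ∂(volume.restrict (Icc (0 : ℝ) T)), ∀ᵐ x, ρ t x = 0 → G t x = 0 :=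
    Measure.ae_ae_of_ae_prod hG0
  refine ⟨⟨hsq, hH, ?_⟩, ?_⟩
  · filter_upwards [h.l2h1.2.2, h.ae_memLp, ae_memLp_two_slice h.l2h1.2.1, h.ae_nonneg, hG0',
      ae_memLp_two_slice hH] with t h1 h2 h3 h4 h5 h6
    exact h1.sqrt h2 h3 h4 h5 (h6.integrable (by norm_num))
  · filter_upwards [hRn, h.ae_nonneg, h.ae_memLp, ae_Icc_mem] with t ht h2 h3 htm
    refine ⟨by simpa using integrable_entropyFn_add h3 h2 le_rfl, ?_⟩
    have hEt := tendsto_integral_entropyFn_add h3 h2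
    have hle : ∫⁻ z in Ioc 0 t ×ˢ univ, ‖G z.1 z.2‖ₑ ^ 2 / ENNReal.ofReal (ρ z.1 z.2)
        ∂(spaceTime d T)
        ≤ ENNReal.ofReal (2 * ((∫ x, entropyFn (ρ₀ x)) + R - ∫ x, entropyFn (ρ t x))) := by
      refine lintegral_le_of_tendsto_of_integral_le (fun n => (hA n).integrableOn)
        (fun n => ae_restrict_of_ae (hA0 n)) (ae_restrict_of_ae hAt)
        (((hE₀.add_const R).sub hEt).const_mul 2) fun n => ?_
      rw [setIntegral_spaceTime_eq (f := fun r x => (ρ r x + δ n)⁻¹ * ‖G r x‖ ^ 2) (hA n) htm]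
      linarith [ht n]
    have hH2 : Integrable (Function.uncurry fun t x => ‖sqrtGrad (ρ t x) (G t x)‖ ^ 2)
        (spaceTime d T) := hH.norm.integrable_sq
    have hHle : ENNReal.ofReal (4 * ∫ z in Ioc 0 t ×ˢ univ,
        ‖sqrtGrad (ρ z.1 z.2) (G z.1 z.2)‖ ^ 2 ∂(spaceTime d T))
        ≤ ENNReal.ofReal (2 * ((∫ x, entropyFn (ρ₀ x)) + R - ∫ x, entropyFn (ρ t x))) := by
      refine le_trans ?_ hle
      have h4 : Integrable (fun z : ℝ × Torus d => 4 * ‖sqrtGrad (ρ z.1 z.2) (G z.1 z.2)‖ ^ 2)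
          ((spaceTime d T).restrict (Ioc 0 t ×ˢ univ)) := hH2.integrableOn.const_mul 4
      rw [← integral_const_mul, ofReal_integral_eq_lintegral_ofReal h4
        (Eventually.of_forall fun z => mul_nonneg (by norm_num) (sq_nonneg _))]
      refine lintegral_mono_ae (ae_restrict_of_ae (h.nonneg.mono fun z hz => ?_))
      rw [ENNReal.ofReal_mul (by norm_num), ENNReal.ofReal_pow (norm_nonneg _), ofReal_norm,
        ENNReal.ofReal_ofNat]
      exact enorm_sqrtGrad_sq_le hz _
    rw [← setIntegral_spaceTime_eq hH2 htm]
    have hint0 : 0 ≤ ∫ z in Ioc 0 t ×ˢ univ,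
        ‖sqrtGrad (ρ z.1 z.2) (G z.1 z.2)‖ ^ 2 ∂(spaceTime d T) :=
      integral_nonneg fun z => sq_nonneg _
    -- `ENNReal.ofReal` truncates negative numbers, so the sign is needed to return to a real
    -- inequality.
    have hlim0 : 0 ≤ (∫ x, entropyFn (ρ₀ x)) + R - ∫ x, entropyFn (ρ t x) := by
      have h5 : ∀ n, 0 ≤ (∫ x, entropyFn (ρ₀ x + δ n)) + R - ∫ x, entropyFn (ρ t x + δ n) :=
        fun n => by
          have h6 : 0 ≤ ∫ r in (0 : ℝ)..t, ∫ x, (ρ r x + δ n)⁻¹ * ‖G r x‖ ^ 2 := by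
            rw [← setIntegral_spaceTime_eq (f := fun r x => (ρ r x + δ n)⁻¹ * ‖G r x‖ ^ 2)
              (hA n) htm]
            exact integral_nonneg_of_ae (ae_restrict_of_ae (hA0 n))
          linarith [ht n]
      exact ge_of_tendsto' ((hE₀.add_const R).sub hEt) h5
    have := (ENNReal.ofReal_le_ofReal_iff (by linarith)).1 hHle
    linarith

end VanishingRegularization

/-! ### Consequences of the assumptions on the coefficients -/

section Coefficients

/-- Extension to the negative half-line by the value at `0`; the bound by `c₁√z` persists because
`√z = 0` there. -/
theorem Skeleton.SqrtApprox.exists_extension {c₁ : ℝ} {σ : ℝ → ℝ → ℝ} (hσ : SqrtApprox c₁ σ)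
    {η : ℝ} (hη : η ∈ Ioo (0 : ℝ) 1) : ∃ s : ℝ → ℝ, Continuous s ∧ (∀ z, 0 ≤ s z) ∧
      (∀ z, s z ≤ c₁ * √z) ∧ (∃ K, ∀ z, |s z| ≤ K) ∧ ∀ z, 0 ≤ z → s z = σ η z := by
  refine ⟨fun z => σ η (max z 0), ?_, fun z => (hσ.bound η hη _ (le_max_right _ _)).1, fun z => ?_,
    ?_, fun z hz => by simp only [max_eq_left hz]⟩
  · exact (hσ.smooth η hη).continuousOn.comp_continuous (continuous_id.max continuous_const)
      fun z => mem_Ici.2 (le_max_right _ _)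
  · refine (hσ.bound η hη _ (le_max_right _ _)).2.trans_eq ?_
    rcases le_total 0 z with hz | hz
    · rw [max_eq_left hz]
    · rw [max_eq_right hz, Real.sqrt_eq_zero_of_nonpos hz, Real.sqrt_zero]
  · obtain ⟨K, hK⟩ := hσ.bounded η hη
    exact ⟨K, fun z => (hK _ (le_max_right _ _)).1⟩

variable {d : ℕ} {T : ℝ} {p pstar : ℝ≥0∞} {V : ℝ → Torus d → Vec d}

theorem Skeleton.LPSKernel.two_le_toReal (hV : LPSKernel T p pstar V) : 2 ≤ pstar.toReal := by
  have := ENNReal.toReal_mono hV.lt_top.ne hV.two_le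
  simpa using this

/-- The scaling condition in the form `1/p ≤ θ/d` with `θ = 1 - 2/p*`; working with `p⁻¹` includes
`p = ⊤`. -/
theorem Skeleton.LPSKernel.inv_le (hV : LPSKernel T p pstar V) (hd : 0 < d) :
    p⁻¹ ≤ ENNReal.ofReal ((1 - 2 / pstar.toReal) / d) := by
  have hp0 : p ≠ 0 := (zero_le.trans_lt hV.dim_lt).ne'
  have hpi : p⁻¹ ≠ ⊤ := ENNReal.inv_ne_top.2 hp0
  have hd' : (0 : ℝ) < d := by exact_mod_cast hd
  have hq : pstar ≠ 0 := (lt_of_lt_of_le (by norm_num) hV.two_le).ne'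
  have h1 := ENNReal.toReal_mono ENNReal.one_ne_top hV.scaling
  rw [div_eq_mul_inv, ENNReal.toReal_add (ENNReal.mul_ne_top (by simp) hpi)
    (ENNReal.div_ne_top (by simp) hq), ENNReal.toReal_mul, ENNReal.toReal_div] at h1
  simp only [ENNReal.toReal_natCast, ENNReal.toReal_ofNat, ENNReal.toReal_one] at h1
  rw [← ENNReal.ofReal_toReal hpi]
  refine ENNReal.ofReal_le_ofReal ?_
  rw [le_div_iff₀ hd']
  linarith

theorem Skeleton.LPSKernel.inv_one_sub_inv_le_two (hV : LPSKernel T p pstar V) (hd : 2 ≤ d) :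
    (1 - p⁻¹)⁻¹ ≤ 2 := by
  have h1 : (2 : ℝ≥0∞) ≤ p := le_trans (by exact_mod_cast hd) hV.dim_lt.le
  rw [ENNReal.inv_le_iff_inv_le]
  refine ENNReal.le_sub_of_add_le_right (ENNReal.inv_ne_top.2 (zero_lt_two.trans_le h1).ne')
    ((add_le_add le_rfl (ENNReal.inv_le_inv.2 h1)).trans_eq ?_)
  exact ENNReal.inv_two_add_inv_two

end Coefficients

/-! ### Assembly of the estimate -/

theorem Skeleton.IsWeakSolution.entropy_estimate {d : ℕ} {T : ℝ} {p pstar : ℝ≥0∞}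
    {V g : ℝ → Torus d → Vec d} {c₁ : ℝ} {σ : ℝ → ℝ → ℝ} {κ : ℝ × (Fin d → ℝ) → ℝ}
    {ρ₀ : Torus d → ℝ} (hd : 2 ≤ d) (hT : 0 < T) (hV : LPSKernel T p pstar V)
    (hσ : SqrtApprox c₁ σ) (hκ : IsConvKernel κ) (hρ₀ : MemLp ρ₀ ⊤ volume)
    (hρ₀0 : ∀ᵐ x, 0 ≤ ρ₀ x) (hg : MemLp (Function.uncurry g) 2 (spaceTime d T)) {η γ : ℝ}
    (hη : η ∈ Ioo (0 : ℝ) 1) (hγ : 0 < γ) {ρ : ℝ → Torus d → ℝ}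
    (h : IsWeakSolution T (σ η) (mollify T κ γ V) g ρ₀ ρ) :
    ∃ G : ℝ → Torus d → Vec d, IsL2H1WithGrad T (fun t x => √(ρ t x)) G ∧
      ∀ᵐ t ∂(volume.restrict (Icc (0 : ℝ) T)), Integrable (fun x => entropyFn (ρ t x)) ∧
        (∫ x, entropyFn (ρ t x)) + (∫ s in (0 : ℝ)..t, ∫ x, ‖G s x‖ ^ 2)
          ≤ (∫ x, entropyFn (ρ₀ x)) + (c₁ ^ 2 * (∫ z, ‖g z.1 z.2‖ ^ 2 ∂(spaceTime d T))
            + |(4 * driftConst c₁ d (1 - 2 / pstar.toReal) (∫ x, ρ₀ x)) ^ pstar.toReal|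
              * (mixedNorm T pstar p V).toReal ^ pstar.toReal) := by
  obtain ⟨s, hs, hs0, hsc, ⟨K, hK⟩, hsσ⟩ := hσ.exists_extension hη
  obtain ⟨U, hU, hUV⟩ := exists_extension hV.measurable
  set q := pstar.toReal with hq
  have hq2 : 2 ≤ q := hV.two_le_toReal
  have hp1 : 1 ≤ p := le_trans (by exact_mod_cast (by omega : 1 ≤ d)) hV.dim_lt.le
  -- The conjugate exponent in a form that gives `p' = 1` for `p = ⊤`.
  set p' := (1 - p⁻¹)⁻¹ with hp'
  have hconj : p.HolderConjugate p' := ENNReal.HolderConjugate.inv_one_sub_inv' hp1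
  have : ENNReal.HolderTriple p' p 1 := hconj.symm
  have hp'2 : p' ≤ 2 := hV.inv_one_sub_inv_le_two hd
  have hpstar0 : pstar ≠ 0 := (lt_of_lt_of_le (by norm_num) hV.two_le).ne'
  have hslice := lintegral_sliceNorm_rpow hUV (p := p) hpstar0 hV.lt_top.ne
  have hbtop : mixedNorm T pstar p V ^ q ≠ ⊤ :=
    ENNReal.rpow_ne_top_of_nonneg (by linarith) hV.finite.ne
  have hfin := lintegral_sliceNorm_ne_top hUV (p := p) (q := q) (by linarith)
    (by rw [hslice]; exact hbtop)
  set k := scaledKernel κ γ with hkdef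
  have hk := continuous_scaledKernel hκ γ
  have hk0 := scaledKernel_nonneg hκ hγ
  have hkc := hasCompactSupport_scaledKernel hκ hγ
  obtain ⟨C, hC⟩ := exists_avgNorm_le hk hkc hU hfin
  have hw := memLp_conv_mconv hk hk0 hU hp'2 hC h.2.2.choose_spec.1.1
  obtain ⟨G, hce⟩ := h.exists_continuityEquation hT hρ₀ hρ₀0 hg hs hK hsσ hw
    ((ae_mollify_eq hUV κ γ).mono fun r hr x => conv_congr_ae hr _ x)
  have hNb : ∫⁻ t, avgNorm k p U t ^ q ≤ mixedNorm T pstar p V ^ q :=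
    (lintegral_avgNorm_rpow_le hk hk0 (hk.integrable_of_hasCompactSupport hkc)
      (integral_scaledKernel hκ hγ) hU p (by linarith)).trans_eq hslice
  -- The interpolation weight is `θ = 1 - 2/q`, so that `(1 + θ)/2 = 1 - 1/q` and Young produces
  -- exactly the power `q = p*` of the kernel norm.
  have hθ0 : 0 ≤ 1 - 2 / q := by
    rw [sub_nonneg, div_le_one (by linarith)]; exact hq2
  have hwN : ∀ᵐ r ∂(volume.restrict (Icc (0 : ℝ) T)), ∀ x,
      ‖conv (mconv k U r) (ρ r) x - (∫ y, ρ r y) • ∫ y, mconv k U r y‖ ≤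
        (avgNorm k p U r).toReal * ((2 * ∫ y, ρ r y) ^ (1 - (1 - 2 / q))
          * (2 * ∑ i, ∫ x, |G r x i|) ^ (1 - 2 / q)) := by
    filter_upwards [hce.ae_memLp, hce.ae_nonneg, ae_memLp_two_slice hce.l2h1.2.1, hce.l2h1.2.2]
      with r h1 h2 h3 h4 x
    have hM : 0 ≤ ∫ y, ρ r y := integral_nonneg_of_ae h2
    have hS : 0 ≤ ∑ i, ∫ x, |G r x i| :=
      Finset.sum_nonneg fun i _ => integral_nonneg fun x => abs_nonneg _
    refine norm_conv_mconv_sub_le (p' := p') hk hk0 hU hp'2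
      (ne_top_of_le_ne_top ENNReal.coe_ne_top (hC r)) h1 _ (by positivity) ?_ x
    refine eLpNorm_sub_integral_le h4 h1 h3 h2 hd hθ0 ?_ ?_
    · have : 0 ≤ 2 / q := by positivity
      linarith
    · rw [hp', inv_inv]
      exact tsub_le_tsub_left (hV.inv_le (by omega)) 1
  refine ⟨_, hce.entropy_le_of_regularized fun δ hδ hδ1 => ?_⟩
  have := hce.entropy_add_dissipation_le hg hw.1 hδ hδ1 hθ0 (by linarith)
    (by field_simp; ring) hs hs0 hsc (measurable_avgNorm hk p hU) hbtop hNb hwN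
  rw [← ENNReal.toReal_rpow] at this
  simpa only [add_assoc] using this

theorem proposition4 :
    ∃ (c : ℝ → ℝ) (C : ℝ → ℕ → ℝ≥0∞ → ℝ≥0∞ → ℝ → ℝ → ℝ),
      (∀ c₁, 0 < c c₁) ∧ (∀ c₁ d p pstar m N, 0 < C c₁ d p pstar m N) ∧
      ∀ (d : ℕ) (T : ℝ) (p pstar : ℝ≥0∞) (V : ℝ → Torus d → Vec d)
        (c₁ : ℝ) (σ : ℝ → ℝ → ℝ) (κ : ℝ × (Fin d → ℝ) → ℝ)
        (ρ₀ : Torus d → ℝ) (g : ℝ → Torus d → Vec d),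
        2 ≤ d → 0 < T → LPSKernel T p pstar V → SqrtApprox c₁ σ → IsConvKernel κ →
        MemLp ρ₀ ⊤ volume → (∀ᵐ x, 0 ≤ ρ₀ x) →
        MemLp (Function.uncurry g) 2 (spaceTime d T) →
        ∀ (η γ : ℝ), η ∈ Ioo (0 : ℝ) 1 → γ ∈ Ioo (0 : ℝ) 1 →
        ∀ ρ : ℝ → Torus d → ℝ, IsWeakSolution T (σ η) (mollify T κ γ V) g ρ₀ ρ →
          ∃ G : ℝ → Torus d → Vec d, IsL2H1WithGrad T (fun t x => √(ρ t x)) G ∧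
            ∀ᵐ t ∂(volume.restrict (Icc (0 : ℝ) T)),
              Integrable (fun x => entropyFn (ρ t x)) ∧
              (∫ x, entropyFn (ρ t x)) + (∫ s in (0 : ℝ)..t, ∫ x, ‖G s x‖ ^ 2)
                ≤ (∫ x, entropyFn (ρ₀ x))
                  + c c₁ * (∫ z, ‖g z.1 z.2‖ ^ 2 ∂(spaceTime d T))
                  + C c₁ d p pstar (∫ x, |ρ₀ x|) (mixedNorm T pstar p V).toReal := by
  -- The summands `1` and the absolute values only secure positivity for arbitrary real arguments.
  refine ⟨fun c₁ => c₁ ^ 2 + 1, fun c₁ d _ pstar m N =>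
    |(4 * driftConst c₁ d (1 - 2 / pstar.toReal) m) ^ pstar.toReal| * |N ^ pstar.toReal| + 1,
    fun c₁ => by positivity, fun c₁ d p pstar m N => by positivity, ?_⟩
  intro d T p pstar V c₁ σ κ ρ₀ g hd hT hV hσ hκ hρ₀ hρ₀0 hg η γ hη hγ ρ h
  obtain ⟨G, hG, hG'⟩ := h.entropy_estimate hd hT hV hσ hκ hρ₀ hρ₀0 hg hη hγ.1
  refine ⟨G, hG, hG'.mono fun t ht => ⟨ht.1, ht.2.trans ?_⟩⟩
  have habs : ∫ x, |ρ₀ x| = ∫ x, ρ₀ x :=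
    integral_congr_ae (hρ₀0.mono fun x hx => abs_of_nonneg hx)
  have hg0 : 0 ≤ ∫ z, ‖g z.1 z.2‖ ^ 2 ∂(spaceTime d T) := integral_nonneg fun z => sq_nonneg _
  beta_reduce
  rw [habs, abs_of_nonneg (Real.rpow_nonneg (ENNReal.toReal_nonneg (a := mixedNorm T pstar p V)) _)]
  linarith
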